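/- **Setting.** Let $d\in\mathbb N$, $H_{\mathbb C}=L^2(\mathbb R^d\to\mathbb C)$ with scalar product $(\cdot,\cdot)$ antilinear in the first argument, $J$ the complex conjugation, $F f(p)=(2\pi)^{-d/2}\int e^{-ix\cdot p}f(x)\,dx$ the unitary Fourier transform, and let $\hat k\in L^1(\mathbb R^d)$ with $0\le\hat k\le1$ a.e. Put $K_1=F^{-1}\hat k^{1/2}F$, $K_2=F^{-1}(1-\hat k)^{1/2}F$, $\kappa_1=(2\pi)^{-d/2}F^{-1}\hat k^{1/2}\in L^2_{\mathbb C}(\mathbb R^d)$, $\kappa_2=(2\pi)^{-d/2}F^{-1}(1-\hat k)^{1/2}\in S'_{\mathbb C}(\mathbb R^d)$, and let $\kappa_{i,x}$ be the translate with $\langle\kappa_{i,x},\varphi\rangle=\langle\kappa_i,\varphi(x+\cdot)\rangle$ ($\langle\cdot,\cdot\rangle$ the pairing generated by the scalar product, antilinear in the first argument). Let $\mathcal F^{(n)}_{\mathrm a}=(H_{\mathbb C}\oplus H_{\mathbb C})^{\wedge n}$, where $h_1\wedge\dots\wedge h_n$ is the antisymmetrization $\frac1{n!}\sum_\sigma\operatorname{sgn}(\sigma)\,h_{\sigma(1)}\otimes\dots\otimes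 h_{\sigma(n)}$, let $\mathcal F_{\mathrm{a,fin}}(H\oplus H)$ be the topological (locally convex) direct sum of the $\mathcal F^{(n)}_{\mathrm a}$, $n\ge0$, and let $\mathcal F_{\mathrm{a,fin}}(\Phi)$ be the topological direct sum of the spaces $\mathcal F^{(n)}_{\mathrm a}(\Phi)$ of antisymmetric elements of the completed tensor powers of $\Phi=S_{\mathbb C}(\mathbb R^d)\oplus S_{\mathbb C}(\mathbb R^d)$, with dual $\mathcal F^*_{\mathrm{a,fin}}(\Phi)\supset\mathcal F_{\mathrm{a,fin}}(H\oplus H)$ with respect to the Fock scalar product. Let $a^*(f)u=\sqrt{n+1}\,f\wedge u$ for $u\in\mathcal F_{\mathrm a}^{(n)}$ be the creation operators and $a(f)$ their adjoints, the annihilation operators; $a$ is extended to $\Phi'=S'_{\mathbb C}\oplus S'_{\mathbb C}$ as operators on $\mathcal F_{\mathrm{a,fin}}(\Phi)$, and $a^*$ to $\Phi'$ by duality, with values in $\mathcal F^*_{\mathrm{a,fin}}(\Phi)$. Write $a_1^\sharp(f)=a^\sharp(f,0)$, $a_2^\sharp(f)=a^\sharp(0,f)$, where $a^\sharp$ is $a$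 or $a^*$. For $x\in\mathbb R^d$ let $$\psi(x)=a_2(\kappa_{2,x})+a_1^*(\overline{\kappa_{1,x}}),\qquad \psi^*(x)=a_2^*(\kappa_{2,x})+a_1(\overline{\kappa_{1,x}}),\qquad \rho_{\mathrm a}(x)=\psi^*(x)\psi(x),$$ so that $\rho_{\mathrm a}(x):\mathcal F_{\mathrm{a,fin}}(\Phi)\to\mathcal F^*_{\mathrm{a,fin}}(\Phi)$. For $f\in S(\mathbb R^d)$ (real-valued) and a family of operators $T(x):\mathcal F_{\mathrm{a,fin}}(\Phi)\to\mathcal F^*_{\mathrm{a,fin}}(\Phi)$, an operator $R$ that is continuous on $\mathcal F_{\mathrm{a,fin}}(H\oplus H)$ is denoted by $\int f(x)T(x)\,dx$ if for all $G_1,G_2\in\mathcal F_{\mathrm{a,fin}}(\Phi)$ the function $x\mapsto f(x)\langle G_2,T(x)G_1\rangle$ is integrable and $\langle G_2,RG_1\rangle=\int f(x)\langle G_2,T(x)G_1\rangle\,dx$. **Lemma.** For each $f\in S(\mathbb R^d)$ the operator $\rho_{\mathrm a}(f)=\int f(x)\rho_{\mathrm a}(x)\,dx$ is well defined and continuous on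 $\mathcal F_{\mathrm{a,fin}}(H\oplus H)$: there is exactly one continuous linear operator on $\mathcal F_{\mathrm{a,fin}}(H\oplus H)$ with the defining property of this integral. Moreover, $\rho_{\mathrm a}(f)=\sum_{j=1}^4\rho_{\mathrm a,j}(f)$ with the following operators, all of which are well defined in the same sense and continuous on $\mathcal F_{\mathrm{a,fin}}(H\oplus H)$. 1. $\rho_{\mathrm a,1}(f)=\int f(x)\,a_2^*(\kappa_{2,x})a_1^*(\overline{\kappa_{1,x}})\,dx$ is a two-particle creation operator: there is $\Psi\in(H_{\mathbb C}\oplus H_{\mathbb C})^{\otimes2}$ with $\Psi=\int f(x)\,(0,\kappa_{2,x})\otimes(\overline{\kappa_{1,x}},0)\,dx$ (weakly, on $g\otimes h$ with $g,h\in\Phi$) and $\rho_{\mathrm a,1}(f)u=\sqrt{(n+1)(n+2)}\,\Psi\wedge u$ for all $u\in\mathcal F^{(n)}_{\mathrm a}$, $n\ge0$. 2. $\rho_{\mathrm a,2}(f)=\int f(x)\,a_2^*(\kappa_{2,x})a_2(\kappa_{2,x})\,dx=d\Gamma(\mathcal A_{2,f})$ with $\mathcal A_{2,f}=\mathbf 0\oplus(K_2fK_2)$.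 3. $\rho_{\mathrm a,3}(f)=\int f(x)\,a_1(\overline{\kappa_{1,x}})a_1^*(\overline{\kappa_{1,x}})\,dx=\Big(\int f(x)\,dx\;(2\pi)^{-d}\int\hat k(p)\,dp\Big)\mathbf 1-d\Gamma(\mathcal A_{1,f})$ with $\mathcal A_{1,f}=(JK_1J\,f\,JK_1J)\oplus\mathbf 0$. 4. $\rho_{\mathrm a,4}(f)=\int f(x)\,a_1(\overline{\kappa_{1,x}})a_2(\kappa_{2,x})\,dx$ is the two-particle annihilation operator adjoint to $\rho_{\mathrm a,1}(f)$: $(u,\rho_{\mathrm a,4}(f)v)=(\rho_{\mathrm a,1}(f)u,v)$ for all $u,v\in\mathcal F_{\mathrm{a,fin}}(H\oplus H)$. Here $f$ in $\mathcal A_{i,f}$ denotes multiplication by $f$, and $d\Gamma(\mathcal A)$ is the continuous operator on $\mathcal F_{\mathrm{a,fin}}(H\oplus H)$ with $d\Gamma(\mathcal A)\,h_1\wedge\dots\wedge h_n=\sum_{i=1}^n h_1\wedge\dots\wedge\mathcal Ah_i\wedge\dots\wedge h_n$. -/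

import Mathlib

open MeasureTheory SchwartzMap
open scoped FourierTransform ENNReal ComplexConjugate

noncomputable section

namespace FermiGas

/-! ### Topological direct sums -/

section DirectSum

/-- The algebraic direct sum of a sequence of complex vector spaces: sequences
`(v₀, v₁, v₂, …)` with only finitely many nonzero entries. -/
def FinSum (V : ℕ → Type*) [∀ n, AddCommGroup (V n)] : Type _ := Π₀ n, V n

variable {V : ℕ → Type*} [∀ n, AddCommGroup (V n)] [∀ n, Module ℂ (V n)]
  [∀ n, TopologicalSpace (V n)]

instance : AddCommGroup (FinSum V) := inferInstanceAs (AddCommGroup (Π₀ n, V n))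

instance : Module ℂ (FinSum V) := inferInstanceAs (Module ℂ (Π₀ n, V n))

/-- The inclusion of the `n`-th summand. -/
def FinSum.singleₗ (n : ℕ) : V n →ₗ[ℂ] FinSum V := DFinsupp.lsingle n

/-- The topology of the topological direct sum of locally convex spaces: the finest locally convex
vector space topology for which all the inclusions of the summands are continuous. -/
instance : TopologicalSpace (FinSum V) :=
  sInf {t : TopologicalSpace (FinSum V) |
    (∀ n, @Continuous _ _ _ t (FinSum.singleₗ (V := V) n)) ∧
    @IsTopologicalAddGroup (FinSum V) t _ ∧
    @ContinuousSMul ℂ (FinSum V) _ _ t ∧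
    @LocallyConvexSpace ℝ (FinSum V) _ _ _ _ t}

instance : IsTopologicalAddGroup (FinSum V) :=
  topologicalAddGroup_sInf fun _ ⟨_, ht, _, _⟩ ↦ ht

instance : ContinuousSMul ℂ (FinSum V) :=
  continuousSMul_sInf fun _ ⟨_, _, ht, _⟩ ↦ ht

instance : LocallyConvexSpace ℝ (FinSum V) :=
  .sInf fun _ ⟨_, _, _, ht⟩ ↦ ht

/-- The inclusion of the `n`-th summand, as a continuous linear map. -/
def FinSum.single (n : ℕ) : V n →L[ℂ] FinSum V where
  toLinearMap := FinSum.singleₗ n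
  cont := continuous_sInf_rng.2 fun _ ht ↦ ht.1 n

/-- The `n`-th entry of an element of the direct sum. -/
def FinSum.entry (u : FinSum V) (n : ℕ) : V n := DFinsupp.lapply (R := ℂ) n u

@[simp]
theorem FinSum.entry_add {V : ℕ → Type*} [∀ n, AddCommGroup (V n)] [∀ n, Module ℂ (V n)]
    (u v : FinSum V) (n : ℕ) : (u + v).entry n = u.entry n + v.entry n := rfl

@[simp]
theorem FinSum.entry_smul {V : ℕ → Type*} [∀ n, AddCommGroup (V n)] [∀ n, Module ℂ (V n)]
    (c : ℂ) (u : FinSum V) (n : ℕ) : (c • u).entry n = c • u.entry n := rfl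

variable {W : Type*} [AddCommGroup W] [Module ℂ W] [t : TopologicalSpace W]

theorem FinSum.hom_ext {S T : FinSum V →L[ℂ] W}
    (h : ∀ n (v : V n), S (FinSum.single n v) = T (FinSum.single n v)) : S = T := by
  have h1 : (S : FinSum V →ₗ[ℂ] W) = T := DFinsupp.lhom_ext h
  exact ContinuousLinearMap.coe_inj.1 h1

variable [Module ℝ W] [IsScalarTower ℝ ℂ W]
  [IsTopologicalAddGroup W] [ContinuousSMul ℂ W] [LocallyConvexSpace ℝ W]

theorem FinSum.continuous_of_single (f : FinSum V →ₗ[ℂ] W)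
    (hf : ∀ n, Continuous fun v : V n ↦ f (FinSum.single n v)) : Continuous f := by
  have h1 : @IsTopologicalAddGroup _ (t.induced f) _ := topologicalAddGroup_induced _
  have h2 : @ContinuousSMul ℂ _ _ _ (t.induced f) := continuousSMul_induced _
  have h3 : @LocallyConvexSpace ℝ _ _ _ _ _ (t.induced (f.restrictScalars ℝ)) := .induced _
  refine continuous_iff_le_induced.2 (sInf_le ⟨fun n ↦ ?_, h1, h2, h3⟩)
  exact continuous_induced_rng.2 (hf n)

/-- The continuous linear map on the direct sum with prescribed continuous restrictions to the
summands: `(v₀, v₁, v₂, …) ↦ ∑ₙ Tₙ vₙ`. -/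
def FinSum.lift (T : ∀ n, V n →L[ℂ] W) : FinSum V →L[ℂ] W where
  toLinearMap := DFinsupp.lsum ℕ (fun n ↦ (T n).toLinearMap)
  cont := by
    refine FinSum.continuous_of_single _ fun n ↦ ?_
    have : (fun v : V n ↦ (DFinsupp.lsum ℕ (fun n ↦ (T n).toLinearMap)) (FinSum.single n v)) =
        T n := by
      funext v
      exact DFinsupp.lsum_single (S := ℕ) (fun n ↦ (T n).toLinearMap) n v
    exact this ▸ (T n).continuous

@[simp]
theorem FinSum.lift_single (T : ∀ n, V n →L[ℂ] W) (n : ℕ) (v : V n) :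
    FinSum.lift T (FinSum.single n v) = T n v :=
  DFinsupp.lsum_single (S := ℕ) (fun n ↦ (T n).toLinearMap) n v

end DirectSum

/-! ### Wave functions of finitely many particles -/

section ManyParticle

/-- The position space `ℝ^d`. -/
abbrev E (d : ℕ) := EuclideanSpace ℝ (Fin d)

/-- `H_ℂ = L²(ℝ^d → ℂ)`. -/
abbrev L2E (d : ℕ) := Lp (α := E d) ℂ 2

/-- `H_ℂ ⊕ H_ℂ`, the complexification of `H ⊕ H`. Index `0` is the first copy of `H_ℂ`, index `1`
the second one. -/
abbrev HH (d : ℕ) := PiLp 2 (fun _ : Fin 2 ↦ L2E d)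

/-- `L²` functions of `n` variables. -/
abbrev L2 (d n : ℕ) := Lp (α := Fin n → E d) ℂ 2

/-- The Hilbert space tensor power `(H_ℂ ⊕ H_ℂ)^{⊗ n}`, realized as usual by `L²` functions of `n`
variables: the component `u s` with `s : Fin n → Fin 2` belongs to the subspace
`H_ℂ^{⊗ n} = L²((ℝ^d)^n → ℂ)` whose `i`-th tensor factor lies in the copy number `s i` of `H_ℂ`. -/
abbrev Tensor (d n : ℕ) := PiLp 2 (fun _ : Fin n → Fin 2 ↦ L2 d n)

variable {d : ℕ}

instance instTemperateGrowthPi (d n : ℕ) :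
    (volume : Measure (Fin n → E d)).HasTemperateGrowth :=
  Measure.IsAddHaarMeasure.instHasTemperateGrowth (E := Fin n → E d) (μ := volume)

theorem measurePreserving_comp {n : ℕ} (σ : Equiv.Perm (Fin n)) :
    MeasurePreserving (fun z : Fin n → E d ↦ z ∘ σ) volume volume := by
  have h := volume_measurePreserving_piCongrLeft (fun _ : Fin n ↦ E d) σ.symm
  convert h using 1
  funext z i
  simp [MeasurableEquiv.coe_piCongrLeft, Equiv.piCongrLeft_apply]

/-- The continuous linear map into `(H_ℂ ⊕ H_ℂ)^{⊗ n}` with prescribed components. -/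
def toTensor {V : Type*} [AddCommGroup V] [Module ℂ V] [TopologicalSpace V] {n : ℕ}
    (T : (Fin n → Fin 2) → V →L[ℂ] L2 d n) : V →L[ℂ] Tensor d n :=
  ((PiLp.continuousLinearEquiv 2 ℂ (fun _ : Fin n → Fin 2 ↦ L2 d n)).symm :
    ((Fin n → Fin 2) → L2 d n) →L[ℂ] Tensor d n) ∘L ContinuousLinearMap.pi T

/-- The `s`-th component of an element of `(H_ℂ ⊕ H_ℂ)^{⊗ n}`. -/
def component {n : ℕ} (s : Fin n → Fin 2) : Tensor d n →L[ℂ] L2 d n :=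
  PiLp.proj 2 (fun _ : Fin n → Fin 2 ↦ L2 d n) s

/-- The unitary action of a permutation on `(H_ℂ ⊕ H_ℂ)^{⊗ n}` by permuting the variables (and the
copies of `H_ℂ` along with them). -/
def permOp (d : ℕ) {n : ℕ} (σ : Equiv.Perm (Fin n)) : Tensor d n →L[ℂ] Tensor d n :=
  toTensor fun s ↦
    (Lp.compMeasurePreservingₗᵢ ℂ (fun z : Fin n → E d ↦ z ∘ σ)
      (measurePreserving_comp σ)).toContinuousLinearMap ∘L component (s ∘ σ)

theorem permOp_apply {n : ℕ} (σ : Equiv.Perm (Fin n)) (u : Tensor d n) (s : Fin n → Fin 2) :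
    permOp d σ u s =
      Lp.compMeasurePreserving (fun z : Fin n → E d ↦ z ∘ σ) (measurePreserving_comp σ)
        (u (s ∘ σ)) := rfl

theorem permOp_mul {n : ℕ} (σ τ : Equiv.Perm (Fin n)) (u : Tensor d n) :
    permOp d σ (permOp d τ u) = permOp d (σ * τ) u := by
  ext1 s
  exact (Lp.compMeasurePreserving_comp_apply (u ((s ∘ σ) ∘ τ)) (measurePreserving_comp τ)
    (measurePreserving_comp σ)).symm

/-- The `n`-particle space `𝓕_a^{(n)}(H ⊕ H) = (H_ℂ ⊕ H_ℂ)^{∧ n}`: the antisymmetric elements of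
`(H_ℂ ⊕ H_ℂ)^{⊗ n}`. For `n = 0` this is `L²` of a point, that is, `ℂ`. -/
def Fock (d n : ℕ) : Submodule ℂ (Tensor d n) :=
  ⨅ σ : Equiv.Perm (Fin n),
    LinearMap.ker ((permOp d σ - ((Equiv.Perm.sign σ : ℤ) : ℂ) • ContinuousLinearMap.id ℂ _ :
      Tensor d n →L[ℂ] Tensor d n) : Tensor d n →ₗ[ℂ] Tensor d n)

theorem mem_Fock {n : ℕ} {u : Tensor d n} :
    u ∈ Fock d n ↔
      ∀ σ : Equiv.Perm (Fin n), permOp d σ u = ((Equiv.Perm.sign σ : ℤ) : ℂ) • u := by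
  simp [Fock, sub_eq_zero]

instance (d n : ℕ) : CompleteSpace (Fock d n) := by
  have h : IsClosed (Fock d n : Set (Tensor d n)) := by
    simp only [Fock, Submodule.coe_iInf]
    exact isClosed_iInter fun σ ↦ ContinuousLinearMap.isClosed_ker _
  exact h.completeSpace_coe

/-- The antisymmetrization operator `(1/n!) ∑_σ sgn(σ) σ` from `(H_ℂ ⊕ H_ℂ)^{⊗ n}` onto
`(H_ℂ ⊕ H_ℂ)^{∧ n}`. -/
def alt (d n : ℕ) : Tensor d n →L[ℂ] Fock d n :=
  ((n.factorial : ℂ)⁻¹ •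
    ∑ σ : Equiv.Perm (Fin n), ((Equiv.Perm.sign σ : ℤ) : ℂ) • permOp d σ).codRestrict (Fock d n)
  (by
    intro u
    rw [mem_Fock]
    intro σ
    simp only [_root_.smul_apply, _root_.sum_apply, map_smul, map_sum,
      permOp_mul]
    rw [smul_comm]
    congr 1
    rw [Finset.smul_sum]
    refine Fintype.sum_equiv (Equiv.mulLeft σ) _ _ fun τ ↦ ?_
    simp only [Equiv.coe_mulLeft, Equiv.Perm.sign_mul, Units.val_mul, Int.cast_mul, smul_smul]
    congr 1
    rw [← mul_assoc, ← Int.cast_mul, Int.units_coe_mul_self, Int.cast_one, one_mul])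

theorem memLp_prod {n : ℕ} (h : Fin n → L2E d) :
    MemLp (fun z : Fin n → E d ↦ ∏ i, h i (z i)) 2 volume := by
  have hm : AEStronglyMeasurable (fun z : Fin n → E d ↦ ∏ i, h i (z i)) volume :=
    Finset.aestronglyMeasurable_fun_prod _ fun i _ ↦
      (Lp.aestronglyMeasurable (h i)).comp_quasiMeasurePreserving
        (Measure.quasiMeasurePreserving_eval (fun _ : Fin n ↦ (volume : Measure (E d))) i)
  rw [memLp_two_iff_integrable_sq_norm hm]
  have h2 : Integrable (fun z : Fin n → E d ↦ ∏ i, ‖h i (z i)‖ ^ 2)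
      (Measure.pi fun _ : Fin n ↦ (volume : Measure (E d))) :=
    Integrable.fintype_prod_dep (f := fun i (x : E d) ↦ ‖h i x‖ ^ 2) fun i ↦
      (memLp_two_iff_integrable_sq_norm (Lp.aestronglyMeasurable (h i))).1 (Lp.memLp (h i))
  refine h2.congr (Filter.Eventually.of_forall fun z ↦ ?_)
  simp [norm_prod, Finset.prod_pow]

/-- The tensor product `h₁ ⊗ ⋯ ⊗ hₙ` of elements of `H_ℂ ⊕ H_ℂ`. -/
def tprod {n : ℕ} (h : Fin n → HH d) : Tensor d n :=
  WithLp.toLp 2 fun s ↦ (memLp_prod fun i ↦ h i (s i)).toLp _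

/-- `h₁ ∧ ⋯ ∧ hₙ`, the antisymmetrization of `h₁ ⊗ ⋯ ⊗ hₙ`. -/
def wedge {n : ℕ} (h : Fin n → HH d) : Fock d n := alt d n (tprod h)

/-- The first `m` of `n + m` indices. -/
def firstIdx (m n : ℕ) (i : Fin m) : Fin (n + m) := Fin.castLE (Nat.le_add_left m n) i

/-- The last `n` of `n + m` indices. -/
def lastIdx (m n : ℕ) (i : Fin n) : Fin (n + m) := Fin.addNat i m

theorem measurePreserving_split (m n : ℕ) :
    MeasurePreserving
      (fun z : Fin (n + m) → E d ↦ ((z ∘ firstIdx m n, z ∘ lastIdx m n) :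
        (Fin m → E d) × (Fin n → E d))) volume (volume.prod volume) := by
  let e : Fin m ⊕ Fin n ≃ Fin (n + m) := finSumFinEquiv.trans (finCongr (Nat.add_comm m n))
  have h1 := volume_measurePreserving_piCongrLeft (fun _ : Fin m ⊕ Fin n ↦ E d) e.symm
  have h2 := volume_measurePreserving_sumPiEquivProdPi (fun _ : Fin m ⊕ Fin n ↦ E d)
  have h3 := h2.comp h1
  refine (congrArg (fun f ↦ MeasurePreserving f volume (volume.prod volume)) ?_).mp h3
  symm
  funext z
  refine Prod.ext ?_ ?_
  · funext i
    simp only [Function.comp_apply, MeasurableEquiv.coe_sumPiEquivProdPi,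
      MeasurableEquiv.coe_piCongrLeft, Equiv.sumPiEquivProdPi_apply, Equiv.piCongrLeft_apply,
      eq_rec_constant]
    rfl
  · funext i
    simp only [Function.comp_apply, MeasurableEquiv.coe_sumPiEquivProdPi,
      MeasurableEquiv.coe_piCongrLeft, Equiv.sumPiEquivProdPi_apply, Equiv.piCongrLeft_apply,
      eq_rec_constant]
    congr 1
    ext
    simp [e, lastIdx]

theorem eLpNorm_mul_prod {m n : ℕ} (a : L2 d m)
    (b : L2 d n) :
    eLpNorm (fun p : (Fin m → E d) × (Fin n → E d) ↦ a p.1 * b p.2) 2 (volume.prod volume) =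
      eLpNorm a 2 volume * eLpNorm b 2 volume := by
  simp only [eLpNorm_eq_lintegral_rpow_enorm_toReal (p := 2) (by norm_num) (by norm_num), enorm_mul]
  rw [← ENNReal.mul_rpow_of_nonneg _ _ (by positivity), ← lintegral_prod_mul]
  · simp only [ENNReal.mul_rpow_of_nonneg _ _ (ENNReal.toReal_nonneg)]
  · exact (Lp.aestronglyMeasurable a).enorm.pow_const _
  · exact (Lp.aestronglyMeasurable b).enorm.pow_const _

theorem memLp_mul_prod {m n : ℕ} (a : L2 d m)
    (b : L2 d n) :
    MemLp (fun p : (Fin m → E d) × (Fin n → E d) ↦ a p.1 * b p.2) 2 (volume.prod volume) :=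
  ⟨(Lp.aestronglyMeasurable a).comp_fst.mul (Lp.aestronglyMeasurable b).comp_snd, by
    rw [eLpNorm_mul_prod]
    exact ENNReal.mul_lt_top (Lp.eLpNorm_lt_top a) (Lp.eLpNorm_lt_top b)⟩

/-- `b ↦ a ⊗ b` for functions `a` of `m` variables and `b` of `n` variables:
`(a ⊗ b)(z₁, …, z_{m+n}) = a(z₁, …, z_m) b(z_{m+1}, …, z_{m+n})`. -/
def outer {m : ℕ} (n : ℕ) (a : L2 d m) :
    L2 d n →L[ℂ] L2 d (n + m) :=
  (Lp.compMeasurePreservingₗᵢ ℂ _ (measurePreserving_split m n)).toContinuousLinearMap ∘L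
    LinearMap.mkContinuous
      { toFun := fun b ↦ (memLp_mul_prod a b).toLp _
        map_add' := fun b c ↦ by
          rw [← MemLp.toLp_add]
          refine MemLp.toLp_congr _ _ ?_
          filter_upwards [Measure.quasiMeasurePreserving_snd.ae_eq_comp (Lp.coeFn_add b c)]
            with p hp
          simp only [Function.comp_apply, Pi.add_apply] at hp
          rw [Pi.add_apply, hp, mul_add]
        map_smul' := fun r b ↦ by
          rw [RingHom.id_apply, ← MemLp.toLp_const_smul]
          refine MemLp.toLp_congr _ _ ?_
          filter_upwards [Measure.quasiMeasurePreserving_snd.ae_eq_comp (Lp.coeFn_smul r b)]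
            with p hp
          simp only [Function.comp_apply, Pi.smul_apply] at hp
          rw [Pi.smul_apply, hp, smul_eq_mul, smul_eq_mul, mul_left_comm] }
      ‖a‖ (fun b ↦ by
        simp only [LinearMap.coe_mk, AddHom.coe_mk, Lp.norm_toLp, eLpNorm_mul_prod,
          ENNReal.toReal_mul]
        rfl)

/-- `v ↦ u ⊗ v` for `u ∈ (H_ℂ ⊕ H_ℂ)^{⊗ m}` and `v ∈ (H_ℂ ⊕ H_ℂ)^{⊗ n}`. The factors of `u` come
first. -/
def tensorLeft {m : ℕ} (n : ℕ) (u : Tensor d m) : Tensor d n →L[ℂ] Tensor d (n + m) :=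
  toTensor fun s ↦ outer n (u (s ∘ firstIdx m n)) ∘L component (s ∘ lastIdx m n)

/-- The wedge product `v ↦ u ∧ v`, the antisymmetrization of `u ⊗ v`. -/
def wedgeLeft {m : ℕ} (n : ℕ) (u : Tensor d m) : Fock d n →L[ℂ] Fock d (n + m) :=
  alt d (n + m) ∘L tensorLeft n u ∘L (Fock d n).subtypeL

end ManyParticle
/-! ### Test functions and contraction with tempered distributions -/

section Test

variable {d : ℕ}

/-- `𝓕_a^{(n)}(Φ)` for `Φ = S_ℂ(ℝ^d) ⊕ S_ℂ(ℝ^d)`: the antisymmetric elements of `Φ^{⊗ n}` (completed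
tensor power), realized by Schwartz functions of `n` variables: the component `g s` with
`s : Fin n → Fin 2` is the part whose `i`-th tensor factor lies in the copy number `s i` of
`S_ℂ(ℝ^d)`. -/
def Test (d n : ℕ) : Submodule ℂ ((Fin n → Fin 2) → 𝓢(Fin n → E d, ℂ)) where
  carrier := {g | ∀ (σ : Equiv.Perm (Fin n)) (s : Fin n → Fin 2) (z : Fin n → E d),
    g (s ∘ σ) (z ∘ σ) = ((Equiv.Perm.sign σ : ℤ) : ℂ) * g s z}
  add_mem' := fun {g h} hg hh σ s z ↦ by simp [hg σ s z, hh σ s z, mul_add]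
  zero_mem' := fun σ s z ↦ by simp
  smul_mem' := fun c g hg σ s z ↦ by simp [hg σ s z, mul_left_comm]

/-- The `s`-th component of a test function. -/
def testComponent {n : ℕ} (s : Fin n → Fin 2) : Test d n →L[ℂ] 𝓢(Fin n → E d, ℂ) :=
  ContinuousLinearMap.proj s ∘L (Test d n).subtypeL

/-- The inclusion of `𝓕_a^{(n)}(Φ)` into `𝓕_a^{(n)}(H ⊕ H)`. -/
def embN (d n : ℕ) : Test d n →L[ℂ] Fock d n :=
  (toTensor fun s ↦ SchwartzMap.toLpCLM ℂ ℂ 2 (volume : Measure (Fin n → E d)) ∘L testComponent s).codRestrict (Fock d n)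
  (by
    intro g
    rw [mem_Fock]
    intro σ
    ext1 s
    change (Lp.compMeasurePreserving (fun z : Fin n → E d ↦ z ∘ σ) (measurePreserving_comp σ)
        ((g.1 (s ∘ σ)).toLp 2 volume)) = ((Equiv.Perm.sign σ : ℤ) : ℂ) • (g.1 s).toLp 2 volume
    unfold SchwartzMap.toLp
    rw [Lp.toLp_compMeasurePreserving, ← MemLp.toLp_const_smul]
    refine MemLp.toLp_congr _ _ (Filter.Eventually.of_forall fun z ↦ ?_)
    simpa using g.2 σ s z)

theorem hasTemperateGrowth_cons {n : ℕ} (w : Fin n → E d) :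
    (fun y : E d ↦ (Fin.cons y w : Fin (n + 1) → E d)).HasTemperateGrowth := by
  have h : (fun y : E d ↦ (Fin.cons y w : Fin (n + 1) → E d)) =
      fun y ↦ (ContinuousLinearMap.single ℝ (fun _ : Fin (n + 1) ↦ E d) 0) y + Fin.cons 0 w := by
    funext y i
    refine Fin.cases ?_ (fun i ↦ ?_) i <;> simp
  rw [h]
  exact (ContinuousLinearMap.hasTemperateGrowth _).add (Function.HasTemperateGrowth.const _)

theorem norm_le_norm_cons {n : ℕ} (y : E d) (w : Fin n → E d) :
    ‖y‖ ≤ ‖(Fin.cons y w : Fin (n + 1) → E d)‖ :=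
  norm_le_pi_norm (Fin.cons y w : Fin (n + 1) → E d) 0

theorem norm_le_norm_cons' {n : ℕ} (y : E d) (w : Fin n → E d) :
    ‖w‖ ≤ ‖(Fin.cons y w : Fin (n + 1) → E d)‖ :=
  (pi_norm_le_iff_of_nonneg (norm_nonneg _)).2 fun i ↦ by
    simpa using norm_le_pi_norm (Fin.cons y w : Fin (n + 1) → E d) i.succ

/-- The slice `y ↦ G(y, w)` of a Schwartz function `G` of `n + 1` variables. -/
def slice {n : ℕ} (w : Fin n → E d) : 𝓢(Fin (n + 1) → E d, ℂ) →L[ℂ] 𝓢(E d, ℂ) :=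
  SchwartzMap.compCLM ℂ (g := fun y : E d ↦ (Fin.cons y w : Fin (n + 1) → E d))
    (hasTemperateGrowth_cons w) ⟨1, 1, fun y ↦ by
      have := norm_le_norm_cons y w
      rw [one_mul, pow_one]
      linarith⟩

theorem slice_apply {n : ℕ} (w : Fin n → E d) (G : 𝓢(Fin (n + 1) → E d, ℂ)) (y : E d) :
    slice w G y = G (Fin.cons y w) := rfl

theorem iteratedFDeriv_slice {n : ℕ} (w : Fin n → E d) (G : 𝓢(Fin (n + 1) → E d, ℂ)) (l : ℕ)
    (y : E d) :
    iteratedFDeriv ℝ l (slice w G) y =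
      (iteratedFDeriv ℝ l G (Fin.cons y w)).compContinuousLinearMap
        (fun _ ↦ ContinuousLinearMap.single ℝ (fun _ : Fin (n + 1) ↦ E d) 0) := by
  have h (y : E d) : (Fin.cons y w : Fin (n + 1) → E d) =
      (ContinuousLinearMap.single ℝ (fun _ : Fin (n + 1) ↦ E d) 0) y + Fin.cons 0 w := by
    funext i
    refine Fin.cases ?_ (fun i ↦ ?_) i <;> simp
  have h2 : (slice w G : E d → ℂ) = (fun z ↦ G (z + Fin.cons 0 w)) ∘
      (ContinuousLinearMap.single ℝ (fun _ : Fin (n + 1) ↦ E d) 0) := by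
    funext y
    rw [slice_apply, h]
    rfl
  rw [h2, ContinuousLinearMap.iteratedFDeriv_comp_right (i := l) (n := ((⊤ : ℕ∞) : WithTop ℕ∞)), h y]
  · congr 1
    exact iteratedFDeriv_comp_add_right l _ _
  · exact (G.smooth ⊤).comp (contDiff_id.add contDiff_const)
  · exact mod_cast le_top

theorem norm_compContinuousLinearMap_single_le {n l : ℕ}
    (A : ContinuousMultilinearMap ℝ (fun _ : Fin l ↦ Fin (n + 1) → E d) ℂ) :
    ‖A.compContinuousLinearMap
      (fun _ ↦ ContinuousLinearMap.single ℝ (fun _ : Fin (n + 1) ↦ E d) 0)‖ ≤ ‖A‖ := by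
  have h1 : ‖ContinuousLinearMap.single ℝ (fun _ : Fin (n + 1) ↦ E d) 0‖ ≤ 1 :=
    ContinuousLinearMap.opNorm_le_bound _ zero_le_one fun y ↦ by
      simp [Pi.norm_single]
  refine (ContinuousMultilinearMap.norm_compContinuousLinearMap_le _ _).trans ?_
  exact mul_le_of_le_one_right (norm_nonneg _)
    (Finset.prod_le_one (fun _ _ ↦ norm_nonneg _) fun _ _ ↦ h1)

/-- Slices decay rapidly in the frozen variables. -/
theorem seminorm_slice_le {n : ℕ} (N k l : ℕ) (w : Fin n → E d) (G : 𝓢(Fin (n + 1) → E d, ℂ)) :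
    SchwartzMap.seminorm ℂ k l (slice w G) ≤
      (2 ^ (N + k) * (Finset.Iic (N + k, l)).sup (schwartzSeminormFamily ℂ _ _) G) /
        (1 + ‖w‖) ^ N := by
  refine SchwartzMap.seminorm_le_bound ℂ k l _ (by positivity) fun y ↦ ?_
  rw [le_div_iff₀' (by positivity), iteratedFDeriv_slice]
  refine le_trans ?_ (SchwartzMap.one_add_le_sup_seminorm_apply (𝕜 := ℂ) (m := (N + k, l))
    le_rfl le_rfl G (Fin.cons y w))
  rw [pow_add, mul_assoc]
  have h1 := norm_le_norm_cons y w
  have h2 := norm_le_norm_cons' y w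
  gcongr
  · linarith
  · exact norm_compContinuousLinearMap_single_le _

/-- Slices depend Lipschitz continuously on the frozen variables. -/
theorem seminorm_slice_sub_le {n : ℕ} (k l : ℕ) (w w' : Fin n → E d)
    (G : 𝓢(Fin (n + 1) → E d, ℂ)) :
    SchwartzMap.seminorm ℂ k l (slice w G - slice w' G) ≤
      SchwartzMap.seminorm ℂ k (l + 1) G * ‖w - w'‖ := by
  refine SchwartzMap.seminorm_le_bound ℂ k l _ (by positivity) fun y ↦ ?_
  have hl : ((l : ℕ) : WithTop ℕ∞) ≤ ((⊤ : ℕ∞) : WithTop ℕ∞) := mod_cast le_top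
  have hsub : iteratedFDeriv ℝ l (slice w G - slice w' G : 𝓢(E d, ℂ)) y =
      iteratedFDeriv ℝ l (slice w G) y - iteratedFDeriv ℝ l (slice w' G) y := by
    have : ((slice w G - slice w' G : 𝓢(E d, ℂ)) : E d → ℂ) =
        (slice w G : E d → ℂ) - (slice w' G : E d → ℂ) := rfl
    rw [this, iteratedFDeriv_sub_apply]
    · exact ((slice w G).smooth l).contDiffAt
    · exact ((slice w' G).smooth l).contDiffAt
  rw [hsub, iteratedFDeriv_slice, iteratedFDeriv_slice]
  have hlin : ∀ A B : ContinuousMultilinearMap ℝ (fun _ : Fin l ↦ Fin (n + 1) → E d) ℂ,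
      A.compContinuousLinearMap
        (fun _ ↦ ContinuousLinearMap.single ℝ (fun _ : Fin (n + 1) ↦ E d) 0) -
      B.compContinuousLinearMap
        (fun _ ↦ ContinuousLinearMap.single ℝ (fun _ : Fin (n + 1) ↦ E d) 0) =
      (A - B).compContinuousLinearMap
        (fun _ ↦ ContinuousLinearMap.single ℝ (fun _ : Fin (n + 1) ↦ E d) 0) := fun A B ↦ rfl
  rw [hlin]
  refine (mul_le_mul_of_nonneg_left (norm_compContinuousLinearMap_single_le _)
    (by positivity)).trans ?_
  have hd : Differentiable ℝ (iteratedFDeriv ℝ l G) :=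
    (G.smooth (l + 1)).differentiable_iteratedFDeriv (by norm_cast; exact Nat.lt_succ_self l)
  have hconv : Convex ℝ {z : Fin (n + 1) → E d | z 0 = y} :=
    (convex_singleton y).linear_preimage (LinearMap.proj (R := ℝ) (φ := fun _ ↦ E d) 0)
  have key := hconv.norm_image_sub_le_of_norm_fderiv_le (𝕜 := ℝ)
    (f := (‖y‖ ^ k : ℝ) • iteratedFDeriv ℝ l G)
    (C := SchwartzMap.seminorm ℂ k (l + 1) G)
    (fun z _ ↦ (hd z).const_smul _) (fun z hz ↦ by
      rw [fderiv_const_smul (hd z), norm_smul, norm_fderiv_iteratedFDeriv, norm_pow, norm_norm]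
      refine le_trans ?_ (SchwartzMap.le_seminorm ℂ k (l + 1) G z)
      have : ‖y‖ ≤ ‖z‖ := by
        rw [← show z 0 = y from hz]
        exact norm_le_pi_norm z 0
      gcongr)
    (x := Fin.cons y w') (y := Fin.cons y w) rfl rfl
  rw [Pi.smul_apply, Pi.smul_apply, ← smul_sub, norm_smul, norm_pow, norm_norm] at key
  refine key.trans ?_
  gcongr
  refine (pi_norm_le_iff_of_nonneg (norm_nonneg _)).2 fun i ↦ ?_
  refine Fin.cases ?_ (fun i ↦ ?_) i
  · simp
  · simpa using norm_le_pi_norm (w - w') i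

theorem exists_bound_functional (L : 𝓢(E d, ℂ) →L[ℂ] ℂ) :
    ∃ (s : Finset (ℕ × ℕ)) (C : ℝ), 0 ≤ C ∧
      ∀ φ, ‖L φ‖ ≤ C * s.sup (schwartzSeminormFamily ℂ (E d) ℂ) φ := by
  obtain ⟨s, C, -, h⟩ := Seminorm.bound_of_continuous (schwartz_withSeminorms ℂ (E d) ℂ)
    ((normSeminorm ℂ ℂ).comp L.toLinearMap) (by
      change Continuous fun φ ↦ ‖L φ‖
      exact L.continuous.norm)
  exact ⟨s, C, C.2, fun φ ↦ h φ⟩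

theorem continuous_contract {n : ℕ} (L : 𝓢(E d, ℂ) →L[ℂ] ℂ) (G : 𝓢(Fin (n + 1) → E d, ℂ)) :
    Continuous fun w : Fin n → E d ↦ L (slice w G) := by
  refine L.continuous.comp (continuous_iff_continuousAt.2 fun w₀ ↦ ?_)
  refine ((schwartz_withSeminorms ℂ (E d) ℂ).tendsto_nhds _ _).2 fun ⟨k, l⟩ ε hε ↦ ?_
  have hc : Filter.Tendsto (fun w ↦ SchwartzMap.seminorm ℂ k (l + 1) G * ‖w - w₀‖) (nhds w₀)
      (nhds 0) := by
    have : Continuous fun w ↦ SchwartzMap.seminorm ℂ k (l + 1) G * ‖w - w₀‖ := by fun_prop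
    simpa using this.tendsto w₀
  filter_upwards [hc.eventually (gt_mem_nhds hε)] with w hw
  exact (seminorm_slice_sub_le k l w w₀ G).trans_lt hw

theorem exists_bound_contract (n N : ℕ) (L : 𝓢(E d, ℂ) →L[ℂ] ℂ) :
    ∃ (s : Finset (ℕ × ℕ)) (C : ℝ), 0 ≤ C ∧
      ∀ (G : 𝓢(Fin (n + 1) → E d, ℂ)) (w : Fin n → E d), ‖L (slice w G)‖ ≤
        (C * s.sup (schwartzSeminormFamily ℂ (Fin (n + 1) → E d) ℂ) G) * (1 + ‖w‖) ^ (-N : ℝ) := by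
  obtain ⟨s, C, hC, h⟩ := exists_bound_functional L
  refine ⟨s.sup fun i ↦ Finset.Iic (N + i.1, i.2), C * ∑ i ∈ s, 2 ^ (N + i.1), by positivity,
    fun G w ↦ (h _).trans ?_⟩
  rw [mul_assoc, mul_assoc]
  gcongr
  refine Seminorm.finset_sup_apply_le (by positivity) fun i hi ↦ ?_
  refine (seminorm_slice_le N i.1 i.2 w G).trans ?_
  rw [Real.rpow_neg (by positivity), Real.rpow_natCast, ← div_eq_mul_inv, ← mul_div_assoc]
  have h1 : (2 : ℝ) ^ (N + i.1) ≤ ∑ i ∈ s, 2 ^ (N + i.1) :=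
    Finset.single_le_sum (f := fun i : ℕ × ℕ ↦ (2 : ℝ) ^ (N + i.1)) (fun _ _ ↦ by positivity) hi
  have h2 : (Finset.Iic (N + i.1, i.2)).sup (schwartzSeminormFamily ℂ (Fin (n + 1) → E d) ℂ) G ≤
      (s.sup fun i ↦ Finset.Iic (N + i.1, i.2)).sup
        (schwartzSeminormFamily ℂ (Fin (n + 1) → E d) ℂ) G :=
    (Finset.sup_mono (Finset.le_sup (f := fun i : ℕ × ℕ ↦ Finset.Iic (N + i.1, i.2)) hi) :
      (Finset.Iic (N + i.1, i.2)).sup (schwartzSeminormFamily ℂ (Fin (n + 1) → E d) ℂ) ≤ _) G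
  gcongr

theorem memLp_contract {n : ℕ} (L : 𝓢(E d, ℂ) →L[ℂ] ℂ) (G : 𝓢(Fin (n + 1) → E d, ℂ)) :
    MemLp (fun w : Fin n → E d ↦ L (slice w G)) 2 volume := by
  obtain ⟨N, hN⟩ := (instTemperateGrowthPi d n).exists_eLpNorm_lt_top 2
  obtain ⟨s, C, hC, h⟩ := exists_bound_contract n N L
  refine ⟨(continuous_contract L G).aestronglyMeasurable, ?_⟩
  refine (eLpNorm_le_mul_eLpNorm_of_ae_le_mul (g := fun w : Fin n → E d ↦ (1 + ‖w‖) ^ (-N : ℝ))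
    (c := C * s.sup (schwartzSeminormFamily ℂ (Fin (n + 1) → E d) ℂ) G)
    (Filter.Eventually.of_forall fun w ↦ (h G w).trans ?_) 2).trans_lt
    (ENNReal.mul_lt_top ENNReal.ofReal_lt_top hN)
  exact mul_le_mul_of_nonneg_left (le_abs_self _) (by positivity)

/-- Contraction of the first variable: the `L²` function `w ↦ L(y ↦ G(y, w))`, for a continuous
linear functional `L` on the Schwartz space and a Schwartz function `G` of `n + 1` variables. -/
def contract (n : ℕ) (L : 𝓢(E d, ℂ) →L[ℂ] ℂ) : 𝓢(Fin (n + 1) → E d, ℂ) →L[ℂ] L2 d n :=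
  SchwartzMap.mkCLMtoNormedSpace (fun G ↦ (memLp_contract L G).toLp _)
    (fun G G' ↦ by
      rw [← MemLp.toLp_add]
      exact MemLp.toLp_congr _ _ (Filter.Eventually.of_forall fun w ↦ by simp))
    (fun c G ↦ by
      rw [RingHom.id_apply, ← MemLp.toLp_const_smul]
      exact MemLp.toLp_congr _ _ (Filter.Eventually.of_forall fun w ↦ by simp))
    (by
      obtain ⟨N, hN⟩ := (instTemperateGrowthPi d n).exists_eLpNorm_lt_top 2
      obtain ⟨s, C, hC, h⟩ := exists_bound_contract n N L
      set A := eLpNorm (fun w : Fin n → E d ↦ (1 + ‖w‖) ^ (-N : ℝ)) 2 volume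
      refine ⟨s, C * A.toReal, by positivity, fun G ↦ ?_⟩
      rw [Lp.norm_toLp]
      have h1 : eLpNorm (fun w : Fin n → E d ↦ L (slice w G)) 2 volume ≤
          ENNReal.ofReal (C * s.sup (schwartzSeminormFamily ℂ (Fin (n + 1) → E d) ℂ) G) * A := by
        refine eLpNorm_le_mul_eLpNorm_of_ae_le_mul
          (Filter.Eventually.of_forall fun w ↦ (h G w).trans ?_) 2
        gcongr
        exact le_abs_self _
      refine (ENNReal.toReal_mono (ENNReal.mul_lt_top ENNReal.ofReal_lt_top hN).ne h1).trans ?_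
      rw [ENNReal.toReal_mul, ENNReal.toReal_ofReal (by positivity)]
      exact le_of_eq (by ring))

end Test
/-! ### Fock spaces and creation and annihilation operators -/

section FockSpace

variable {d : ℕ}

/-- `𝓕_{a,fin}(H ⊕ H)`: the topological direct sum of the spaces `𝓕_a^{(n)}(H ⊕ H)`. -/
abbrev FockFin (d : ℕ) := FinSum fun n ↦ Fock d n

/-- `𝓕_{a,fin}(Φ)`: the topological direct sum of the spaces `𝓕_a^{(n)}(Φ)`. -/
abbrev TestFin (d : ℕ) := FinSum fun n ↦ Test d n

/-- The inclusion of `𝓕_{a,fin}(Φ)` into `𝓕_{a,fin}(H ⊕ H)`. -/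
def emb (d : ℕ) : TestFin d →L[ℂ] FockFin d :=
  FinSum.lift fun n ↦ FinSum.single (V := fun n ↦ Fock d n) n ∘L embN d n

/-- The functional `v ↦ ⟨u, v⟩ = ∑ₙ ⟨uₙ, vₙ⟩` on `𝓕_{a,fin}(H ⊕ H)`. -/
def fockInner (u : FockFin d) : FockFin d →L[ℂ] ℂ :=
  FinSum.lift fun n ↦ innerSL ℂ (u.entry n)

theorem fockInner_add (u v : FockFin d) : fockInner (u + v) = fockInner u + fockInner v :=
  FinSum.hom_ext fun n w ↦ by simp [fockInner]

theorem fockInner_smul (c : ℂ) (u : FockFin d) : fockInner (c • u) = conj c • fockInner u :=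
  FinSum.hom_ext fun n w ↦ by simp [fockInner]

/-- `𝓕*_{a,fin}(Φ)`, the dual of `𝓕_{a,fin}(Φ)` with respect to the zero space `𝓕_a(H ⊕ H)`.
An element `T` is given by the continuous antilinear functional `G ↦ ⟨G, T⟩`, where the pairing is
generated by the scalar product, antilinear in the first and linear in the second argument. -/
abbrev TestDual (d : ℕ) := TestFin d →L⋆[ℂ] ℂ

/-- The adjoint `B* : 𝓕_{a,fin}(H ⊕ H) → 𝓕*_{a,fin}(Φ)` of a continuous operator
`B : 𝓕_{a,fin}(Φ) → 𝓕_{a,fin}(H ⊕ H)`, given by `⟨G, B* u⟩ = ⟨B G, u⟩`. -/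
def adj (B : TestFin d →L[ℂ] FockFin d) : FockFin d →ₗ[ℂ] TestDual d where
  toFun u := ((starL ℂ : ℂ ≃L⋆[ℂ] ℂ) : ℂ →L⋆[ℂ] ℂ).comp (fockInner u ∘L B)
  map_add' u v := by
    ext G
    simp [fockInner_add]
  map_smul' c u := by
    ext G
    simp [fockInner_smul]

/-- The inclusion of `𝓕_{a,fin}(H ⊕ H)` into `𝓕*_{a,fin}(Φ)`: `⟨G, u⟩` is the scalar product in the
Fock space. -/
def toDual (d : ℕ) : FockFin d →ₗ[ℂ] TestDual d := adj (emb d)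

/-- The creation operator `a*(f) : 𝓕_a^{(n)} → 𝓕_a^{(n+1)}`, `a*(f) u = √(n+1) f ∧ u`. -/
def creN (n : ℕ) (f : HH d) : Fock d n →L[ℂ] Fock d (n + 1) :=
  ((Real.sqrt (n + 1) : ℝ) : ℂ) • wedgeLeft n (tprod (fun _ : Fin 1 ↦ f))

/-- The creation operator `a*(f)` on `𝓕_{a,fin}(H ⊕ H)`, for `f ∈ H_ℂ ⊕ H_ℂ`. -/
def cre (f : HH d) : FockFin d →L[ℂ] FockFin d :=
  FinSum.lift fun n ↦ FinSum.single (V := fun n ↦ Fock d n) (n + 1) ∘L creN n f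

/-- The restriction of `a(f)` to `𝓕_a^{(n)}`. -/
def annSum (f : HH d) : (n : ℕ) → Fock d n →L[ℂ] FockFin d
  | 0 => 0
  | n + 1 => FinSum.single (V := fun n ↦ Fock d n) n ∘L ContinuousLinearMap.adjoint (creN n f)

/-- The annihilation operator `a(f)` on `𝓕_{a,fin}(H ⊕ H)`, for `f ∈ H_ℂ ⊕ H_ℂ`: it vanishes on
`𝓕_a^{(0)}`, and its restriction `𝓕_a^{(n+1)} → 𝓕_a^{(n)}` is the Hilbert space adjoint
of `a*(f) : 𝓕_a^{(n)} → 𝓕_a^{(n+1)}`. -/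
def ann (f : HH d) : FockFin d →L[ℂ] FockFin d :=
  FinSum.lift (annSum f)

/-- The complex conjugation of Schwartz functions. -/
def conjS : 𝓢(E d, ℂ) →L[ℝ] 𝓢(E d, ℂ) := SchwartzMap.postcompCLM (Complex.conjCLE : ℂ →L[ℝ] ℂ)

/-- The pairing `φ ↦ ⟨F, φ⟩` of a generalized function `F ∈ S'_ℂ` with `φ ∈ S_ℂ`, generated by the
scalar product of `L²_ℂ` and so antilinear in `F`: it equals `conj (F (conj φ))` in terms of the
bilinear pairing `F φ`, so that `⟨F, φ⟩ = ∫ conj(F) φ` for functions `F`. -/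
def pairing (F : 𝓢'(E d, ℂ)) : 𝓢(E d, ℂ) →L[ℂ] ℂ where
  toFun φ := conj (F (conjS φ))
  map_add' φ ψ := by simp
  map_smul' c φ := by
    have h : conjS (c • φ) = conj c • conjS φ := by
      ext x
      simp [conjS]
    simp [h]
  cont := Complex.continuous_conj.comp (F.continuous.comp conjS.continuous)

theorem contract_perm {n : ℕ} (σ : Equiv.Perm (Fin n)) (j : Fin 2) (s : Fin n → Fin 2)
    (L : 𝓢(E d, ℂ) →L[ℂ] ℂ) (g : Test d (n + 1)) :
    Lp.compMeasurePreserving (fun w : Fin n → E d ↦ w ∘ σ) (measurePreserving_comp σ)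
        (contract n L (g.1 (Fin.cons j (s ∘ σ)))) =
      ((Equiv.Perm.sign σ : ℤ) : ℂ) • contract n L (g.1 (Fin.cons j s)) := by
  let τ : Equiv.Perm (Fin (n + 1)) := Equiv.Perm.decomposeFin.symm (0, σ)
  have hτ0 : τ 0 = 0 := by simp [τ]
  have hτs (i : Fin n) : τ i.succ = (σ i).succ := by simp [τ]
  have hsign : Equiv.Perm.sign τ = Equiv.Perm.sign σ := by simp [τ]
  have hcons {α : Type} (a : α) (w : Fin n → α) :
      (Fin.cons a (w ∘ σ) : Fin (n + 1) → α) = (Fin.cons a w : Fin (n + 1) → α) ∘ τ := by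
    funext i
    refine Fin.cases ?_ (fun i ↦ ?_) i
    · simp [hτ0]
    · simp [hτs]
  change Lp.compMeasurePreserving (fun w : Fin n → E d ↦ w ∘ σ) (measurePreserving_comp σ)
      ((memLp_contract L (g.1 (Fin.cons j (s ∘ σ)))).toLp _) =
    ((Equiv.Perm.sign σ : ℤ) : ℂ) • (memLp_contract L (g.1 (Fin.cons j s))).toLp _
  rw [Lp.toLp_compMeasurePreserving, ← MemLp.toLp_const_smul]
  refine MemLp.toLp_congr _ _ (Filter.Eventually.of_forall fun w ↦ ?_)
  have h : slice (w ∘ σ) (g.1 (Fin.cons j (s ∘ σ))) =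
      ((Equiv.Perm.sign σ : ℤ) : ℂ) • slice w (g.1 (Fin.cons j s)) := by
    ext y
    have := g.2 τ (Fin.cons j s) (Fin.cons y w)
    rw [hsign, ← hcons, ← hcons] at this
    simpa [slice_apply] using this
  simp [Function.comp_def] at h ⊢
  simp [h]

/-- The annihilation operator `a(F₁, F₂) : 𝓕_a^{(n+1)}(Φ) → 𝓕_a^{(n)}(H ⊕ H)` for
`(F₁, F₂) ∈ Φ' = S'_ℂ ⊕ S'_ℂ`: it is `√(n+1)` times the contraction of the first tensor factor with
`(F₁, F₂)`. -/
def annDN (n : ℕ) (F : Fin 2 → 𝓢'(E d, ℂ)) : Test d (n + 1) →L[ℂ] Fock d n :=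
  (((Real.sqrt (n + 1) : ℝ) : ℂ) •
    toTensor fun s ↦ ∑ j : Fin 2, contract n (pairing (F j)) ∘L
      testComponent (Fin.cons j s : Fin (n + 1) → Fin 2)).codRestrict (Fock d n)
  (by
    intro g
    rw [mem_Fock]
    intro σ
    ext1 s
    have h : Lp.compMeasurePreserving (fun w : Fin n → E d ↦ w ∘ σ) (measurePreserving_comp σ)
        (∑ j : Fin 2, contract n (pairing (F j)) (g.1 (Fin.cons j (s ∘ σ)))) =
        ((Equiv.Perm.sign σ : ℤ) : ℂ) •
          ∑ j : Fin 2, contract n (pairing (F j)) (g.1 (Fin.cons j s)) := by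
      rw [map_sum, Finset.smul_sum]
      exact Finset.sum_congr rfl fun j _ ↦ contract_perm σ j s (pairing (F j)) g
    simp only [FunLike.coe_smul, Pi.smul_apply, map_smul, PiLp.smul_apply]
    rw [smul_comm]
    congr 1)

/-- The restriction of `a(F₁, F₂)` to `𝓕_a^{(n)}(Φ)`. -/
def annDSum (F : Fin 2 → 𝓢'(E d, ℂ)) : (n : ℕ) → Test d n →L[ℂ] FockFin d
  | 0 => 0
  | n + 1 => FinSum.single (V := fun n ↦ Fock d n) n ∘L annDN n F

/-- The annihilation operator `a(F₁, F₂)` on `𝓕_{a,fin}(Φ)`. -/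
def annD (F : Fin 2 → 𝓢'(E d, ℂ)) : TestFin d →L[ℂ] FockFin d :=
  FinSum.lift (annDSum F)

/-- The creation operator `a*(F₁, F₂) : 𝓕_{a,fin}(H ⊕ H) → 𝓕*_{a,fin}(Φ)` for
`(F₁, F₂) ∈ Φ'`, the adjoint of the annihilation operator `a(F₁, F₂)`. -/
def creD (F : Fin 2 → 𝓢'(E d, ℂ)) : FockFin d →ₗ[ℂ] TestDual d := adj (annD F)

end FockSpace
/-! ### The free Fermi gas of finite density -/

section FermiGas

variable {d : ℕ}

/-- The density distribution `k̂` in momentum space: an integrable function on `ℝ^d` with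
`0 ≤ k̂ ≤ 1` (almost everywhere). -/
structure MomentumDensity (d : ℕ) where
  /-- The function `k̂`. -/
  khat : E d → ℝ
  integrable : Integrable khat
  nonneg : ∀ᵐ p, 0 ≤ khat p
  le_one : ∀ᵐ p, khat p ≤ 1

/-! The Fourier transform `F f(p) = (2π)^{-d/2} ∫ e^{-i x·p} f(x) dx` and the transform
`𝓕 f(ξ) = ∫ e^{-2πi x·ξ} f(x) dx` of Mathlib are related by `F f(p) = (2π)^{-d/2} 𝓕 f(p / (2π))`.
Hence `F⁻¹ m F = 𝓕⁻¹ m(2π ·) 𝓕` for the operator of multiplication by a function `m`, and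
`(2π)^{-d/2} F⁻¹ m = 𝓕⁻¹ (m(2π ·))`. -/

/-- The function `ξ ↦ k̂(2πξ)^{1/2}`. -/
def sym₁ (k : MomentumDensity d) (ξ : E d) : ℂ := (Real.sqrt (k.khat ((2 * Real.pi) • ξ)) : ℝ)

/-- The function `ξ ↦ (1 - k̂(2πξ))^{1/2}`. -/
def sym₂ (k : MomentumDensity d) (ξ : E d) : ℂ := (Real.sqrt (1 - k.khat ((2 * Real.pi) • ξ)) : ℝ)

theorem integrable_scaled (k : MomentumDensity d) :
    Integrable fun ξ : E d ↦ k.khat ((2 * Real.pi) • ξ) :=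
  (integrable_comp_smul_iff volume k.khat (by positivity)).2 k.integrable

theorem quasiMeasurePreserving_two_pi (d : ℕ) :
    Measure.QuasiMeasurePreserving (fun ξ : E d ↦ (2 * Real.pi) • ξ) volume volume :=
  Measure.quasiMeasurePreserving_smul volume (by positivity)

theorem nonneg_scaled (k : MomentumDensity d) :
    ∀ᵐ ξ : E d, 0 ≤ k.khat ((2 * Real.pi) • ξ) :=
  (quasiMeasurePreserving_two_pi d).ae k.nonneg

theorem memLp_sym₁ (k : MomentumDensity d) : MemLp (sym₁ k) 2 volume := by
  have hm : AEStronglyMeasurable (sym₁ k) volume :=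
    Complex.continuous_ofReal.comp_aestronglyMeasurable
      (Real.continuous_sqrt.comp_aestronglyMeasurable (integrable_scaled k).aestronglyMeasurable)
  rw [memLp_two_iff_integrable_sq_norm hm]
  refine (integrable_scaled k).congr ?_
  filter_upwards [nonneg_scaled k] with ξ hξ
  simp [sym₁, Real.sq_sqrt hξ, abs_of_nonneg (Real.sqrt_nonneg _)]

theorem memLp_top_sym₁ (k : MomentumDensity d) : MemLp (sym₁ k) ∞ volume := by
  refine memLp_top_of_bound (Complex.continuous_ofReal.comp_aestronglyMeasurable
    (Real.continuous_sqrt.comp_aestronglyMeasurable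
      (integrable_scaled k).aestronglyMeasurable)) 1 ?_
  have h : ∀ᵐ ξ : E d, k.khat ((2 * Real.pi) • ξ) ≤ 1 :=
    (quasiMeasurePreserving_two_pi d).ae k.le_one
  filter_upwards [h] with ξ hξ
  simpa [sym₁, abs_of_nonneg (Real.sqrt_nonneg _)] using hξ

theorem memLp_top_sym₂ (k : MomentumDensity d) : MemLp (sym₂ k) ∞ volume := by
  refine memLp_top_of_bound (Complex.continuous_ofReal.comp_aestronglyMeasurable
    (Real.continuous_sqrt.comp_aestronglyMeasurable
      (aestronglyMeasurable_const.sub (integrable_scaled k).aestronglyMeasurable))) 1 ?_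
  filter_upwards [nonneg_scaled k] with ξ hξ
  simpa [sym₂, abs_of_nonneg (Real.sqrt_nonneg _)] using hξ

/-- The operator of multiplication by a bounded function in `L²_ℂ(ℝ^d)`. -/
def mulOp (m : Lp (α := E d) ℂ ∞) : L2E d →L[ℂ] L2E d :=
  (ContinuousLinearMap.mul ℂ ℂ).holderL (volume : Measure (E d)) ∞ 2 2 m

/-- The operator `𝓕⁻¹ m 𝓕` in `L²_ℂ(ℝ^d)`. -/
def multiplier (m : Lp (α := E d) ℂ ∞) : L2E d →L[ℂ] L2E d :=
  ((Lp.fourierTransformₗᵢ (E d) ℂ).symm : L2E d →L[ℂ] L2E d) ∘L mulOp m ∘L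
    (Lp.fourierTransformₗᵢ (E d) ℂ : L2E d →L[ℂ] L2E d)

/-- `K₁ = K^{1/2} = F⁻¹ k̂^{1/2} F`. -/
def K₁ (k : MomentumDensity d) : L2E d →L[ℂ] L2E d := multiplier ((memLp_top_sym₁ k).toLp _)

/-- `K₂ = (1 - K)^{1/2} = F⁻¹ (1 - k̂)^{1/2} F`. -/
def K₂ (k : MomentumDensity d) : L2E d →L[ℂ] L2E d := multiplier ((memLp_top_sym₂ k).toLp _)

/-- The complex conjugation `J f = conj f` in `L²_ℂ(ℝ^d)`. -/
def J : L2E d →L⋆[ℂ] L2E d :=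
  LinearMap.mkContinuous
    { toFun := fun f ↦ star f
      map_add' := fun f g ↦ by
        refine Lp.ext ?_
        filter_upwards [Lp.coeFn_star (f + g), Lp.coeFn_star f, Lp.coeFn_star g,
          Lp.coeFn_add f g, Lp.coeFn_add (star f) (star g)] with x h1 h2 h3 h4 h5
        simp only [Pi.star_apply, Pi.add_apply] at h1 h2 h3 h4 h5
        rw [h1, h5, h2, h3, h4, star_add]
      map_smul' := fun c f ↦ by
        refine Lp.ext ?_
        filter_upwards [Lp.coeFn_star (c • f), Lp.coeFn_star f, Lp.coeFn_smul c f,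
          Lp.coeFn_smul (conj c) (star f)] with x h1 h2 h3 h4
        simp only [Pi.star_apply, Pi.smul_apply] at h1 h2 h3 h4
        rw [h1, h4, h2, h3, star_smul]
        rfl } 1
    (fun f ↦ by
      rw [one_mul]
      refine Lp.norm_le_norm_of_ae_le ?_
      filter_upwards [Lp.coeFn_star f] with x h1
      rw [Pi.star_apply] at h1
      exact (congrArg norm h1).trans_le (norm_star _).le)

/-- `κ₁ = (2π)^{-d/2} F⁻¹ k̂^{1/2} ∈ L²_ℂ(ℝ^d)`. -/
def κ₁ (k : MomentumDensity d) : L2E d := 𝓕⁻ ((memLp_sym₁ k).toLp _ : L2E d)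

/-- `κ₂ = (2π)^{-d/2} F⁻¹ (1 - k̂)^{1/2} ∈ S'_ℂ(ℝ^d)`. -/
def κ₂ (k : MomentumDensity d) : 𝓢'(E d, ℂ) :=
  𝓕⁻ (Lp.toTemperedDistribution ((memLp_top_sym₂ k).toLp _ : Lp (α := E d) ℂ ∞))

/-- `κ_{1,x}(y) = κ₁(y - x)`, so that `⟨κ_{1,x}, φ⟩ = ⟨κ₁, φ(x + ·)⟩`. -/
def κ₁x (k : MomentumDensity d) (x : E d) : L2E d :=
  Lp.compMeasurePreserving (fun y ↦ y - x) (measurePreserving_sub_right volume x) (κ₁ k)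

/-- The translate `κ_{2,x}` of `κ₂`, given by `⟨κ_{2,x}, φ⟩ = ⟨κ₂, φ(x + ·)⟩`. -/
def κ₂x (k : MomentumDensity d) (x : E d) : 𝓢'(E d, ℂ) :=
  PointwiseConvergenceCLM.precomp ℂ (SchwartzMap.compSubConstCLM ℂ (-x)) (κ₂ k)

/-- The inclusion of `H_ℂ` into `H_ℂ ⊕ H_ℂ` as copy number `i`. -/
def copy (i : Fin 2) : L2E d →L[ℂ] HH d :=
  ((PiLp.continuousLinearEquiv 2 ℂ (fun _ : Fin 2 ↦ L2E d)).symm :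
    (Fin 2 → L2E d) →L[ℂ] HH d) ∘L ContinuousLinearMap.single ℂ (fun _ : Fin 2 ↦ L2E d) i

/-- The operator in `H_ℂ ⊕ H_ℂ` that acts as `B` in the copy number `i` of `H_ℂ` and vanishes on the
other copy. -/
def block (i : Fin 2) (B : L2E d →L[ℂ] L2E d) : HH d →L[ℂ] HH d :=
  copy i ∘L B ∘L PiLp.proj 2 (fun _ : Fin 2 ↦ L2E d) i

end FermiGas
section Density

variable {d : ℕ}

/-- `a₁(f) = a(f, 0)` for `i = 0` and `a₂(f) = a(0, f)` for `i = 1`, with `f ∈ H_ℂ`. -/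
def annCopy (i : Fin 2) (f : L2E d) : FockFin d →L[ℂ] FockFin d := ann (copy i f)

/-- `a₁*(f) = a*(f, 0)` for `i = 0` and `a₂*(f) = a*(0, f)` for `i = 1`, with `f ∈ H_ℂ`. -/
def creCopy (i : Fin 2) (f : L2E d) : FockFin d →L[ℂ] FockFin d := cre (copy i f)

/-- `a₁(F) = a(F, 0)` for `i = 0` and `a₂(F) = a(0, F)` for `i = 1`, with `F ∈ S'_ℂ`. -/
def annDCopy (i : Fin 2) (F : 𝓢'(E d, ℂ)) : TestFin d →L[ℂ] FockFin d := annD (Pi.single i F)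

/-- `a₁*(F) = a*(F, 0)` for `i = 0` and `a₂*(F) = a*(0, F)` for `i = 1`, with `F ∈ S'_ℂ`. -/
def creDCopy (i : Fin 2) (F : 𝓢'(E d, ℂ)) : FockFin d →ₗ[ℂ] TestDual d := creD (Pi.single i F)

/-- `ψ(x) = a₂(κ_{2,x}) + a₁*(conj κ_{1,x})`. -/
def ψ (k : MomentumDensity d) (x : E d) : TestFin d →L[ℂ] FockFin d :=
  annDCopy 1 (κ₂x k x) + creCopy 0 (J (κ₁x k x)) ∘L emb d

/-- `ψ*(x) = a₂*(κ_{2,x}) + a₁(conj κ_{1,x})`. -/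
def ψstar (k : MomentumDensity d) (x : E d) : FockFin d →ₗ[ℂ] TestDual d :=
  creDCopy 1 (κ₂x k x) + toDual d ∘ₗ (annCopy 0 (J (κ₁x k x)) : FockFin d →ₗ[ℂ] FockFin d)

/-- The particle density `ρ_a(x) = ψ*(x) ψ(x) : 𝓕_{a,fin}(Φ) → 𝓕*_{a,fin}(Φ)`. -/
def ρ (k : MomentumDensity d) (x : E d) : TestFin d →ₗ[ℂ] TestDual d :=
  ψstar k x ∘ₗ (ψ k x : TestFin d →ₗ[ℂ] FockFin d)

/-- `a₂*(κ_{2,x}) a₁*(conj κ_{1,x})`. -/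
def ρ₁ (k : MomentumDensity d) (x : E d) : TestFin d →ₗ[ℂ] TestDual d :=
  creDCopy 1 (κ₂x k x) ∘ₗ (creCopy 0 (J (κ₁x k x)) ∘L emb d : TestFin d →L[ℂ] FockFin d)

/-- `a₂*(κ_{2,x}) a₂(κ_{2,x})`. -/
def ρ₂ (k : MomentumDensity d) (x : E d) : TestFin d →ₗ[ℂ] TestDual d :=
  creDCopy 1 (κ₂x k x) ∘ₗ (annDCopy 1 (κ₂x k x) : TestFin d →ₗ[ℂ] FockFin d)

/-- `a₁(conj κ_{1,x}) a₁*(conj κ_{1,x})`. -/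
def ρ₃ (k : MomentumDensity d) (x : E d) : TestFin d →ₗ[ℂ] TestDual d :=
  toDual d ∘ₗ (annCopy 0 (J (κ₁x k x)) ∘L creCopy 0 (J (κ₁x k x)) ∘L emb d : TestFin d →L[ℂ] FockFin d)

/-- `a₁(conj κ_{1,x}) a₂(κ_{2,x})`. -/
def ρ₄ (k : MomentumDensity d) (x : E d) : TestFin d →ₗ[ℂ] TestDual d :=
  toDual d ∘ₗ (annCopy 0 (J (κ₁x k x)) ∘L annDCopy 1 (κ₂x k x) : TestFin d →L[ℂ] FockFin d)

/-- The statement that the continuous operator `R` on `𝓕_{a,fin}(H ⊕ H)` is the integral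
`∫ f(x) T(x) dx` of a family of operators `T(x) : 𝓕_{a,fin}(Φ) → 𝓕*_{a,fin}(Φ)`, that is,
`⟨G₂, R G₁⟩ = ∫ f(x) ⟨G₂, T(x) G₁⟩ dx` (with an absolutely convergent integral) for all
`G₁, G₂ ∈ 𝓕_{a,fin}(Φ)`. -/
def IsSmeared (f : 𝓢(E d, ℝ)) (T : E d → TestFin d →ₗ[ℂ] TestDual d)
    (R : FockFin d →L[ℂ] FockFin d) : Prop :=
  ∀ G₁ G₂ : TestFin d,
    Integrable (fun x ↦ (f x : ℂ) * T x G₁ G₂) ∧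
      toDual d (R (emb d G₁)) G₂ = ∫ x, (f x : ℂ) * T x G₁ G₂

/-- The statement that `R` is the second quantization `dΓ(A)` of the bounded operator `A` on
`H_ℂ ⊕ H_ℂ`, that is, `R` is continuous and acts as
`A ⊗ 1 ⊗ ⋯ ⊗ 1 + 1 ⊗ A ⊗ 1 ⊗ ⋯ ⊗ 1 + ⋯ + 1 ⊗ ⋯ ⊗ 1 ⊗ A` on `𝓕_a^{(n)}(H ⊕ H)`, in which the vectors
`h₁ ∧ ⋯ ∧ hₙ` are total. -/
def IsSecondQuantization (A : HH d →L[ℂ] HH d) (R : FockFin d →L[ℂ] FockFin d) : Prop :=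
  ∀ (n : ℕ) (h : Fin n → HH d),
    R (FinSum.single (V := fun n ↦ Fock d n) n (wedge h)) =
      FinSum.single (V := fun n ↦ Fock d n) n
        (∑ i, wedge (Function.update h i (A (h i))))

/-- The statement that `R` is the two-particle creation operator with kernel
`Ψ ∈ (H_ℂ ⊕ H_ℂ)^{⊗ 2}`: it maps `u ∈ 𝓕_a^{(n)}` to `√((n+1)(n+2)) Ψ ∧ u ∈ 𝓕_a^{(n+2)}`. For
`Ψ = h₁ ⊗ h₂` this is the operator `a*(h₁) a*(h₂)`. -/
def IsPairCreation (Ψ : Tensor d 2) (R : FockFin d →L[ℂ] FockFin d) : Prop :=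
  ∀ (n : ℕ) (u : Fock d n),
    R (FinSum.single (V := fun n ↦ Fock d n) n u) =
      FinSum.single (V := fun n ↦ Fock d n) (n + 2)
        (((Real.sqrt ((n + 1) * (n + 2)) : ℝ) : ℂ) • wedgeLeft n Ψ u)

/-- The element `(g 0, g 1)` of `Φ`, as an element of `H_ℂ ⊕ H_ℂ`. -/
def testPair (g : Fin 2 → 𝓢(E d, ℂ)) : HH d :=
  WithLp.toLp 2 fun i ↦ (g i).toLp 2 volume

/-- The statement that `Ψ ∈ (H_ℂ ⊕ H_ℂ)^{⊗ 2}` is the integral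
`∫ f(x) (0, κ_{2,x}) ⊗ (conj κ_{1,x}, 0) dx`, tested against `g ⊗ h` for `g, h ∈ Φ`. -/
def IsPairKernel (k : MomentumDensity d) (f : 𝓢(E d, ℝ)) (Ψ : Tensor d 2) : Prop :=
  ∀ g h : Fin 2 → 𝓢(E d, ℂ),
    Integrable (fun x ↦ (f x : ℂ) *
      (pairing (κ₂x k x) (g 1) * inner ℂ (J (κ₁x k x)) ((h 0).toLp 2 volume))) ∧
    inner ℂ Ψ (tprod ![testPair g, testPair h]) =
      ∫ x, (f x : ℂ) * (pairing (κ₂x k x) (g 1) * inner ℂ (J (κ₁x k x)) ((h 0).toLp 2 volume))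

/-- The operator of multiplication by a Schwartz function in `L²_ℂ(ℝ^d)`. -/
def mulSchwartz (f : 𝓢(E d, ℝ)) : L2E d →L[ℂ] L2E d :=
  mulOp ((f.memLp_top (μ := volume)).ofReal (K := ℂ)).toLp

/-- `𝒜_{1,f} = (J K₁ J f J K₁ J) ⊕ 0`. -/
def A₁ (k : MomentumDensity d) (f : 𝓢(E d, ℝ)) : HH d →L[ℂ] HH d :=
  block 0 ((J.comp ((K₁ k).comp J)) ∘L mulSchwartz f ∘L (J.comp ((K₁ k).comp J)))

/-- `𝒜_{2,f} = 0 ⊕ (K₂ f K₂)`. -/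
def A₂ (k : MomentumDensity d) (f : 𝓢(E d, ℝ)) : HH d →L[ℂ] HH d :=
  block 1 (K₂ k ∘L mulSchwartz f ∘L K₂ k)

end Density

end FermiGas

end

open FermiGas

/-! The key observation is that pairing with the translated kernels is evaluation at a point. For a
Schwartz function φ one has `⟨κ_{2,x}, φ⟩ = (K₂ φ)(x)` and `(conj κ_{1,x}, φ) = (J K₁ J φ)(x)`,
where the right-hand sides are absolutely convergent inverse Fourier integrals, continuous in x.
This is `isKernel_K₂` and `isKernel_JKJ`. Both operators are bounded and, their symbols being real,
self-adjoint.

Let A be one of these operators and a(x) the annihilation operator of the corresponding kernel. On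
an (n+1)-particle test function G, a(x) is `√(n+1)` times the contraction of the first variable, so
a(x)G is `√(n+1)` times the slice at x of `(A ⊗ 1)G` (`IsKernel.onFirst_toLp`). Fubini in the first
variable therefore gives `∫ f(x) ⟨a(x)G₂, a(x)G₁⟩ dx = (n+1) ⟨(A ⊗ 1)G₂, (f ⊗ 1)(A ⊗ 1)G₁⟩`. Moving
A across turns this into `⟨G₂, dΓ(A f A) G₁⟩`, because on antisymmetric vectors all n+1 summands of
dΓ contribute equally. That is the second operator (`IsKernel.smear_contract`,
`IsKernel.isSmeared`).

The third operator reduces to the same computation by the canonical anticommutation relation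
`ann_cre`: `a(g)a*(g) = ‖g‖² - a*(g)a(g)` with `g = conj κ_{1,x}`. The norm does not depend on x,
and by Plancherel and scaling its square is `(2π)^{-d} ∫ k̂`.

For the pair terms, `Θ(x, y) = f(x) conj κ₁(y - x)` is square integrable, since f and κ₁ are and the
shear `(x, y) ↦ (x, y - x)` preserves Lebesgue measure. Contracting G first with `κ_{2,x}` and then
with `conj κ_{1,x}`, and integrating against f, pairs `(K₂ ⊗ 1)G` with `Θ ⊗ v`. So the kernel of the
pair operators is `Ψ = (K₂ ⊗ 1)Θ`, with its first factor in the second copy and its second factor in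
the first copy of `H_ℂ`. This yields the fourth operator; the first is its formal adjoint, and
smearing respects adjoints because f is real.

All operators are bounded between particle spaces and are assembled through the universal property
of the direct sum, which makes them continuous. Uniqueness holds because test functions are dense in
each particle space and the entries of an element of the direct sum are continuous
(`eq_of_toDual_eq`). -/

noncomputable section

namespace FermiGas

/-! ### Products of functions of separate variables -/

section Product

variable {d : ℕ}

/-- Splitting off the first variable. -/
def consEquiv (d n : ℕ) : E d × (Fin n → E d) ≃ᵐ (Fin (n + 1) → E d) :=
  (MeasurableEquiv.piFinSuccAbove (fun _ ↦ E d) 0).symm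

theorem consEquiv_apply (n : ℕ) (p : E d × (Fin n → E d)) :
    consEquiv d n p = Fin.cons p.1 p.2 := by
  exact congrFun (Fin.insertNth_zero' p.1 p.2) |> funext

theorem measurePreserving_consEquiv (d n : ℕ) :
    MeasurePreserving (consEquiv d n) (volume.prod volume) volume :=
  (volume_preserving_piFinSuccAbove (fun _ : Fin (n + 1) ↦ E d) 0).symm

theorem consEquiv_symm_apply (n : ℕ) (z : Fin (n + 1) → E d) :
    (consEquiv d n).symm z = (z 0, Fin.tail z) := by
  rw [MeasurableEquiv.symm_apply_eq, consEquiv_apply, Fin.cons_self_tail]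

theorem measurePreserving_eval_zero_tail (d n : ℕ) :
    MeasurePreserving (fun z : Fin (n + 1) → E d ↦ (z 0, Fin.tail z)) volume
      (volume.prod volume) := by
  have h := (measurePreserving_consEquiv d n).symm
  convert h using 1
  funext z
  rw [consEquiv_symm_apply]

theorem quasiMeasurePreserving_zero (d n : ℕ) :
    Measure.QuasiMeasurePreserving (fun z : Fin (n + 1) → E d ↦ z 0) volume volume :=
  Measure.quasiMeasurePreserving_fst.comp
    (measurePreserving_eval_zero_tail d n).quasiMeasurePreserving

theorem quasiMeasurePreserving_tail (d n : ℕ) :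
    Measure.QuasiMeasurePreserving (fun z : Fin (n + 1) → E d ↦ (Fin.tail z : Fin n → E d))
      volume volume :=
  Measure.quasiMeasurePreserving_snd.comp
    (measurePreserving_eval_zero_tail d n).quasiMeasurePreserving

theorem ae_ae_of_ae_cons {n : ℕ} {p : (Fin (n + 1) → E d) → Prop} (h : ∀ᵐ z, p z) :
    ∀ᵐ w : Fin n → E d, ∀ᵐ y : E d, p (Fin.cons y w) := by
  have h1 := (measurePreserving_consEquiv d n).quasiMeasurePreserving.ae h
  have h2 := Measure.ae_ae_of_ae_prod
    (Measure.measurePreserving_swap (μ := (volume : Measure (Fin n → E d)))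
      (ν := (volume : Measure (E d))) |>.quasiMeasurePreserving.ae h1)
  filter_upwards [h2] with w hw
  filter_upwards [hw] with y hy
  simpa [consEquiv_apply] using hy

theorem ae_ae_of_ae_cons' {n : ℕ} {p : (Fin (n + 1) → E d) → Prop} (h : ∀ᵐ z, p z) :
    ∀ᵐ y : E d, ∀ᵐ w : Fin n → E d, p (Fin.cons y w) := by
  have h1 := (measurePreserving_consEquiv d n).quasiMeasurePreserving.ae h
  filter_upwards [Measure.ae_ae_of_ae_prod h1] with y hy
  filter_upwards [hy] with w hw
  simpa [consEquiv_apply] using hw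

theorem integrable_cons {n : ℕ} {F : (Fin (n + 1) → E d) → ℂ} (hF : Integrable F) :
    Integrable (fun p : E d × (Fin n → E d) ↦ F (Fin.cons p.1 p.2)) (volume.prod volume) := by
  have := (measurePreserving_consEquiv d n).integrable_comp_of_integrable hF
  refine this.congr (Filter.Eventually.of_forall fun p ↦ ?_)
  simp [consEquiv_apply]

theorem integral_cons {n : ℕ} {F : (Fin (n + 1) → E d) → ℂ} (hF : Integrable F) :
    ∫ z, F z = ∫ y : E d, ∫ w : Fin n → E d, F (Fin.cons y w) := by
  rw [← (measurePreserving_consEquiv d n).integral_comp' F]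
  simp only [consEquiv_apply]
  exact integral_prod _ (integrable_cons hF)

theorem integral_cons' {n : ℕ} {F : (Fin (n + 1) → E d) → ℂ} (hF : Integrable F) :
    ∫ z, F z = ∫ w : Fin n → E d, ∫ y : E d, F (Fin.cons y w) := by
  rw [← (measurePreserving_consEquiv d n).integral_comp' F]
  simp only [consEquiv_apply]
  exact integral_prod_symm _ (integrable_cons hF)

theorem outer_coeFn {m : ℕ} (n : ℕ) (a : L2 d m) (b : L2 d n) :
    outer n a b =ᵐ[volume] fun z ↦ a (z ∘ firstIdx m n) * b (z ∘ lastIdx m n) := by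
  have h1 : outer n a b = Lp.compMeasurePreserving _ (measurePreserving_split m n)
      ((memLp_mul_prod a b).toLp _) := rfl
  rw [h1]
  refine (Lp.coeFn_compMeasurePreserving _ _).trans ?_
  exact (measurePreserving_split m n).quasiMeasurePreserving.ae_eq_comp
    (memLp_mul_prod a b).coeFn_toLp

theorem norm_outer {m : ℕ} (n : ℕ) (a : L2 d m) (b : L2 d n) :
    ‖outer n a b‖ = ‖a‖ * ‖b‖ := by
  have h1 : outer n a b = Lp.compMeasurePreserving _ (measurePreserving_split m n)
      ((memLp_mul_prod a b).toLp _) := rfl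
  rw [h1, Lp.norm_compMeasurePreserving, Lp.norm_toLp, eLpNorm_mul_prod, ENNReal.toReal_mul]
  rfl

theorem quasiMeasurePreserving_firstIdx (d m n : ℕ) :
    Measure.QuasiMeasurePreserving (fun z : Fin (n + m) → E d ↦ z ∘ firstIdx m n)
      volume volume :=
  Measure.quasiMeasurePreserving_fst.comp (measurePreserving_split m n).quasiMeasurePreserving

theorem outer_add {m : ℕ} (n : ℕ) (a a' : L2 d m) (b : L2 d n) :
    outer n (a + a') b = outer n a b + outer n a' b := by
  refine Lp.ext ?_
  filter_upwards [outer_coeFn n (a + a') b, outer_coeFn n a b, outer_coeFn n a' b,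
    Lp.coeFn_add (outer n a b) (outer n a' b),
    (quasiMeasurePreserving_firstIdx d m n).ae_eq_comp (Lp.coeFn_add a a')] with z h1 h2 h3 h4 h5
  simp only [Function.comp_apply, Pi.add_apply] at h5
  rw [h1, h4, Pi.add_apply, h2, h3, h5, add_mul]

theorem outer_smul {m : ℕ} (n : ℕ) (c : ℂ) (a : L2 d m) (b : L2 d n) :
    outer n (c • a) b = c • outer n a b := by
  refine Lp.ext ?_
  filter_upwards [outer_coeFn n (c • a) b, outer_coeFn n a b,
    Lp.coeFn_smul c (outer n a b),
    (quasiMeasurePreserving_firstIdx d m n).ae_eq_comp (Lp.coeFn_smul c a)] with z h1 h2 h4 h5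
  simp only [Function.comp_apply, Pi.smul_apply] at h5
  rw [h1, h4, Pi.smul_apply, h2, h5, smul_eq_mul, smul_eq_mul, mul_assoc]

/-- The map `a ↦ a ⊗ b`. -/
def outerFlip {n : ℕ} (m : ℕ) (b : L2 d n) : L2 d m →L[ℂ] L2 d (n + m) :=
  LinearMap.mkContinuous
    { toFun := fun a ↦ outer n a b
      map_add' := fun a a' ↦ outer_add n a a' b
      map_smul' := fun c a ↦ outer_smul n c a b } ‖b‖
    (fun a ↦ by
      change ‖outer n a b‖ ≤ _
      rw [norm_outer, mul_comm])

/-- A function of one variable as a function on `Fin 1 → ℝ^d`. -/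
def oneVar (g : L2E d) : L2 d 1 := (memLp_prod fun _ : Fin 1 ↦ g).toLp _

theorem oneVar_coeFn (g : L2E d) : oneVar g =ᵐ[volume] fun z ↦ g (z 0) := by
  refine (MemLp.coeFn_toLp _).trans (Filter.Eventually.of_forall fun z ↦ ?_)
  simp

/-- The product `(g ⊗ b)(z₀, z₁, …) = g(z₀) b(z₁, …)`. -/
def prodL (n : ℕ) (g : L2E d) : L2 d n →L[ℂ] L2 d (n + 1) := outer n (oneVar g)

theorem prodL_coeFn {n : ℕ} (g : L2E d) (b : L2 d n) :
    prodL n g b =ᵐ[volume] fun z ↦ g (z 0) * b (Fin.tail z) := by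
  filter_upwards [outer_coeFn n (oneVar g) b,
    (quasiMeasurePreserving_firstIdx d 1 n).ae_eq_comp (oneVar_coeFn g)] with z h1 h2
  simp only [Function.comp_apply] at h2
  exact h1.trans (by rw [h2]; rfl)

theorem inner_prodL_left {n : ℕ} (g : L2E d) (b : L2 d n) (u : L2 d (n + 1)) :
    Integrable (fun z : Fin (n + 1) → E d ↦ conj (g (z 0)) * conj (b (Fin.tail z)) * u z) ∧
    inner ℂ (prodL n g b) u = ∫ z, conj (g (z 0)) * conj (b (Fin.tail z)) * u z := by
  have h : (fun z ↦ inner ℂ (prodL n g b z) (u z)) =ᵐ[volume]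
      fun z ↦ conj (g (z 0)) * conj (b (Fin.tail z)) * u z := by
    filter_upwards [prodL_coeFn g b] with z hz
    rw [hz, RCLike.inner_apply', map_mul]
  exact ⟨(L2.integrable_inner (𝕜 := ℂ) (prodL n g b) u).congr h, integral_congr_ae h⟩

theorem inner_prodL_prodL {n : ℕ} (g g' : L2E d) (b b' : L2 d n) :
    inner ℂ (prodL n g b) (prodL n g' b') = inner ℂ g g' * inner ℂ b b' := by
  rw [(inner_prodL_left g b _).2, L2.inner_def, L2.inner_def, ← integral_prod_mul,
    ← (measurePreserving_consEquiv d n).integral_comp' ]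
  refine integral_congr_ae ?_
  filter_upwards [(measurePreserving_consEquiv d n).quasiMeasurePreserving.ae (prodL_coeFn g' b')]
    with p hp
  rw [hp]
  simp only [consEquiv_apply, Fin.cons_zero, Fin.tail_cons, RCLike.inner_apply']
  ring

theorem prodL_add {n : ℕ} (g g' : L2E d) : prodL n (g + g') = prodL n g + prodL n g' := by
  ext1 b
  refine Lp.ext ?_
  rw [_root_.add_apply]
  filter_upwards [prodL_coeFn (g + g') b, prodL_coeFn g b, prodL_coeFn g' b,
    Lp.coeFn_add (prodL n g b) (prodL n g' b),
    (quasiMeasurePreserving_zero d n).ae_eq_comp (Lp.coeFn_add g g')] with z h1 h2 h3 h4 h5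
  simp only [Function.comp_apply, Pi.add_apply] at h5
  rw [h1, h4, Pi.add_apply, h2, h3, h5, add_mul]

theorem prodL_smul {n : ℕ} (c : ℂ) (g : L2E d) : prodL n (c • g) = c • prodL n g := by
  ext1 b
  refine Lp.ext ?_
  rw [_root_.smul_apply]
  filter_upwards [prodL_coeFn (c • g) b, prodL_coeFn g b, Lp.coeFn_smul c (prodL n g b),
    (quasiMeasurePreserving_zero d n).ae_eq_comp (Lp.coeFn_smul c g)] with z h1 h2 h4 h5
  simp only [Function.comp_apply, Pi.smul_apply] at h5
  rw [h1, h4, Pi.smul_apply, h2, h5, smul_eq_mul, smul_eq_mul, mul_assoc]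

/-- The contraction of the first variable with `g`, the adjoint of `b ↦ g ⊗ b`. -/
def contr (n : ℕ) (g : L2E d) : L2 d (n + 1) →L[ℂ] L2 d n :=
  ContinuousLinearMap.adjoint (prodL n g)

/-- Fubini, applied to the pairing of u with g times the indicator of a set of finite measure,
identifies the integrals of both sides over every such set. On a σ-finite space these integrals
determine a function almost everywhere. -/
theorem contr_coeFn {n : ℕ} (g : L2E d) (u : L2 d (n + 1)) :
    contr n g u =ᵐ[volume] fun w ↦ ∫ y, conj (g y) * u (Fin.cons y w) := by
  have key (s : Set (Fin n → E d)) (hs : MeasurableSet s) (hμ : volume s < ∞) :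
      IntegrableOn (fun w ↦ ∫ y, conj (g y) * u (Fin.cons y w)) s ∧
      ∫ w in s, contr n g u w = ∫ w in s, ∫ y, conj (g y) * u (Fin.cons y w) := by
    obtain ⟨h1, h2⟩ := inner_prodL_left g (indicatorConstLp 2 hs hμ.ne (1 : ℂ)) u
    have h3 := (integrable_cons h1).integral_prod_right
    have h4 : (fun w : Fin n → E d ↦ ∫ y : E d, conj (g ((Fin.cons y w : Fin (n + 1) → E d) 0)) *
        conj ((indicatorConstLp 2 hs hμ.ne (1 : ℂ) : Lp ℂ 2 volume)
          (Fin.tail (Fin.cons y w : Fin (n + 1) → E d))) * u (Fin.cons y w)) =ᵐ[volume]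
        s.indicator fun w ↦ ∫ y, conj (g y) * u (Fin.cons y w) := by
      filter_upwards [indicatorConstLp_coeFn (p := 2) (hs := hs) (hμs := hμ.ne) (c := (1 : ℂ))]
        with w hw
      simp only [Fin.cons_zero, Fin.tail_cons]
      rw [hw]
      by_cases hws : w ∈ s
      · simp [hws]
      · simp [hws]
    refine ⟨?_, ?_⟩
    · rw [← integrable_indicator_iff hs]
      exact h3.congr h4
    · rw [← L2.inner_indicatorConstLp_one hs hμ.ne, contr,
        ContinuousLinearMap.adjoint_inner_right, h2, integral_cons' h1, integral_congr_ae h4,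
        integral_indicator hs]
  refine ae_eq_of_forall_setIntegral_eq_of_sigmaFinite (fun s hs hμ ↦ ?_)
    (fun s hs hμ ↦ (key s hs hμ).1) (fun s hs hμ ↦ (key s hs hμ).2)
  exact integrableOn_Lp_of_measure_ne_top _ one_le_two hμ.ne

theorem memLp_slice {n : ℕ} (u : L2 d (n + 1)) :
    ∀ᵐ w : Fin n → E d, MemLp (fun y : E d ↦ u (Fin.cons y w)) 2 volume := by
  have hm : AEStronglyMeasurable (fun p : E d × (Fin n → E d) ↦ u (Fin.cons p.1 p.2))
      (volume.prod volume) := by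
    have := (Lp.aestronglyMeasurable u).comp_quasiMeasurePreserving
      (measurePreserving_consEquiv d n).quasiMeasurePreserving
    refine this.congr (Filter.Eventually.of_forall fun p ↦ ?_)
    simp [consEquiv_apply]
  have h1 : Integrable (fun p : E d × (Fin n → E d) ↦ ‖u (Fin.cons p.1 p.2)‖ ^ 2)
      (volume.prod volume) := by
    have := (measurePreserving_consEquiv d n).integrable_comp_of_integrable
      ((memLp_two_iff_integrable_sq_norm (Lp.aestronglyMeasurable u)).1 (Lp.memLp u))
    refine this.congr (Filter.Eventually.of_forall fun p ↦ ?_)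
    simp [consEquiv_apply]
  filter_upwards [h1.prod_left_ae, hm.prod_swap.prodMk_left] with w h2 h3
  exact (memLp_two_iff_integrable_sq_norm h3).2 h2

/-- An `L²` function is determined by its slices, tested against `L²` functions. -/
theorem ae_eq_slices {n : ℕ} (u : L2 d (n + 1)) (Φ : (Fin n → E d) → L2E d)
    (h : ∀ g : L2E d, contr n g u =ᵐ[volume] fun w ↦ inner ℂ g (Φ w)) :
    ∀ᵐ w : Fin n → E d, ∀ᵐ y : E d, u (Fin.cons y w) = Φ w y := by
  have : Fact ((2 : ℝ≥0∞) ≠ ∞) := ⟨by norm_num⟩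
  -- The exceptional null set of w in the hypothesis depends on g. Restricting to a countable dense
  -- set of g gives one null set for all of them, and density still determines the slice.
  obtain ⟨D, hDc, hD⟩ := TopologicalSpace.exists_countable_dense (L2E d)
  have h1 : ∀ᵐ w : Fin n → E d, ∀ g ∈ D,
      ∫ y, conj (g y) * u (Fin.cons y w) = inner ℂ g (Φ w) := by
    rw [ae_ball_iff hDc]
    intro g _
    filter_upwards [h g, contr_coeFn g u] with w h1 h2
    rw [← h2, h1]
  filter_upwards [h1, memLp_slice u] with w hw hu
  have h3 : hu.toLp _ = Φ w := by
    refine hD.eq_of_inner_right ℂ fun g hg ↦ ?_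
    rw [← hw g hg, L2.inner_def]
    refine integral_congr_ae ?_
    filter_upwards [hu.coeFn_toLp] with y hy
    rw [hy, RCLike.inner_apply']
  rw [← h3]
  exact hu.coeFn_toLp.symm

/-- Iterated null sets give a joint null set only when the exceptional set is measurable, so u and v
are first replaced by measurable representatives on the product. -/
theorem ae_of_ae_ae_cons {n : ℕ} {u v : (Fin (n + 1) → E d) → ℂ}
    (hu : AEStronglyMeasurable u volume) (hv : AEStronglyMeasurable v volume)
    (h : ∀ᵐ w : Fin n → E d, ∀ᵐ y : E d, u (Fin.cons y w) = v (Fin.cons y w)) :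
    u =ᵐ[volume] v := by
  let e : (Fin n → E d) × E d → (Fin (n + 1) → E d) := consEquiv d n ∘ Prod.swap
  have he : MeasurePreserving e (volume.prod volume) volume :=
    (measurePreserving_consEquiv d n).comp Measure.measurePreserving_swap
  have hu' := hu.comp_quasiMeasurePreserving he.quasiMeasurePreserving
  have hv' := hv.comp_quasiMeasurePreserving he.quasiMeasurePreserving
  have h1 : u ∘ e =ᵐ[volume.prod volume] v ∘ e := by
    refine hu'.ae_eq_mk.trans (Filter.EventuallyEq.trans ?_ hv'.ae_eq_mk.symm)
    refine (Measure.ae_prod_iff_ae_ae (measurableSet_eq_fun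
      hu'.stronglyMeasurable_mk.measurable hv'.stronglyMeasurable_mk.measurable)).2 ?_
    filter_upwards [h, Measure.ae_ae_of_ae_prod hu'.ae_eq_mk,
      Measure.ae_ae_of_ae_prod hv'.ae_eq_mk] with w hw h2 h3
    filter_upwards [hw, h2, h3] with y hy h4 h5
    rw [← h4, ← h5]
    simpa [e, consEquiv_apply] using hy
  have he' : MeasurePreserving (Prod.swap ∘ (consEquiv d n).symm) volume (volume.prod volume) :=
    Measure.measurePreserving_swap.comp (measurePreserving_consEquiv d n).symm
  have h3 := he'.quasiMeasurePreserving.ae_eq_comp h1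
  filter_upwards [h3] with z hz
  simpa [e] using hz

theorem eq_zero_of_contr {n : ℕ} {u : L2 d (n + 1)} (h : ∀ g, contr n g u = 0) : u = 0 := by
  refine Lp.ext ?_
  refine (ae_of_ae_ae_cons (v := 0) (Lp.aestronglyMeasurable u) aestronglyMeasurable_zero ?_).trans
    (Lp.coeFn_zero _ _ _).symm
  have h1 := ae_eq_slices u (fun _ ↦ 0) fun g ↦ by
    rw [h g]
    simpa only [inner_zero_right] using! Lp.coeFn_zero ℂ 2 volume
  filter_upwards [h1] with w hw
  filter_upwards [hw, Lp.coeFn_zero ℂ 2 (volume : Measure (E d))] with y hy h0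
  rw [hy, h0]
  rfl

theorem eq_of_inner_prodL {n : ℕ} {u v : L2 d (n + 1)}
    (h : ∀ g b, (inner ℂ (prodL n g b) u : ℂ) = inner ℂ (prodL n g b) v) : u = v := by
  refine sub_eq_zero.1 (eq_zero_of_contr fun g ↦ ext_inner_left ℂ fun b ↦ ?_)
  rw [contr, ContinuousLinearMap.adjoint_inner_right, inner_zero_right, inner_sub_right, h,
    sub_self]

theorem dense_span_prodL (d n : ℕ) :
    (Submodule.span ℂ {u : L2 d (n + 1) | ∃ g b, u = prodL n g b}).topologicalClosure = ⊤ := by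
  rw [Submodule.topologicalClosure_eq_top_iff, Submodule.eq_bot_iff]
  intro u hu
  refine eq_zero_of_contr fun g ↦ ext_inner_left ℂ fun b ↦ ?_
  rw [contr, ContinuousLinearMap.adjoint_inner_right, inner_zero_right]
  exact (Submodule.mem_orthogonal _ u).1 hu _ (Submodule.subset_span ⟨g, b, rfl⟩)

/-- Products are total because a function orthogonal to all of them has vanishing contractions and
hence vanishing slices. Operator identities in several variables can thus be verified on products.
-/
theorem clm_ext_prodL {n : ℕ} {W : Type*} [AddCommGroup W] [Module ℂ W] [TopologicalSpace W]
    [T2Space W] {S T : L2 d (n + 1) →L[ℂ] W} (h : ∀ g b, S (prodL n g b) = T (prodL n g b)) :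
    S = T := by
  refine ContinuousLinearMap.ext_on (s := {u : L2 d (n + 1) | ∃ g b, u = prodL n g b}) ?_ ?_
  · exact (Submodule.dense_iff_topologicalClosure_eq_top).2 (dense_span_prodL d n)
  · rintro _ ⟨g, b, rfl⟩
    exact h g b

end Product

/-! ### Operators acting on the first variable -/

section FirstVariable

open TensorProduct

variable {d : ℕ}

/-- The canonical map from the algebraic tensor product. -/
def tensorToL2 (d n : ℕ) : L2E d ⊗[ℂ] L2 d n →ₗ[ℂ] L2 d (n + 1) :=
  TensorProduct.lift
    { toFun := fun g ↦ (prodL n g : L2 d n →ₗ[ℂ] L2 d (n + 1))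
      map_add' := fun g g' ↦ by rw [prodL_add]; rfl
      map_smul' := fun c g ↦ by rw [prodL_smul]; rfl }

theorem tensorToL2_tmul {n : ℕ} (g : L2E d) (b : L2 d n) :
    tensorToL2 d n (g ⊗ₜ b) = prodL n g b := rfl

/-- Together with dense range, this makes the `L²` space a completion of the algebraic tensor
product, so that `A ⊗ 1`, bounded there, extends uniquely. -/
theorem inner_tensorToL2 {n : ℕ} (x y : L2E d ⊗[ℂ] L2 d n) :
    inner ℂ (tensorToL2 d n x) (tensorToL2 d n y) = inner ℂ x y := by
  induction x with
  | zero => simp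
  | add x x' hx hx' => rw [map_add, inner_add_left, inner_add_left, hx, hx']
  | tmul g b =>
    induction y with
    | zero => simp
    | add y y' hy hy' => rw [map_add, inner_add_right, inner_add_right, hy, hy']
    | tmul g' b' =>
      rw [tensorToL2_tmul, tensorToL2_tmul, inner_prodL_prodL, TensorProduct.inner_tmul]

theorem norm_tensorToL2 {n : ℕ} (x : L2E d ⊗[ℂ] L2 d n) : ‖tensorToL2 d n x‖ = ‖x‖ := by
  rw [@norm_eq_sqrt_re_inner ℂ, @norm_eq_sqrt_re_inner ℂ, inner_tensorToL2]

theorem denseRange_tensorToL2 (d n : ℕ) : DenseRange (tensorToL2 d n) := by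
  have h : (LinearMap.range (tensorToL2 d n)).topologicalClosure = ⊤ := by
    refine top_le_iff.1 ((dense_span_prodL d n).ge.trans (Submodule.topologicalClosure_mono ?_))
    rw [Submodule.span_le]
    rintro _ ⟨g, b, rfl⟩
    exact ⟨g ⊗ₜ b, rfl⟩
  have h1 := (Submodule.dense_iff_topologicalClosure_eq_top).2 h
  rwa [LinearMap.coe_range] at h1

/-- The operator `A ⊗ 1 ⊗ ⋯ ⊗ 1` on functions of `n + 1` variables. -/
def onFirst (n : ℕ) (A : L2E d →L[ℂ] L2E d) : L2 d (n + 1) →L[ℂ] L2 d (n + 1) :=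
  (tensorToL2 d n ∘ₗ (A.rTensor (L2 d n)).toLinearMap).extendOfNorm (tensorToL2 d n)

theorem onFirst_prodL {n : ℕ} (A : L2E d →L[ℂ] L2E d) (g : L2E d) (b : L2 d n) :
    onFirst n A (prodL n g b) = prodL n (A g) b := by
  rw [← tensorToL2_tmul, onFirst, LinearMap.extendOfNorm_eq (denseRange_tensorToL2 d n)]
  · rfl
  -- `extendOfNorm` agrees with the given map only under a norm bound. Here the bound is that of `A
  -- ⊗ 1` on the algebraic tensor product.
  · refine ⟨‖A‖, fun x ↦ ?_⟩
    rw [norm_tensorToL2, LinearMap.comp_apply, norm_tensorToL2]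
    exact ((A.rTensor (L2 d n)).le_opNorm x).trans
      (mul_le_mul_of_nonneg_right (ContinuousLinearMap.norm_rTensor_le (L2 d n) A) (norm_nonneg _))

theorem onFirst_comp {n : ℕ} (A B : L2E d →L[ℂ] L2E d) :
    onFirst n (A ∘L B) = onFirst n A ∘L onFirst n B :=
  clm_ext_prodL fun g b ↦ by
    simp [onFirst_prodL]

theorem onFirst_adjoint {n : ℕ} (A : L2E d →L[ℂ] L2E d) :
    ContinuousLinearMap.adjoint (onFirst n A) = onFirst n (ContinuousLinearMap.adjoint A) := by
  refine clm_ext_prodL fun g b ↦ ?_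
  refine eq_of_inner_prodL fun g' b' ↦ ?_
  have h1 := ContinuousLinearMap.adjoint_inner_right (onFirst n A) (prodL n g' b') (prodL n g b)
  have h2 := ContinuousLinearMap.adjoint_inner_right A g' g
  rw [h1, onFirst_prodL, onFirst_prodL, inner_prodL_prodL, inner_prodL_prodL, h2]

/-- Associativity of the product: A sees only the first of all variables. It lets the factor K₂ in
the two-particle kernel be moved onto an (n+2)-particle wave function. -/
theorem onFirst_outer {n : ℕ} (A : L2E d →L[ℂ] L2E d) (a : L2 d 2) (b : L2 d n) :
    outer n (onFirst 1 A a) b = onFirst (n + 1) A (outer n a b) := by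
  suffices h : outerFlip 2 b ∘L onFirst 1 A = (onFirst (n + 1) A : L2 d (n + 2) →L[ℂ] L2 d (n + 2)) ∘L outerFlip 2 b from
    DFunLike.congr_fun h a
  refine clm_ext_prodL fun g a' ↦ ?_
  have h (g : L2E d) : outer n (prodL 1 g a' : L2 d 2) b = prodL (n + 1) g (outer n a' b) := by
    refine Lp.ext ?_
    filter_upwards [outer_coeFn n (prodL 1 g a' : L2 d 2) b, prodL_coeFn g (outer n a' b),
      (quasiMeasurePreserving_firstIdx d 2 n).ae_eq_comp (prodL_coeFn g a'),
      (quasiMeasurePreserving_tail d (n + 1)).ae_eq_comp (outer_coeFn n a' b)] with z h1 h2 h3 h4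
    simp only [Function.comp_apply] at h3 h4
    refine h1.trans (Eq.trans ?_ h2.symm)
    rw [h3, h4]
    exact mul_assoc _ _ _
  change outer n (onFirst 1 A (prodL 1 g a')) b = onFirst (n + 1) A (outer n (prodL 1 g a') b)
  rw [onFirst_prodL, h, h, onFirst_prodL]

end FirstVariable

/-! ### Operators with a continuous pointwise kernel -/

section Kernel

variable {d : ℕ}

/-- The bounded operator `A` is given on Schwartz functions by `(A φ)(x) = L_x φ`, where `L_x φ` is
continuous in `x`. -/
structure IsKernel (L : E d → 𝓢(E d, ℂ) →L[ℂ] ℂ) (A : L2E d →L[ℂ] L2E d) : Prop where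
  continuous : ∀ φ, Continuous fun x ↦ L x φ
  ae_eq : ∀ φ : 𝓢(E d, ℂ), A (φ.toLp 2 volume) =ᵐ[volume] fun x ↦ L x φ

theorem contr_toLp {n : ℕ} (g : L2E d) (G : 𝓢(Fin (n + 1) → E d, ℂ)) :
    contr n g (G.toLp 2 volume) =ᵐ[volume]
      fun w ↦ inner ℂ g ((slice w G).toLp 2 volume : L2E d) := by
  filter_upwards [contr_coeFn g (G.toLp 2 volume),
    ae_ae_of_ae_cons (G.coeFn_toLp 2 volume)] with w h1 h2
  rw [h1, L2.inner_def]
  refine integral_congr_ae ?_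
  filter_upwards [h2, (slice w G).coeFn_toLp 2 volume] with y h3 h4
  rw [h3, h4, slice_apply, RCLike.inner_apply']

/-- A function continuous in one variable and measurable in the other is jointly measurable. This is
where the continuity demanded by `IsKernel` is used. -/
theorem IsKernel.aestronglyMeasurable {L : E d → 𝓢(E d, ℂ) →L[ℂ] ℂ} {A : L2E d →L[ℂ] L2E d}
    (hL : IsKernel L A) {n : ℕ} (G : 𝓢(Fin (n + 1) → E d, ℂ)) :
    AEStronglyMeasurable (fun z : Fin (n + 1) → E d ↦ L (z 0) (slice (Fin.tail z) G)) volume := by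
  have h := stronglyMeasurable_uncurry_of_continuous_of_stronglyMeasurable
    (u := fun (y : E d) (w : Fin n → E d) ↦ L y (slice w G)) (fun w ↦ hL.continuous (slice w G))
    (fun y ↦ (continuous_contract (L y) G).stronglyMeasurable)
  exact (h.comp_measurable (measurePreserving_eval_zero_tail d n).measurable).aestronglyMeasurable

/-- `A ⊗ 1 ⊗ ⋯ ⊗ 1` acts on Schwartz functions through the kernel of `A`. -/
theorem IsKernel.onFirst_toLp {L : E d → 𝓢(E d, ℂ) →L[ℂ] ℂ} {A : L2E d →L[ℂ] L2E d}
    (hL : IsKernel L A) {n : ℕ} (G : 𝓢(Fin (n + 1) → E d, ℂ)) :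
    onFirst n A (G.toLp 2 volume) =ᵐ[volume] fun z ↦ L (z 0) (slice (Fin.tail z) G) := by
  refine ae_of_ae_ae_cons (Lp.aestronglyMeasurable _) (hL.aestronglyMeasurable G) ?_
  -- The slices of `(A ⊗ 1)G` are A applied to the slices of G: contraction with g moves A to its
  -- adjoint acting on g, and the contraction of a Schwartz function is a genuine inner product with
  -- its slice.
  have h1 := ae_eq_slices (onFirst n A (G.toLp 2 volume))
    (fun w ↦ A ((slice w G).toLp 2 volume)) fun g ↦ by
      have h2 : contr n g (onFirst n A (G.toLp 2 volume)) =
          contr n (ContinuousLinearMap.adjoint A g) (G.toLp 2 volume) := by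
        refine ext_inner_left ℂ fun b ↦ ?_
        have h3 := ContinuousLinearMap.adjoint_inner_left (onFirst n A) (G.toLp 2 volume)
          (prodL n g b)
        rw [onFirst_adjoint, onFirst_prodL] at h3
        rw [contr, contr, ContinuousLinearMap.adjoint_inner_right,
          ContinuousLinearMap.adjoint_inner_right, h3]
      rw [h2]
      filter_upwards [contr_toLp (ContinuousLinearMap.adjoint A g) G] with w hw
      rw [hw, ContinuousLinearMap.adjoint_inner_left]
  filter_upwards [h1] with w hw
  filter_upwards [hw, hL.ae_eq (slice w G)] with y h2 h3
  rw [h2, h3]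
  simp

theorem contract_coeFn {n : ℕ} (L : 𝓢(E d, ℂ) →L[ℂ] ℂ) (G : 𝓢(Fin (n + 1) → E d, ℂ)) :
    contract n L G =ᵐ[volume] fun w ↦ L (slice w G) :=
  (memLp_contract L G).coeFn_toLp

theorem contr_toLp_eq_contract {n : ℕ} (g : L2E d) (G : 𝓢(Fin (n + 1) → E d, ℂ)) :
    contr n g (G.toLp 2 volume) =
      contract n (innerSL ℂ g ∘L SchwartzMap.toLpCLM ℂ ℂ 2 volume) G :=
  Lp.ext ((contr_toLp g G).trans
    (contract_coeFn (innerSL ℂ g ∘L SchwartzMap.toLpCLM ℂ ℂ 2 volume) G).symm)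

theorem mulSchwartz_coeFn (f : 𝓢(E d, ℝ)) (g : L2E d) :
    mulSchwartz f g =ᵐ[volume] fun x ↦ (f x : ℂ) * g x := by
  filter_upwards [(ContinuousLinearMap.mul ℂ ℂ).coeFn_holder (r := 2)
    ((f.memLp_top (μ := volume)).ofReal (K := ℂ)).toLp g,
    ((f.memLp_top (μ := volume)).ofReal (K := ℂ)).coeFn_toLp] with x h1 h2
  refine h1.trans ?_
  rw [h2]
  rfl

theorem onFirst_mulSchwartz {n : ℕ} (f : 𝓢(E d, ℝ)) (u : L2 d (n + 1)) :
    onFirst n (mulSchwartz f) u =ᵐ[volume] fun z ↦ (f (z 0) : ℂ) * u z := by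
  have hm : MemLp (fun z : Fin (n + 1) → E d ↦ (f (z 0) : ℂ)) ∞ volume := by
    refine memLp_top_of_bound (Continuous.aestronglyMeasurable ?_)
      (SchwartzMap.seminorm ℝ 0 0 f) (Filter.Eventually.of_forall fun z ↦ ?_)
    · exact Complex.continuous_ofReal.comp (f.continuous.comp (continuous_apply 0))
    · simpa using SchwartzMap.norm_le_seminorm ℝ f (z 0)
  let M : L2 d (n + 1) →L[ℂ] L2 d (n + 1) :=
    (ContinuousLinearMap.mul ℂ ℂ).holderL (volume : Measure (Fin (n + 1) → E d)) ∞ 2 2 hm.toLp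
  have hM (u : L2 d (n + 1)) : M u =ᵐ[volume] fun z ↦ (f (z 0) : ℂ) * u z := by
    filter_upwards [(ContinuousLinearMap.mul ℂ ℂ).coeFn_holder (r := 2) hm.toLp u,
      hm.coeFn_toLp] with x h1 h2
    refine h1.trans ?_
    rw [h2]
    rfl
  have h : onFirst n (mulSchwartz f) = M := by
    refine clm_ext_prodL fun g b ↦ Lp.ext ?_
    rw [onFirst_prodL]
    filter_upwards [prodL_coeFn (mulSchwartz f g) b, hM (prodL n g b), prodL_coeFn g b,
      (quasiMeasurePreserving_zero d n).ae_eq_comp (mulSchwartz_coeFn f g)] with z h1 h2 h3 h4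
    simp only [Function.comp_apply] at h4
    rw [h1, h2, h3, h4, mul_assoc]
  rw [h]
  exact hM u

/-- Smearing of a pair of contractions with the kernel of `A`. -/
theorem IsKernel.smear_contract {L : E d → 𝓢(E d, ℂ) →L[ℂ] ℂ} {A : L2E d →L[ℂ] L2E d}
    (hL : IsKernel L A) {n : ℕ} (f : 𝓢(E d, ℝ)) (G H : 𝓢(Fin (n + 1) → E d, ℂ)) :
    Integrable (fun x ↦ (f x : ℂ) * inner ℂ (contract n (L x) G) (contract n (L x) H)) ∧
    inner ℂ (onFirst n A (G.toLp 2 volume))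
      (onFirst n (mulSchwartz f) (onFirst n A (H.toLp 2 volume))) =
      ∫ x, (f x : ℂ) * inner ℂ (contract n (L x) G) (contract n (L x) H) := by
  -- With the first variable read as the smearing point x, the integrand of the `L²` product is the
  -- integrand of the smeared expression before integration over the remaining variables. Fubini
  -- then supplies both integrability and the value.
  have h1 : (fun z ↦ inner ℂ (onFirst n A (G.toLp 2 volume) z)
      (onFirst n (mulSchwartz f) (onFirst n A (H.toLp 2 volume)) z)) =ᵐ[volume]
      fun z : Fin (n + 1) → E d ↦ (f (z 0) : ℂ) * (conj (L (z 0) (slice (Fin.tail z) G)) *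
        L (z 0) (slice (Fin.tail z) H)) := by
    filter_upwards [hL.onFirst_toLp G, hL.onFirst_toLp H,
      onFirst_mulSchwartz f (onFirst n A (H.toLp 2 volume))] with z h2 h3 h4
    rw [h4, h2, h3, RCLike.inner_apply']
    ring
  have h2 := (L2.integrable_inner (𝕜 := ℂ) (onFirst n A (G.toLp 2 volume))
    (onFirst n (mulSchwartz f) (onFirst n A (H.toLp 2 volume)))).congr h1
  have h3 (x : E d) : ∫ w : Fin n → E d, (f x : ℂ) * (conj (L x (slice w G)) * L x (slice w H)) =
      (f x : ℂ) * inner ℂ (contract n (L x) G) (contract n (L x) H) := by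
    rw [integral_const_mul, L2.inner_def]
    congr 1
    refine integral_congr_ae ?_
    filter_upwards [contract_coeFn (L x) G, contract_coeFn (L x) H] with w h4 h5
    rw [h4, h5, RCLike.inner_apply']
  constructor
  · have h4 := (integrable_cons h2).integral_prod_left
    simpa only [Fin.cons_zero, Fin.tail_cons, h3] using h4
  · rw [L2.inner_def, integral_congr_ae h1, integral_cons h2]
    simp only [Fin.cons_zero, Fin.tail_cons, h3]

theorem inner_oneVar (g h : L2E d) : inner ℂ (oneVar g) (oneVar h) = (inner ℂ g h : ℂ) := by
  rw [L2.inner_def, L2.inner_def,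
    ← (volume_preserving_funUnique (Fin 1) (E d)).integral_comp']
  refine integral_congr_ae ?_
  filter_upwards [oneVar_coeFn g, oneVar_coeFn h] with z h1 h2
  rw [h1, h2]
  rfl

/-- `Θ(x, y) = f(x) g_x(y)`. -/
def IsPairFunction (f : 𝓢(E d, ℝ)) (g : E d → L2E d) (Θ : L2 d 2) : Prop :=
  ∀ᵐ x : E d, ∀ᵐ w : Fin 1 → E d, Θ (Fin.cons x w) = (f x : ℂ) * g x (w 0)

/-- Smearing of a contraction with the kernel of `A` followed by a contraction with `g_x`. -/
theorem IsKernel.smear_pair {L : E d → 𝓢(E d, ℂ) →L[ℂ] ℂ} {A : L2E d →L[ℂ] L2E d}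
    (hL : IsKernel L A) {f : 𝓢(E d, ℝ)} {g : E d → L2E d} {Θ : L2 d 2}
    (hΘ : IsPairFunction f g Θ) {n : ℕ} (v : L2 d n) (G : 𝓢(Fin (n + 1 + 1) → E d, ℂ)) :
    Integrable (fun x ↦ (f x : ℂ) * inner ℂ (prodL n (g x) v) (contract (n + 1) (L x) G)) ∧
    inner ℂ (outer n Θ v : L2 d (n + 1 + 1)) (onFirst (n + 1) A (G.toLp 2 volume)) =
      ∫ x, (f x : ℂ) * inner ℂ (prodL n (g x) v) (contract (n + 1) (L x) G) := by
  have h2 := L2.integrable_inner (𝕜 := ℂ) (outer n Θ v : L2 d (n + 1 + 1))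
    (onFirst (n + 1) A (G.toLp 2 volume))
  -- For almost every x the slice of `Θ ⊗ v` is `f(x) (g_x ⊗ v)`, and the real number f(x) passes
  -- through the conjugation.
  have h3 : (fun x ↦ ∫ w : Fin (n + 1) → E d,
        inner ℂ ((outer n Θ v : L2 d (n + 1 + 1)) (Fin.cons x w))
          (onFirst (n + 1) A (G.toLp 2 volume) (Fin.cons x w))) =ᵐ[volume]
      fun x ↦ (f x : ℂ) * inner ℂ (prodL n (g x) v) (contract (n + 1) (L x) G) := by
    filter_upwards [hΘ, ae_ae_of_ae_cons' (n := n + 1) (outer_coeFn n Θ v),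
      ae_ae_of_ae_cons' (hL.onFirst_toLp G)] with x h4 h5 h6
    rw [L2.inner_def, ← integral_const_mul]
    refine integral_congr_ae ?_
    filter_upwards [h5, h6, prodL_coeFn (g x) v, contract_coeFn (L x) G,
      (quasiMeasurePreserving_firstIdx d 1 n).ae h4] with w h7 h8 h9 h10 h11
    have h12 : (Fin.cons x w : Fin (n + 1 + 1) → E d) ∘ firstIdx 2 n =
        Fin.cons x (w ∘ firstIdx 1 n) := by
      funext i
      refine Fin.cases rfl (fun i ↦ rfl) i
    rw [h12, h11] at h7
    rw [h7, h8, h9, h10, RCLike.inner_apply', RCLike.inner_apply', map_mul, map_mul, map_mul,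
      Complex.conj_ofReal]
    simp only [Fin.cons_zero, Fin.tail_cons]
    rw [mul_assoc, mul_assoc, mul_assoc]
    rfl
  constructor
  · exact (integrable_cons h2).integral_prod_left.congr h3
  · rw [L2.inner_def, integral_cons h2, integral_congr_ae h3]

/-- The analogue of `IsKernel.smear_pair` for a product wave function and no further particles,
where the second factor may be any `L²` function. It serves to identify the kernel Ψ weakly. -/
theorem IsKernel.smear_pair_prod {L : E d → 𝓢(E d, ℂ) →L[ℂ] ℂ} {A : L2E d →L[ℂ] L2E d}
    (hL : IsKernel L A) {f : 𝓢(E d, ℝ)} {g : E d → L2E d} {Θ : L2 d 2}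
    (hΘ : IsPairFunction f g Θ) (φ : 𝓢(E d, ℂ)) (h : L2E d) :
    Integrable (fun x ↦ (f x : ℂ) * (L x φ * inner ℂ (g x) h)) ∧
    inner ℂ (Θ : L2 d (1 + 1)) (prodL 1 (A (φ.toLp 2 volume)) (oneVar h)) =
      ∫ x, (f x : ℂ) * (L x φ * inner ℂ (g x) h) := by
  have h2 := L2.integrable_inner (𝕜 := ℂ) (Θ : L2 d (1 + 1))
    (prodL 1 (A (φ.toLp 2 volume)) (oneVar h))
  have h3 : (fun x ↦ ∫ w : Fin 1 → E d, inner ℂ ((Θ : L2 d (1 + 1)) (Fin.cons x w))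
          (prodL 1 (A (φ.toLp 2 volume)) (oneVar h) (Fin.cons x w))) =ᵐ[volume]
      fun x ↦ (f x : ℂ) * (L x φ * inner ℂ (g x) h) := by
    filter_upwards [hΘ, ae_ae_of_ae_cons' (prodL_coeFn (A (φ.toLp 2 volume)) (oneVar h)),
      hL.ae_eq φ] with x h4 h5 h6
    rw [← inner_oneVar, L2.inner_def, ← mul_assoc, ← integral_const_mul]
    refine integral_congr_ae ?_
    filter_upwards [h4, h5, oneVar_coeFn (g x)] with w h7 h8 h9
    rw [h8, h7, h9, RCLike.inner_apply', RCLike.inner_apply', map_mul, Complex.conj_ofReal]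
    simp only [Fin.cons_zero, Fin.tail_cons]
    rw [h6]
    ring
  constructor
  · exact (integrable_cons h2).integral_prod_left.congr h3
  · rw [L2.inner_def, integral_cons h2, integral_congr_ae h3]

end Kernel

/-! ### The kernels of `K₂` and `J K₁ J` -/

section FourierKernel

variable {d : ℕ}

theorem continuous_fourierInv {h : E d → ℂ} (hh : Integrable h) : Continuous (𝓕⁻ h) := by
  have := VectorFourier.fourierIntegral_continuous (μ := (volume : Measure (E d)))
    (L := -innerₗ (E d)) Real.continuous_fourierChar
    ((continuous_inner (𝕜 := ℝ) (E := E d)).neg) hh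
  exact this

/-- The `L²` and the `L¹` inverse Fourier transform agree. -/
theorem fourierInv_toLp_ae_eq {h : E d → ℂ} (h1 : Integrable h) (h2 : MemLp h 2 volume) :
    (𝓕⁻ (h2.toLp h : L2E d) : L2E d) =ᵐ[volume] 𝓕⁻ h := by
  refine ae_eq_of_integral_contDiff_smul_eq
    ((Lp.memLp (𝓕⁻ (h2.toLp h : L2E d) : L2E d)).locallyIntegrable one_le_two)
    (continuous_fourierInv h1).locallyIntegrable fun g hg hgc ↦ ?_
  -- The test function g becomes a Schwartz function φ. Against φ, the `L²` transform is computed as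
  -- the transform of a tempered distribution and the `L¹` transform by the multiplication formula;
  -- both give `∫ (𝓕⁻ φ) h`.
  have hg₁ : HasCompactSupport (Complex.ofRealCLM ∘ g) := hgc.comp_left rfl
  have hg₂ : ContDiff ℝ ((⊤ : ℕ∞) : WithTop ℕ∞) (Complex.ofRealCLM ∘ g) := by fun_prop
  let φ : 𝓢(E d, ℂ) := hg₁.toSchwartzMap hg₂
  have hφ (x : E d) : φ x = (g x : ℂ) := rfl
  have h3 := DFunLike.congr_fun
    (Lp.fourierInv_toTemperedDistribution_eq (h2.toLp h : L2E d)) φ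
  rw [TemperedDistribution.fourierInv_apply, Lp.toTemperedDistribution_apply,
    Lp.toTemperedDistribution_apply] at h3
  have h4 : ∫ x, (g x : ℝ) • (𝓕⁻ (h2.toLp h : L2E d) : L2E d) x =
      ∫ x, φ x • (𝓕⁻ (h2.toLp h : L2E d) : L2E d) x := rfl
  have h5 : ∫ x, (g x : ℝ) • 𝓕⁻ h x = ∫ x, φ x • 𝓕⁻ h x := rfl
  rw [h4, h5, ← h3]
  have h6 : ∫ x, (𝓕⁻ φ) x • (h2.toLp h) x = ∫ x, (𝓕⁻ φ) x • h x := by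
    refine integral_congr_ae ?_
    filter_upwards [h2.coeFn_toLp] with x hx
    rw [hx]
  rw [h6, SchwartzMap.fourierInv_coe]
  have h7 := VectorFourier.integral_fourierIntegral_smul_eq_flip (μ := (volume : Measure (E d)))
    (ν := (volume : Measure (E d))) (L := -innerₗ (E d)) (f := φ) (g := h)
    Real.continuous_fourierChar
    ((continuous_inner (𝕜 := ℝ) (E := E d)).neg) φ.integrable h1
  have h8 : (-innerₗ (E d)).flip = -innerₗ (E d) := by
    ext x y
    simp [real_inner_comm]
  rw [h8] at h7
  exact h7

/-- The function `𝓕⁻ (m · 𝓕 φ)`. -/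
def multFun (m : E d → ℂ) (φ : 𝓢(E d, ℂ)) : E d → ℂ := 𝓕⁻ fun ξ ↦ m ξ * 𝓕 φ ξ

theorem integrable_mul_fourier {m : E d → ℂ} (hm : MemLp m ∞ volume) (φ : 𝓢(E d, ℂ)) :
    Integrable fun ξ ↦ m ξ * 𝓕 φ ξ := by
  have := MemLp.mul (p := ∞) (q := 1) (r := 1) ((𝓕 φ).memLp 1 volume) hm
  exact memLp_one_iff_integrable.1 this

theorem memLp_mul_fourier {m : E d → ℂ} (hm : MemLp m ∞ volume) (φ : 𝓢(E d, ℂ)) :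
    MemLp (fun ξ ↦ m ξ * 𝓕 φ ξ) 2 volume :=
  MemLp.mul (p := ∞) (q := 2) (r := 2) ((𝓕 φ).memLp 2 volume) hm

theorem mulOp_coeFn (m : Lp (α := E d) ℂ ∞) (u : L2E d) :
    mulOp m u =ᵐ[volume] fun x ↦ m x * u x :=
  (ContinuousLinearMap.mul ℂ ℂ).coeFn_holder (r := 2) m u

/-- Since m is bounded and `𝓕 φ` is Schwartz, `m · 𝓕 φ` lies in both `L¹` and `L²`. The `L²`
operator is then represented by an absolutely convergent integral, which has values at points. -/
theorem multiplier_toLp {m : E d → ℂ} (hm : MemLp m ∞ volume) (φ : 𝓢(E d, ℂ)) :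
    multiplier (hm.toLp m) (φ.toLp 2 volume) =ᵐ[volume] multFun m φ := by
  have h1 : multiplier (hm.toLp m) (φ.toLp 2 volume) =
      𝓕⁻ (mulOp (hm.toLp m) (𝓕 (φ.toLp 2 volume))) := rfl
  have h2 : mulOp (hm.toLp m) (𝓕 (φ.toLp 2 volume)) = (memLp_mul_fourier hm φ).toLp _ := by
    refine Lp.ext ?_
    rw [SchwartzMap.toLp_fourier_eq]
    filter_upwards [mulOp_coeFn (hm.toLp m) ((𝓕 φ).toLp 2), hm.coeFn_toLp,
      (𝓕 φ).coeFn_toLp 2 volume, (memLp_mul_fourier hm φ).coeFn_toLp] with x h3 h4 h5 h6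
    rw [h3, h4, h5, h6]
  rw [h1, h2]
  exact fourierInv_toLp_ae_eq (integrable_mul_fourier hm φ) _

/-- The translate is `φ(x + ·)`, so the phase has a positive sign: it is the kernel of the inverse
transform, which turns pairing with a translated kernel into evaluation at x. -/
theorem fourier_translate (φ : 𝓢(E d, ℂ)) (x ξ : E d) :
    𝓕 (SchwartzMap.compSubConstCLM ℂ (-x) φ) ξ =
      Real.fourierChar (inner ℝ ξ x) • 𝓕 φ ξ := by
  rw [SchwartzMap.fourier_coe, SchwartzMap.fourier_coe]
  have h := congrFun (VectorFourier.fourierIntegral_comp_add_right Real.fourierChar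
    (volume : Measure (E d)) (innerₗ (E d)) φ x) ξ
  have h1 : (SchwartzMap.compSubConstCLM ℂ (-x) φ : E d → ℂ) = φ ∘ fun v ↦ v + x := by
    funext v
    simp
  rw [h1]
  refine h.trans ?_
  rw [innerₗ_apply_apply, real_inner_comm]
  rfl

theorem fourierInv_conjS (φ : 𝓢(E d, ℂ)) (ξ : E d) : 𝓕⁻ (conjS φ) ξ = conj (𝓕 φ ξ) := by
  rw [SchwartzMap.fourierInv_coe, SchwartzMap.fourier_coe, Real.fourierInv_eq, Real.fourier_eq,
    ← integral_conj]
  refine integral_congr_ae (Filter.Eventually.of_forall fun v ↦ ?_)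
  simp only [Circle.smul_def, smul_eq_mul, map_mul]
  rw [← Circle.coe_inv_eq_conj, ← AddChar.map_neg_eq_inv, neg_neg]
  rfl

theorem conj_sym₁ (k : MomentumDensity d) (ξ : E d) : conj (sym₁ k ξ) = sym₁ k ξ :=
  Complex.conj_ofReal _

theorem conj_sym₂ (k : MomentumDensity d) (ξ : E d) : conj (sym₂ k ξ) = sym₂ k ξ :=
  Complex.conj_ofReal _

/-- The translation and the inverse transform in the definition of `κ₂x` pass to the test function.
The two conjugations in the pairing cancel because the symbol is real, leaving the inverse Fourier
integral at x. -/
theorem pairing_κ₂x (k : MomentumDensity d) (x : E d) (φ : 𝓢(E d, ℂ)) :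
    pairing (κ₂x k x) φ = multFun (sym₂ k) φ x := by
  have h1 : pairing (κ₂x k x) φ = conj (Lp.toTemperedDistribution
      ((memLp_top_sym₂ k).toLp _ : Lp (α := E d) ℂ ∞)
      (𝓕⁻ (conjS (SchwartzMap.compSubConstCLM ℂ (-x) φ)))) := rfl
  rw [h1, Lp.toTemperedDistribution_apply, ← integral_conj, multFun, Real.fourierInv_eq]
  refine integral_congr_ae ?_
  filter_upwards [(memLp_top_sym₂ k).coeFn_toLp] with ξ hξ
  rw [hξ, fourierInv_conjS, fourier_translate, smul_eq_mul, map_mul, conj_sym₂,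
    Complex.conj_conj, Circle.smul_def, Circle.smul_def, smul_eq_mul, smul_eq_mul]
  ring

/-- As κ₁ is square integrable, translation invariance and Plancherel replace the distributional
argument used for κ₂. -/
theorem inner_κ₁x (k : MomentumDensity d) (x : E d) (φ : 𝓢(E d, ℂ)) :
    inner ℂ (κ₁x k x) (φ.toLp 2 volume : L2E d) = multFun (sym₁ k) φ x := by
  have h1 : inner ℂ (κ₁x k x) (φ.toLp 2 volume : L2E d) =
      (inner ℂ (κ₁ k) ((SchwartzMap.compSubConstCLM ℂ (-x) φ).toLp 2 volume : L2E d) : ℂ) := by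
    rw [L2.inner_def, L2.inner_def,
      ← integral_sub_right_eq_self (fun y ↦ inner ℂ (κ₁ k y)
        (((SchwartzMap.compSubConstCLM ℂ (-x) φ).toLp 2 volume : L2E d) y)) x]
    refine integral_congr_ae ?_
    filter_upwards [φ.coeFn_toLp 2 volume,
      Lp.coeFn_compMeasurePreserving (κ₁ k) (measurePreserving_sub_right volume x),
      (measurePreserving_sub_right volume x).quasiMeasurePreserving.ae
        ((SchwartzMap.compSubConstCLM ℂ (-x) φ).coeFn_toLp 2 volume)] with y h2 h3 h4
    rw [h2, h4]
    refine congrArg₂ _ h3 ?_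
    simp
  have h2 : (inner ℂ (κ₁ k) ((SchwartzMap.compSubConstCLM ℂ (-x) φ).toLp 2 volume : L2E d) : ℂ) =
      inner ℂ ((memLp_sym₁ k).toLp _ : L2E d)
        ((𝓕 (SchwartzMap.compSubConstCLM ℂ (-x) φ)).toLp 2 volume : L2E d) := by
    rw [← SchwartzMap.toLp_fourier_eq, ← Lp.inner_fourier_eq, κ₁, FourierTransform.fourier_fourierInv_eq]
  rw [h1, h2, L2.inner_def, multFun, Real.fourierInv_eq]
  refine integral_congr_ae ?_
  filter_upwards [(memLp_sym₁ k).coeFn_toLp,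
    (𝓕 (SchwartzMap.compSubConstCLM ℂ (-x) φ)).coeFn_toLp 2 volume] with ξ h3 h4
  rw [h3, h4, RCLike.inner_apply', conj_sym₁, fourier_translate, Circle.smul_def, Circle.smul_def,
    smul_eq_mul, smul_eq_mul]
  ring

theorem J_coeFn (u : L2E d) : J u =ᵐ[volume] fun x ↦ conj (u x) := Lp.coeFn_star u

theorem J_J (u : L2E d) : J (J u) = u := star_star u

theorem J_toLp (φ : 𝓢(E d, ℂ)) : J (φ.toLp 2 volume : L2E d) = (conjS φ).toLp 2 volume := by
  refine Lp.ext ?_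
  filter_upwards [J_coeFn (φ.toLp 2 volume : L2E d), φ.coeFn_toLp 2 volume,
    (conjS φ).coeFn_toLp 2 volume] with x h1 h2 h3
  rw [h1, h2, h3]
  rfl

/-- Both sides are the symmetric bilinear pairing `∫ u v`. -/
theorem inner_J_left (u v : L2E d) : inner ℂ (J u) v = (inner ℂ (J v) u : ℂ) := by
  rw [L2.inner_def, L2.inner_def]
  refine integral_congr_ae ?_
  filter_upwards [J_coeFn u, J_coeFn v] with x h1 h2
  rw [h1, h2, RCLike.inner_apply', RCLike.inner_apply', Complex.conj_conj, Complex.conj_conj,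
    mul_comm]

theorem inner_J_right (u v : L2E d) : inner ℂ u (J v) = (inner ℂ v (J u) : ℂ) := by
  rw [← inner_conj_symm, inner_J_left, inner_conj_symm]

/-- The operator `J K₁ J`. -/
def JKJ (k : MomentumDensity d) : L2E d →L[ℂ] L2E d := J.comp ((K₁ k).comp J)

theorem isKernel_K₂ (k : MomentumDensity d) : IsKernel (fun x ↦ pairing (κ₂x k x)) (K₂ k) where
  continuous φ := by
    simp only [pairing_κ₂x]
    exact continuous_fourierInv (integrable_mul_fourier (memLp_top_sym₂ k) φ)
  ae_eq φ := by
    simp only [pairing_κ₂x]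
    exact multiplier_toLp (memLp_top_sym₂ k) φ

theorem inner_J_κ₁x (k : MomentumDensity d) (x : E d) (φ : 𝓢(E d, ℂ)) :
    inner ℂ (J (κ₁x k x)) (φ.toLp 2 volume : L2E d) = conj (multFun (sym₁ k) (conjS φ) x) := by
  rw [inner_J_left, J_toLp, ← inner_conj_symm, inner_κ₁x]

/-- The functional `φ ↦ ⟨g, φ⟩` on the Schwartz space. -/
def innerTest (g : L2E d) : 𝓢(E d, ℂ) →L[ℂ] ℂ := innerSL ℂ g ∘L SchwartzMap.toLpCLM ℂ ℂ 2 volume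

theorem innerTest_apply (g : L2E d) (φ : 𝓢(E d, ℂ)) :
    innerTest g φ = inner ℂ g (φ.toLp 2 volume : L2E d) := rfl

theorem isKernel_JKJ (k : MomentumDensity d) :
    IsKernel (fun x ↦ innerTest (J (κ₁x k x))) (JKJ k) where
  continuous φ := by
    simp only [innerTest_apply, inner_J_κ₁x]
    exact Complex.continuous_conj.comp
      (continuous_fourierInv (integrable_mul_fourier (memLp_top_sym₁ k) (conjS φ)))
  ae_eq φ := by
    have h : JKJ k (φ.toLp 2 volume : L2E d) = J (K₁ k ((conjS φ).toLp 2 volume)) := by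
      rw [← J_toLp]
      rfl
    rw [h]
    filter_upwards [J_coeFn (K₁ k ((conjS φ).toLp 2 volume)),
      multiplier_toLp (memLp_top_sym₁ k) (conjS φ)] with x h1 h2
    rw [h1, innerTest_apply, inner_J_κ₁x]
    exact congrArg _ h2

theorem inner_mulOp {m : E d → ℂ} (hm : MemLp m ∞ volume) (hr : ∀ ξ, conj (m ξ) = m ξ)
    (u v : L2E d) :
    inner ℂ (mulOp (hm.toLp m) u) v = (inner ℂ u (mulOp (hm.toLp m) v) : ℂ) := by
  rw [L2.inner_def, L2.inner_def]
  refine integral_congr_ae ?_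
  filter_upwards [mulOp_coeFn (hm.toLp m) u, mulOp_coeFn (hm.toLp m) v, hm.coeFn_toLp]
    with x h1 h2 h3
  rw [h1, h2, h3, RCLike.inner_apply', RCLike.inner_apply', map_mul, hr]
  ring

theorem inner_multiplier {m : E d → ℂ} (hm : MemLp m ∞ volume) (hr : ∀ ξ, conj (m ξ) = m ξ)
    (u v : L2E d) :
    inner ℂ (multiplier (hm.toLp m) u) v = (inner ℂ u (multiplier (hm.toLp m) v) : ℂ) := by
  let F := Lp.fourierTransformₗᵢ (E d) ℂ
  have h1 (w : L2E d) : multiplier (hm.toLp m) w = F.symm (mulOp (hm.toLp m) (F w)) := rfl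
  rw [h1, h1, ← F.inner_map_map, F.apply_symm_apply, inner_mulOp hm hr, ← F.inner_map_map u,
    F.apply_symm_apply]

theorem adjoint_K₂ (k : MomentumDensity d) : ContinuousLinearMap.adjoint (K₂ k) = K₂ k :=
  ((ContinuousLinearMap.eq_adjoint_iff _ _).2
    (inner_multiplier (memLp_top_sym₂ k) (conj_sym₂ k))).symm

theorem adjoint_JKJ (k : MomentumDensity d) : ContinuousLinearMap.adjoint (JKJ k) = JKJ k := by
  refine ((ContinuousLinearMap.eq_adjoint_iff _ _).2 fun u v ↦ ?_).symm
  change inner ℂ (J (K₁ k (J u))) v = (inner ℂ u (J (K₁ k (J v))) : ℂ)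
  rw [inner_J_left, inner_J_right]
  exact (inner_multiplier (memLp_top_sym₁ k) (conj_sym₁ k) (J v) (J u)).symm

/-- Conjugation, translation and the Fourier transform preserve the norm, so the value is `∫ k̂(2πξ)
dξ`; the substitution `p = 2πξ` produces `(2π)^{-d}`. Independence of x makes the scalar term in the
third operator a multiple of `∫ f`. -/
theorem inner_J_κ₁x_self (k : MomentumDensity d) (x : E d) :
    inner ℂ (J (κ₁x k x)) (J (κ₁x k x)) =
      (((2 * Real.pi) ^ (-(d : ℝ)) * ∫ p, k.khat p : ℝ) : ℂ) := by
  have h1 : ‖κ₁x k x‖ = ‖((memLp_sym₁ k).toLp _ : L2E d)‖ := by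
    rw [κ₁x, Lp.norm_compMeasurePreserving, κ₁, ← Lp.norm_fourier_eq, FourierTransform.fourier_fourierInv_eq]
  rw [inner_J_left, J_J, inner_self_eq_norm_sq_to_K, h1, ← inner_self_eq_norm_sq_to_K,
    L2.inner_def]
  have h2 : ∫ ξ, inner ℂ (((memLp_sym₁ k).toLp _ : L2E d) ξ) (((memLp_sym₁ k).toLp _ : L2E d) ξ) =
      ∫ ξ, ((k.khat ((2 * Real.pi) • ξ) : ℝ) : ℂ) := by
    refine integral_congr_ae ?_
    filter_upwards [(memLp_sym₁ k).coeFn_toLp, nonneg_scaled k] with ξ h3 h4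
    rw [h3, RCLike.inner_apply', conj_sym₁, sym₁, ← Complex.ofReal_mul, Real.mul_self_sqrt h4]
  rw [h2, integral_complex_ofReal, Measure.integral_comp_smul volume k.khat (2 * Real.pi),
    finrank_euclideanSpace_fin, smul_eq_mul, abs_of_pos (by positivity),
    Real.rpow_neg (by positivity), Real.rpow_natCast]

/-- The witness is `f(x) conj κ₁(y - x)`: a product of two `L²` functions composed with the
measure-preserving shear `(x, y) ↦ (x, y - x)`. The decay of f provides integrability in x. -/
theorem exists_isPairFunction (f : 𝓢(E d, ℝ)) (k : MomentumDensity d) :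
    ∃ Θ : L2 d 2, IsPairFunction f (fun x ↦ J (κ₁x k x)) Θ := by
  have hm : AEStronglyMeasurable (fun p : E d × E d ↦ (f p.1 : ℂ) * conj (κ₁ k p.2))
      (volume.prod volume) := by
    refine AEStronglyMeasurable.mul ?_ ?_
    · exact (Complex.continuous_ofReal.comp (f.continuous.comp continuous_fst)).aestronglyMeasurable
    · exact Complex.continuous_conj.comp_aestronglyMeasurable
        (Lp.aestronglyMeasurable (κ₁ k)).comp_snd
  have h1 : MemLp (fun p : E d × E d ↦ (f p.1 : ℂ) * conj (κ₁ k p.2)) 2 (volume.prod volume) := by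
    rw [memLp_two_iff_integrable_sq_norm hm]
    have h2 := (memLp_two_iff_integrable_sq_norm f.continuous.aestronglyMeasurable).1
      (f.memLp 2 volume)
    have h3 := (memLp_two_iff_integrable_sq_norm (Lp.aestronglyMeasurable (κ₁ k))).1
      (Lp.memLp (κ₁ k))
    refine (h2.mul_prod h3).congr (Filter.Eventually.of_forall fun p ↦ ?_)
    simp [mul_pow]
  have h2 : MeasurePreserving (fun z : Fin 2 → E d ↦ (z 0, z 1 - z 0)) volume
      (volume.prod volume) :=
    (measurePreserving_prod_sub volume volume).comp (volume_preserving_finTwoArrow (E d))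
  have h3 := h1.comp_measurePreserving h2
  refine ⟨h3.toLp _, ?_⟩
  filter_upwards [ae_ae_of_ae_cons' (n := 1) h3.coeFn_toLp] with x hx
  have h4 : ∀ᵐ y : E d, J (κ₁x k x) y = conj (κ₁ k (y - x)) := by
    filter_upwards [J_coeFn (κ₁x k x),
      Lp.coeFn_compMeasurePreserving (κ₁ k) (measurePreserving_sub_right volume x)] with y h5 h6
    rw [h5]
    exact congrArg _ h6
  filter_upwards [hx, (volume_preserving_funUnique (Fin 1) (E d)).quasiMeasurePreserving.ae h4]
    with w h5 h6
  refine h5.trans ?_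
  simp only [Function.comp_apply]
  congr 1
  exact h6.symm

end FourierKernel

/-! ### Antisymmetrization -/

section Antisymmetrization

variable {d : ℕ}

theorem inner_tensor {n : ℕ} (u v : Tensor d n) :
    inner ℂ u v = ∑ s, (inner ℂ (u s) (v s) : ℂ) := PiLp.inner_apply u v

theorem inner_compMeasurePreserving {n : ℕ} (σ : Equiv.Perm (Fin n)) (a b : L2 d n) :
    inner ℂ (Lp.compMeasurePreserving (fun z : Fin n → E d ↦ z ∘ σ) (measurePreserving_comp σ) a)
      (Lp.compMeasurePreserving (fun z : Fin n → E d ↦ z ∘ σ) (measurePreserving_comp σ) b) =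
      (inner ℂ a b : ℂ) :=
  (Lp.compMeasurePreservingₗᵢ ℂ (fun z : Fin n → E d ↦ z ∘ σ)
    (measurePreserving_comp σ)).inner_map_map a b

theorem inner_permOp_permOp {n : ℕ} (σ : Equiv.Perm (Fin n)) (u v : Tensor d n) :
    inner ℂ (permOp d σ u) (permOp d σ v) = (inner ℂ u v : ℂ) := by
  rw [inner_tensor, inner_tensor]
  refine Fintype.sum_equiv (σ.symm.arrowCongr (Equiv.refl (Fin 2))) _ _ fun s ↦ ?_
  rw [permOp_apply, permOp_apply, inner_compMeasurePreserving]
  rfl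

theorem permOp_one {n : ℕ} (u : Tensor d n) : permOp d 1 u = u := by
  ext1 s
  rw [permOp_apply]
  refine Lp.ext ?_
  exact Lp.coeFn_compMeasurePreserving _ _

theorem inner_permOp_left {n : ℕ} (σ : Equiv.Perm (Fin n)) (u v : Tensor d n) :
    inner ℂ (permOp d σ u) v = (inner ℂ u (permOp d σ⁻¹ v) : ℂ) := by
  rw [← inner_permOp_permOp σ u, permOp_mul, mul_inv_cancel, permOp_one]

theorem sign_mul_sign {n : ℕ} (σ : Equiv.Perm (Fin n)) :
    ((Equiv.Perm.sign σ : ℤ) : ℂ) * ((Equiv.Perm.sign σ : ℤ) : ℂ) = 1 := by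
  rw [← Int.cast_mul, Int.units_coe_mul_self, Int.cast_one]

theorem conj_sign {n : ℕ} (σ : Equiv.Perm (Fin n)) :
    conj ((Equiv.Perm.sign σ : ℤ) : ℂ) = ((Equiv.Perm.sign σ : ℤ) : ℂ) := map_intCast _ _

theorem coe_alt {n : ℕ} (u : Tensor d n) :
    (alt d n u : Tensor d n) = (n.factorial : ℂ)⁻¹ •
      ∑ σ : Equiv.Perm (Fin n), ((Equiv.Perm.sign σ : ℤ) : ℂ) • permOp d σ u := by
  simp [alt]

theorem inner_fock {n : ℕ} (u v : Fock d n) :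
    inner ℂ u v = (inner ℂ (u : Tensor d n) (v : Tensor d n) : ℂ) := rfl

/-- Each permutation is unitary, and its inverse acts on the antisymmetric v by its sign, which
cancels the sign in the sum; all n! terms are equal. Hence antisymmetrization acts as an orthogonal
projection and may be dropped next to an antisymmetric vector. -/
theorem inner_alt_left {n : ℕ} (u : Tensor d n) (v : Fock d n) :
    inner ℂ (alt d n u) v = (inner ℂ u (v : Tensor d n) : ℂ) := by
  have hn : (n.factorial : ℂ) ≠ 0 := Nat.cast_ne_zero.2 n.factorial_ne_zero
  rw [Submodule.coe_inner, coe_alt, inner_smul_left, sum_inner]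
  have h (σ : Equiv.Perm (Fin n)) : inner ℂ (((Equiv.Perm.sign σ : ℤ) : ℂ) • permOp d σ u)
      (v : Tensor d n) = (inner ℂ u (v : Tensor d n) : ℂ) := by
    rw [inner_smul_left, inner_permOp_left, mem_Fock.1 v.2, inner_smul_right, conj_sign,
      Equiv.Perm.sign_inv, ← mul_assoc, sign_mul_sign, one_mul]
  rw [Finset.sum_congr rfl fun σ _ ↦ h σ, Finset.sum_const, Finset.card_univ,
    Fintype.card_perm, Fintype.card_fin, nsmul_eq_mul, ← mul_assoc, map_inv₀, map_natCast,
    inv_mul_cancel₀ hn, one_mul]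

theorem inner_alt_right {n : ℕ} (u : Fock d n) (v : Tensor d n) :
    inner ℂ u (alt d n v) = (inner ℂ (u : Tensor d n) v : ℂ) := by
  rw [inner_fock, ← inner_conj_symm, ← inner_fock, inner_alt_left, inner_conj_symm]

theorem alt_coe {n : ℕ} (u : Fock d n) : alt d n (u : Tensor d n) = u :=
  ext_inner_right ℂ fun v ↦ by rw [inner_alt_left, Submodule.coe_inner]

theorem alt_permOp {n : ℕ} (σ : Equiv.Perm (Fin n)) (u : Tensor d n) :
    alt d n (permOp d σ u) = ((Equiv.Perm.sign σ : ℤ) : ℂ) • alt d n u :=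
  ext_inner_right ℂ fun v ↦ by
    rw [inner_alt_left, inner_permOp_left, mem_Fock.1 v.2, inner_smul_right, inner_fock,
      Submodule.coe_smul, inner_smul_left, ← inner_fock, inner_alt_left, conj_sign,
      Equiv.Perm.sign_inv]

end Antisymmetrization

/-! ### Creation and annihilation of one particle -/

section OneParticle

variable {d : ℕ}

/-- `v ↦ h ⊗ v` for `h ∈ H_ℂ ⊕ H_ℂ`. -/
def oneLeft (n : ℕ) (h : HH d) : Tensor d n →L[ℂ] Tensor d (n + 1) :=
  tensorLeft n (tprod (fun _ : Fin 1 ↦ h))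

theorem oneLeft_apply {n : ℕ} (h : HH d) (v : Tensor d n) (s : Fin (n + 1) → Fin 2) :
    oneLeft n h v s = prodL n (h (s 0)) (v (Fin.tail s)) := by
  have h1 : tprod (fun _ : Fin 1 ↦ h) (s ∘ firstIdx 1 n) = oneVar (h (s 0)) := by
    refine MemLp.toLp_congr (memLp_prod fun i ↦ h ((s ∘ firstIdx 1 n) i)) _
      (Filter.Eventually.of_forall fun z ↦ ?_)
    simp [firstIdx]
  change outer n (tprod (fun _ : Fin 1 ↦ h) (s ∘ firstIdx 1 n)) (v (s ∘ lastIdx 1 n)) = _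
  rw [h1]
  rfl

theorem sum_cons {M : Type*} [AddCommMonoid M] {n : ℕ} (F : (Fin (n + 1) → Fin 2) → M) :
    ∑ s, F s = ∑ i : Fin 2, ∑ s : Fin n → Fin 2, F (Fin.cons i s) := by
  rw [← Fintype.sum_prod_type']
  exact (Fintype.sum_equiv (Fin.consEquiv fun _ : Fin (n + 1) ↦ Fin 2) _ _ fun p ↦ rfl).symm

theorem inner_oneLeft_left {n : ℕ} (h : HH d) (v : Tensor d n) (u : Tensor d (n + 1)) :
    inner ℂ (oneLeft n h v) u =
      ∑ i : Fin 2, ∑ s, (inner ℂ (prodL n (h i) (v s)) (u (Fin.cons i s)) : ℂ) := by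
  rw [inner_tensor, sum_cons]
  simp only [oneLeft_apply, Fin.cons_zero, Fin.tail_cons]

theorem inner_oneLeft_oneLeft {n : ℕ} (h h' : HH d) (v v' : Tensor d n) :
    inner ℂ (oneLeft n h v) (oneLeft n h' v') = (inner ℂ h h' * inner ℂ v v' : ℂ) := by
  rw [inner_oneLeft_left, inner_tensor, PiLp.inner_apply, Finset.sum_mul_sum]
  simp only [oneLeft_apply, Fin.cons_zero, Fin.tail_cons, inner_prodL_prodL]

/-- The adjoint of `v ↦ h ⊗ v`. -/
def contrT (n : ℕ) (h : HH d) : Tensor d (n + 1) →L[ℂ] Tensor d n :=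
  ContinuousLinearMap.adjoint (oneLeft n h)

theorem inner_contrT_right {n : ℕ} (h : HH d) (v : Tensor d n) (u : Tensor d (n + 1)) :
    inner ℂ v (contrT n h u) = (inner ℂ (oneLeft n h v) u : ℂ) :=
  ContinuousLinearMap.adjoint_inner_right _ _ _

theorem inner_contrT_left {n : ℕ} (h : HH d) (v : Tensor d n) (u : Tensor d (n + 1)) :
    inner ℂ (contrT n h u) v = (inner ℂ u (oneLeft n h v) : ℂ) :=
  ContinuousLinearMap.adjoint_inner_left _ _ _

theorem contrT_apply {n : ℕ} (h : HH d) (u : Tensor d (n + 1)) (s : Fin n → Fin 2) :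
    contrT n h u s = ∑ i : Fin 2, contr n (h i) (u (Fin.cons i s)) := by
  suffices h1 : contrT n h u =
      WithLp.toLp 2 fun s ↦ ∑ i : Fin 2, contr n (h i) (u (Fin.cons i s)) by rw [h1]
  refine ext_inner_left ℂ fun v ↦ ?_
  rw [inner_contrT_right, inner_oneLeft_left, inner_tensor, Finset.sum_comm]
  simp only [inner_sum, contr, ContinuousLinearMap.adjoint_inner_right]

theorem contrT_oneLeft {n : ℕ} (h h' : HH d) (v : Tensor d n) :
    contrT n h (oneLeft n h' v) = (inner ℂ h h' : ℂ) • v :=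
  ext_inner_left ℂ fun w ↦ by
    rw [inner_contrT_right, inner_oneLeft_oneLeft, inner_smul_right]

theorem copy_apply (i j : Fin 2) (g : L2E d) : copy i g j = if j = i then g else 0 := by
  change (Pi.single i g : Fin 2 → L2E d) j = _
  rw [Pi.single_apply]

theorem contr_zero {n : ℕ} : contr n (0 : L2E d) = 0 := by
  have : prodL n (0 : L2E d) = 0 := by
    rw [← zero_smul ℂ (0 : L2E d), prodL_smul, zero_smul]
  rw [contr, this, map_zero]

theorem contrT_copy {n : ℕ} (i : Fin 2) (g : L2E d) (u : Tensor d (n + 1)) (s : Fin n → Fin 2) :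
    contrT n (copy i g) u s = contr n g (u (Fin.cons i s)) := by
  rw [contrT_apply, Finset.sum_eq_single i]
  · rw [copy_apply, if_pos rfl]
  · intro j _ hj
    rw [copy_apply, if_neg hj, contr_zero, _root_.zero_apply]
  · simp

theorem eq_zero_of_contrT {n : ℕ} {u : Tensor d (n + 1)} (h : ∀ f, contrT n f u = 0) : u = 0 := by
  ext1 s
  rw [← Fin.cons_self_tail s]
  refine eq_zero_of_contr fun g ↦ ?_
  rw [← contrT_copy, h]
  rfl

theorem clm_ext_oneLeft {n : ℕ} {W : Type*} [AddCommGroup W] [Module ℂ W] [TopologicalSpace W]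
    [T2Space W] {S T : Tensor d (n + 1) →L[ℂ] W}
    (h : ∀ f v, S (oneLeft n f v) = T (oneLeft n f v)) : S = T := by
  refine ContinuousLinearMap.ext_on (s := {u | ∃ f v, u = oneLeft n f v}) ?_ ?_
  · refine (Submodule.dense_iff_topologicalClosure_eq_top).2 ?_
    rw [Submodule.topologicalClosure_eq_top_iff, Submodule.eq_bot_iff]
    intro u hu
    refine eq_zero_of_contrT fun f ↦ ext_inner_left ℂ fun v ↦ ?_
    rw [inner_contrT_right, inner_zero_right]
    exact (Submodule.mem_orthogonal _ u).1 hu _ (Submodule.subset_span ⟨f, v, rfl⟩)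
  · rintro _ ⟨f, v, rfl⟩
    exact h f v

/-- A permutation of the last `n` of `n + 1` indices. -/
def consPerm {n : ℕ} (σ : Equiv.Perm (Fin n)) : Equiv.Perm (Fin (n + 1)) :=
  Equiv.Perm.decomposeFin.symm (0, σ)

theorem consPerm_zero {n : ℕ} (σ : Equiv.Perm (Fin n)) : consPerm σ 0 = 0 := by simp [consPerm]

theorem consPerm_succ {n : ℕ} (σ : Equiv.Perm (Fin n)) (i : Fin n) :
    consPerm σ i.succ = (σ i).succ := by simp [consPerm]

theorem sign_consPerm {n : ℕ} (σ : Equiv.Perm (Fin n)) :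
    Equiv.Perm.sign (consPerm σ) = Equiv.Perm.sign σ := by simp [consPerm]

theorem tail_comp_consPerm {α : Type*} {n : ℕ} (σ : Equiv.Perm (Fin n)) (z : Fin (n + 1) → α) :
    Fin.tail (z ∘ consPerm σ) = Fin.tail z ∘ σ := by
  funext i
  simp [Fin.tail, consPerm_succ]

/-- Coset decomposition with respect to the stabilizer of 0. For antisymmetric u, the permutations
fixing 0 act on `h ⊗ u` by their sign, so only the transpositions `(0 p)` matter. -/
theorem decomposeFin_symm_eq {n : ℕ} (p : Fin (n + 1)) (σ : Equiv.Perm (Fin n)) :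
    Equiv.Perm.decomposeFin.symm (p, σ) = Equiv.swap 0 p * consPerm σ := by
  ext1 i
  refine Fin.cases ?_ (fun i ↦ ?_) i
  · simp [consPerm_zero]
  · simp [consPerm_succ]

theorem prodL_compMeasurePreserving {n : ℕ} (σ : Equiv.Perm (Fin n)) (g : L2E d) (b : L2 d n) :
    prodL n g (Lp.compMeasurePreserving (fun z : Fin n → E d ↦ z ∘ σ)
      (measurePreserving_comp σ) b) =
    Lp.compMeasurePreserving (fun z : Fin (n + 1) → E d ↦ z ∘ consPerm σ)
      (measurePreserving_comp (consPerm σ)) (prodL n g b) := by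
  refine Lp.ext ?_
  filter_upwards [prodL_coeFn g (Lp.compMeasurePreserving (fun z : Fin n → E d ↦ z ∘ σ)
      (measurePreserving_comp σ) b),
    Lp.coeFn_compMeasurePreserving (prodL n g b) (measurePreserving_comp (consPerm σ)),
    (measurePreserving_comp (consPerm σ)).quasiMeasurePreserving.ae (prodL_coeFn g b),
    (quasiMeasurePreserving_tail d n).ae
      (Lp.coeFn_compMeasurePreserving b (measurePreserving_comp σ))] with z h1 h2 h3 h4
  rw [h1, h2, h4, Function.comp_apply, Function.comp_apply, h3, tail_comp_consPerm,
    Function.comp_apply, consPerm_zero]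

theorem oneLeft_permOp {n : ℕ} (σ : Equiv.Perm (Fin n)) (h : HH d) (v : Tensor d n) :
    oneLeft n h (permOp d σ v) = permOp d (consPerm σ) (oneLeft n h v) := by
  ext1 s
  rw [oneLeft_apply, permOp_apply, permOp_apply, oneLeft_apply, prodL_compMeasurePreserving,
    tail_comp_consPerm, Function.comp_apply, consPerm_zero]

theorem contrT_permOp {n : ℕ} (σ : Equiv.Perm (Fin n)) (h : HH d) (u : Tensor d (n + 1)) :
    permOp d σ (contrT n h u) = contrT n h (permOp d (consPerm σ) u) :=
  ext_inner_right ℂ fun v ↦ by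
    have h1 : (consPerm σ)⁻¹ = consPerm σ⁻¹ := by
      rw [inv_eq_iff_mul_eq_one]
      ext1 i
      refine Fin.cases ?_ (fun i ↦ ?_) i
      · simp [consPerm_zero]
      · simp [consPerm_succ]
    rw [inner_permOp_left, inner_contrT_left, inner_contrT_left, oneLeft_permOp,
      inner_permOp_left, h1]

theorem contrT_mem_Fock {n : ℕ} (h : HH d) (u : Fock d (n + 1)) :
    contrT n h (u : Tensor d (n + 1)) ∈ Fock d n := by
  rw [mem_Fock]
  intro σ
  rw [contrT_permOp, mem_Fock.1 u.2, map_smul, sign_consPerm]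

/-- The restriction `𝓕_a^{(n+1)} → 𝓕_a^{(n)}` of the annihilation operator. -/
def annN (n : ℕ) (h : HH d) : Fock d (n + 1) →L[ℂ] Fock d n :=
  ContinuousLinearMap.adjoint (creN n h)

theorem creN_apply {n : ℕ} (h : HH d) (u : Fock d n) :
    creN n h u = ((Real.sqrt (n + 1) : ℝ) : ℂ) • alt d (n + 1) (oneLeft n h u) := rfl

theorem inner_annN_right {n : ℕ} (h : HH d) (v : Fock d n) (u : Fock d (n + 1)) :
    inner ℂ v (annN n h u) = (inner ℂ (creN n h v) u : ℂ) :=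
  ContinuousLinearMap.adjoint_inner_right _ _ _

theorem inner_creN_left {n : ℕ} (h : HH d) (v : Fock d n) (u : Fock d (n + 1)) :
    inner ℂ (creN n h v) u = (((Real.sqrt (n + 1) : ℝ) : ℂ) *
      inner ℂ (oneLeft n h v) (u : Tensor d (n + 1)) : ℂ) := by
  rw [creN_apply, inner_fock, Submodule.coe_smul, inner_smul_left, ← inner_fock, inner_alt_left,
    Complex.conj_ofReal]

/-- The projection in `a*(h)` disappears in the adjoint, since contracting an antisymmetric tensor
gives an antisymmetric one. The result is the formula that defines `annDN`, so distributional and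
`L²` annihilation operators can be treated alike. -/
theorem coe_annN {n : ℕ} (h : HH d) (u : Fock d (n + 1)) :
    (annN n h u : Tensor d n) =
      ((Real.sqrt (n + 1) : ℝ) : ℂ) • contrT n h (u : Tensor d (n + 1)) := by
  have h1 : annN n h u = ((Real.sqrt (n + 1) : ℝ) : ℂ) •
      (⟨contrT n h (u : Tensor d (n + 1)), contrT_mem_Fock h u⟩ : Fock d n) :=
    ext_inner_left ℂ fun v ↦ by
      rw [inner_annN_right, inner_creN_left, inner_fock, Submodule.coe_smul, inner_smul_right,
        inner_contrT_right]
  rw [h1]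
  rfl

theorem sqrt_mul_sqrt (n : ℕ) :
    ((Real.sqrt (n + 1) : ℝ) : ℂ) * ((Real.sqrt (n + 1) : ℝ) : ℂ) = n + 1 := by
  rw [← Complex.ofReal_mul, Real.mul_self_sqrt (by positivity)]
  simp

theorem swap_prodL_prodL {n : ℕ} (g g' : L2E d) (b : L2 d n) :
    Lp.compMeasurePreserving (fun z : Fin (n + 1 + 1) → E d ↦ z ∘ (Equiv.swap 0 1 :
      Equiv.Perm (Fin (n + 1 + 1)))) (measurePreserving_comp (Equiv.swap 0 1))
      (prodL (n + 1) g (prodL n g' b)) = prodL (n + 1) g' (prodL n g b) := by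
  have h (g g' : L2E d) : prodL (n + 1) g (prodL n g' b) =ᵐ[volume]
      fun z ↦ g (z 0) * (g' (z 1) * b (Fin.tail (Fin.tail z))) := by
    filter_upwards [prodL_coeFn g (prodL n g' b),
      (quasiMeasurePreserving_tail d (n + 1)).ae (prodL_coeFn g' b)] with z h1 h2
    rw [h1, h2]
    rfl
  refine Lp.ext ?_
  filter_upwards [Lp.coeFn_compMeasurePreserving (prodL (n + 1) g (prodL n g' b))
      (measurePreserving_comp (Equiv.swap (0 : Fin (n + 1 + 1)) 1)), h g' g,
    (measurePreserving_comp (Equiv.swap (0 : Fin (n + 1 + 1)) 1)).quasiMeasurePreserving.ae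
      (h g g')] with z h1 h2 h3
  have h4 : Fin.tail (Fin.tail (z ∘ Equiv.swap (0 : Fin (n + 1 + 1)) 1)) =
      Fin.tail (Fin.tail z) := by
    funext i
    simp only [Fin.tail, Function.comp_apply]
    rw [Equiv.swap_apply_of_ne_of_ne (Fin.succ_ne_zero _)]
    intro h
    exact Fin.succ_ne_zero i (Fin.succ_injective _ h)
  rw [h1, h2, Function.comp_apply, h3, h4]
  simp only [Function.comp_apply, Equiv.swap_apply_left, Equiv.swap_apply_right]
  ring

theorem swap_oneLeft_oneLeft {n : ℕ} (h h' : HH d) (v : Tensor d n) :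
    permOp d (Equiv.swap 0 1) (oneLeft (n + 1) h (oneLeft n h' v)) =
      oneLeft (n + 1) h' (oneLeft n h v) := by
  ext1 s
  rw [permOp_apply, oneLeft_apply, oneLeft_apply, oneLeft_apply, oneLeft_apply, swap_prodL_prodL]
  have h4 : Fin.tail (Fin.tail (s ∘ Equiv.swap (0 : Fin (n + 1 + 1)) 1)) =
      Fin.tail (Fin.tail s) := by
    funext i
    simp only [Fin.tail, Function.comp_apply]
    rw [Equiv.swap_apply_of_ne_of_ne (Fin.succ_ne_zero _)]
    intro h
    exact Fin.succ_ne_zero i (Fin.succ_injective _ h)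
  have h5 : (s ∘ Equiv.swap (0 : Fin (n + 1 + 1)) 1) 0 = Fin.tail s 0 := by simp [Fin.tail]
  have h6 : Fin.tail (s ∘ Equiv.swap (0 : Fin (n + 1 + 1)) 1) 0 = s 0 := by simp [Fin.tail]
  rw [h4, h5, h6]

/-- After the swap the new factor h is in second position, so the contraction acts on the first
factor of u. On `u = f ⊗ v` both sides are `(h, f) h ⊗ v`. -/
theorem contrT_swap_oneLeft {n : ℕ} (h : HH d) (u : Tensor d (n + 1)) :
    contrT (n + 1) h (permOp d (Equiv.swap 0 1) (oneLeft (n + 1) h u)) =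
      oneLeft n h (contrT n h u) := by
  have h1 : contrT (n + 1) h ∘L permOp d (Equiv.swap 0 1) ∘L oneLeft (n + 1) h =
      oneLeft n h ∘L contrT n h := by
    refine clm_ext_oneLeft fun f v ↦ ?_
    simp only [ContinuousLinearMap.comp_apply]
    rw [swap_oneLeft_oneLeft, contrT_oneLeft, contrT_oneLeft, map_smul]
  exact DFunLike.congr_fun h1 u

/-- The transposition `(0 j+1)` is conjugate to `(0 1)` by a permutation of the last variables. That
permutation acts by a sign on both u and v, and the two signs cancel, so the value is independent of
j. -/
theorem inner_oneLeft_swap {n : ℕ} (h : HH d) (v u : Fock d (n + 1)) (j : Fin (n + 1)) :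
    inner ℂ (oneLeft (n + 1) h v) (permOp d (Equiv.swap 0 j.succ)
      (oneLeft (n + 1) h (u : Tensor d (n + 1)))) =
    (inner ℂ (contrT n h (v : Tensor d (n + 1))) (contrT n h (u : Tensor d (n + 1))) : ℂ) := by
  let e : Equiv.Perm (Fin (n + 1)) := Equiv.swap 0 j
  have h1 : Equiv.swap 0 j.succ =
      consPerm e * Equiv.swap (0 : Fin (n + 1 + 1)) 1 * (consPerm e)⁻¹ := by
    rw [← Equiv.swap_apply_apply, consPerm_zero, ← Fin.succ_zero_eq_one, consPerm_succ]
    simp [e]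
  have h2 : (consPerm e)⁻¹ = consPerm e := by
    rw [inv_eq_iff_mul_eq_one]
    ext1 i
    refine Fin.cases ?_ (fun i ↦ ?_) i
    · simp [consPerm_zero]
    · simp [consPerm_succ, e]
  have h3 (w : Fock d (n + 1)) : permOp d (consPerm e) (oneLeft (n + 1) h w) =
      ((Equiv.Perm.sign e : ℤ) : ℂ) • oneLeft (n + 1) h (w : Tensor d (n + 1)) := by
    rw [← oneLeft_permOp, mem_Fock.1 w.2, map_smul]
  rw [h1, ← permOp_mul, ← permOp_mul, h2, h3, map_smul, map_smul, inner_smul_right]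
  have h4 := inner_permOp_left (consPerm e) (oneLeft (n + 1) h (v : Tensor d (n + 1)))
    (permOp d (Equiv.swap 0 1) (oneLeft (n + 1) h (u : Tensor d (n + 1))))
  rw [h2, h3, inner_smul_left, conj_sign] at h4
  rw [← h4, ← mul_assoc, sign_mul_sign, one_mul, ← inner_contrT_right, contrT_swap_oneLeft,
    inner_contrT_left]

theorem sum_permOp_oneLeft {n : ℕ} (h : HH d) (u : Fock d n) :
    ∑ σ : Equiv.Perm (Fin (n + 1)), ((Equiv.Perm.sign σ : ℤ) : ℂ) •
      permOp d σ (oneLeft n h (u : Tensor d n)) =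
      (n.factorial : ℂ) • ∑ p : Fin (n + 1), ((Equiv.Perm.sign (Equiv.swap 0 p) : ℤ) : ℂ) •
        permOp d (Equiv.swap 0 p) (oneLeft n h (u : Tensor d n)) := by
  rw [← Equiv.sum_comp Equiv.Perm.decomposeFin.symm, Fintype.sum_prod_type, Finset.smul_sum]
  refine Finset.sum_congr rfl fun p _ ↦ ?_
  have h2 (σ : Equiv.Perm (Fin n)) :
      ((Equiv.Perm.sign (Equiv.Perm.decomposeFin.symm (p, σ)) : ℤ) : ℂ) •
        permOp d (Equiv.Perm.decomposeFin.symm (p, σ)) (oneLeft n h (u : Tensor d n)) =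
      ((Equiv.Perm.sign (Equiv.swap 0 p) : ℤ) : ℂ) •
        permOp d (Equiv.swap 0 p) (oneLeft n h (u : Tensor d n)) := by
    rw [decomposeFin_symm_eq, ← permOp_mul, ← oneLeft_permOp, mem_Fock.1 u.2, map_smul, map_smul,
      smul_smul, Equiv.Perm.sign_mul, sign_consPerm, Units.val_mul, Int.cast_mul, mul_assoc,
      sign_mul_sign, mul_one]
  rw [Finset.sum_congr rfl fun σ _ ↦ h2 σ, Finset.sum_const, Finset.card_univ,
    Fintype.card_perm, Fintype.card_fin, Nat.cast_smul_eq_nsmul ℂ]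

/-- The coset sum over `(0 p)` has an identity term for p = 0 and n transpositions of sign -1; their
minus sign is the source of the anticommutator. -/
theorem coe_alt_oneLeft {n : ℕ} (h : HH d) (u : Fock d n) :
    ((n : ℂ) + 1) • (alt d (n + 1) (oneLeft n h (u : Tensor d n)) : Tensor d (n + 1)) =
      oneLeft n h (u : Tensor d n) -
        ∑ j : Fin n, permOp d (Equiv.swap 0 j.succ) (oneLeft n h (u : Tensor d n)) := by
  have hn : (n.factorial : ℂ) ≠ 0 := Nat.cast_ne_zero.2 n.factorial_ne_zero
  have hn' : (n : ℂ) + 1 ≠ 0 := Nat.cast_add_one_ne_zero n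
  have h1 : ((n : ℂ) + 1) * (((n + 1).factorial : ℂ)⁻¹ * (n.factorial : ℂ)) = 1 := by
    rw [Nat.factorial_succ]
    push_cast
    field_simp
  have h2 (j : Fin n) : ((Equiv.Perm.sign (Equiv.swap 0 j.succ) : ℤ) : ℂ) = -1 := by
    rw [Equiv.Perm.sign_swap (Fin.succ_ne_zero j).symm]
    simp
  rw [coe_alt, sum_permOp_oneLeft, smul_smul, smul_smul, mul_assoc, h1, one_smul,
    Fin.sum_univ_succ, Equiv.swap_self, ← Equiv.Perm.one_def, permOp_one, Equiv.Perm.sign_one,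
    Units.val_one, Int.cast_one, one_smul, sub_eq_add_neg, ← Finset.sum_neg_distrib]
  simp only [h2, neg_smul, one_smul]

theorem inner_creN_creN {n : ℕ} (h : HH d) (v u : Fock d n) :
    (inner ℂ (creN n h v) (creN n h u) : ℂ) = inner ℂ h h * inner ℂ v u -
      ∑ j : Fin n, inner ℂ (oneLeft n h (v : Tensor d n)) (permOp d (Equiv.swap 0 j.succ)
        (oneLeft n h (u : Tensor d n))) := by
  have h1 : (inner ℂ (creN n h v) (creN n h u) : ℂ) =
      inner ℂ (oneLeft n h (v : Tensor d n))
        (((n : ℂ) + 1) • (alt d (n + 1) (oneLeft n h (u : Tensor d n)) : Tensor d (n + 1))) := by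
    rw [inner_creN_left, creN_apply, Submodule.coe_smul, inner_smul_right, ← mul_assoc,
      sqrt_mul_sqrt, inner_smul_right]
  rw [h1, coe_alt_oneLeft, inner_sub_right, inner_oneLeft_oneLeft, inner_sum]
  rfl

theorem inner_creN_creN_zero (h : HH d) (v u : Fock d 0) :
    (inner ℂ (creN 0 h v) (creN 0 h u) : ℂ) = inner ℂ h h * inner ℂ v u := by
  rw [inner_creN_creN, Finset.univ_eq_empty, Finset.sum_empty, sub_zero]

/-- The canonical anticommutation relation. -/
theorem inner_creN_creN_succ {n : ℕ} (h : HH d) (v u : Fock d (n + 1)) :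
    (inner ℂ (creN (n + 1) h v) (creN (n + 1) h u) : ℂ) = inner ℂ h h * inner ℂ v u -
      inner ℂ (annN n h v) (annN n h u) := by
  have h1 : (inner ℂ (annN n h v) (annN n h u) : ℂ) = ((n : ℂ) + 1) *
      inner ℂ (contrT n h (v : Tensor d (n + 1))) (contrT n h (u : Tensor d (n + 1))) := by
    rw [inner_fock, coe_annN, coe_annN, inner_smul_left, inner_smul_right, Complex.conj_ofReal,
      ← mul_assoc, sqrt_mul_sqrt]
  -- All n+1 transposition terms are equal, and their number is the square of the factor `√(n+1)` in
  -- the annihilation operator.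
  have h2 : ∑ j : Fin (n + 1), (inner ℂ (oneLeft (n + 1) h (v : Tensor d (n + 1)))
      (permOp d (Equiv.swap 0 j.succ) (oneLeft (n + 1) h (u : Tensor d (n + 1)))) : ℂ) =
      inner ℂ (annN n h v) (annN n h u) := by
    refine (Finset.sum_congr rfl fun j _ ↦ inner_oneLeft_swap h v u j).trans ?_
    rw [Finset.sum_const, Finset.card_univ, Fintype.card_fin, nsmul_eq_mul, Nat.cast_succ]
    exact h1.symm
  exact (inner_creN_creN h v u).trans (congrArg _ h2)

end OneParticle

/-! ### Second quantization -/

section SecondQuantization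

variable {d : ℕ}

theorem block_apply (i j : Fin 2) (B : L2E d →L[ℂ] L2E d) (h : HH d) :
    block i B h j = if j = i then B (h i) else 0 := copy_apply i j _

/-- The operator that acts as `B` in the first variable, on the copy number `i` of `H_ℂ`. -/
def firstBlock (n : ℕ) (i : Fin 2) (B : L2E d →L[ℂ] L2E d) :
    Tensor d (n + 1) →L[ℂ] Tensor d (n + 1) :=
  toTensor fun s ↦ if s 0 = i then onFirst n B ∘L component s else 0

theorem firstBlock_apply {n : ℕ} (i : Fin 2) (B : L2E d →L[ℂ] L2E d) (u : Tensor d (n + 1))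
    (s : Fin (n + 1) → Fin 2) :
    firstBlock n i B u s = if s 0 = i then onFirst n B (u s) else 0 := by
  change (if s 0 = i then onFirst n B ∘L component s else 0 : Tensor d (n + 1) →L[ℂ] _) u = _
  split_ifs <;> rfl

theorem firstBlock_oneLeft {n : ℕ} (i : Fin 2) (B : L2E d →L[ℂ] L2E d) (h : HH d)
    (v : Tensor d n) : firstBlock n i B (oneLeft n h v) = oneLeft n (block i B h) v := by
  ext1 s
  rw [firstBlock_apply, oneLeft_apply, oneLeft_apply, block_apply, onFirst_prodL]
  split_ifs with hs
  · rw [hs]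
  · rw [← zero_smul ℂ (0 : L2E d), prodL_smul, zero_smul, _root_.zero_apply]

theorem tprod_succ {n : ℕ} (h : Fin (n + 1) → HH d) :
    tprod h = oneLeft n (h 0) (tprod (Fin.tail h)) := by
  ext1 s
  rw [oneLeft_apply]
  refine Lp.ext ?_
  filter_upwards [(memLp_prod fun i ↦ h i (s i)).coeFn_toLp,
    prodL_coeFn (h 0 (s 0)) (tprod (Fin.tail h) (Fin.tail s)),
    (quasiMeasurePreserving_tail d n).ae
      (memLp_prod fun i ↦ Fin.tail h i (Fin.tail s i)).coeFn_toLp] with z h1 h2 h3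
  rw [h2]
  refine h1.trans ?_
  rw [Fin.prod_univ_succ]
  exact congrArg _ h3.symm

theorem permOp_tprod {n : ℕ} (σ : Equiv.Perm (Fin n)) (h : Fin n → HH d) :
    permOp d σ (tprod h) = tprod (h ∘ ⇑σ⁻¹) := by
  ext1 s
  rw [permOp_apply]
  change Lp.compMeasurePreserving _ _ ((memLp_prod fun i ↦ h i (s (σ i))).toLp _) =
    (memLp_prod fun i ↦ h (σ⁻¹ i) (s i)).toLp _
  rw [Lp.toLp_compMeasurePreserving]
  refine MemLp.toLp_congr _ _ (Filter.Eventually.of_forall fun z ↦ ?_)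
  refine Fintype.prod_equiv σ _ _ fun i ↦ ?_
  simp

theorem firstBlock_tprod {n : ℕ} (i : Fin 2) (B : L2E d →L[ℂ] L2E d) (h : Fin (n + 1) → HH d) :
    firstBlock n i B (tprod h) = tprod (Function.update h 0 (block i B (h 0))) := by
  rw [tprod_succ, firstBlock_oneLeft, tprod_succ, Function.update_self]
  congr 2

theorem firstBlock_permOp_tprod {n : ℕ} (i : Fin 2) (B : L2E d →L[ℂ] L2E d)
    (σ : Equiv.Perm (Fin (n + 1))) (h : Fin (n + 1) → HH d) :
    firstBlock n i B (permOp d σ (tprod h)) =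
      permOp d σ (tprod (Function.update h (σ⁻¹ 0) (block i B (h (σ⁻¹ 0))))) := by
  rw [permOp_tprod, permOp_tprod, firstBlock_tprod]
  congr 1
  funext j
  rcases eq_or_ne j 0 with rfl | hj
  · simp
  · rw [Function.update_of_ne hj, Function.comp_apply, Function.comp_apply,
      Function.update_of_ne]
    exact fun hc ↦ hj (σ⁻¹.injective hc)

/-- The restriction of `dΓ(B)` to `𝓕_a^{(n)}`, where `B` acts in the copy number `i` of `H_ℂ`. -/
def dGammaN (i : Fin 2) (B : L2E d →L[ℂ] L2E d) : (n : ℕ) → Fock d n →L[ℂ] Fock d n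
  | 0 => 0
  | n + 1 => ((n : ℂ) + 1) • (alt d (n + 1) ∘L firstBlock n i B ∘L (Fock d (n + 1)).subtypeL)

theorem dGammaN_succ {n : ℕ} (i : Fin 2) (B : L2E d →L[ℂ] L2E d) (u : Fock d (n + 1)) :
    dGammaN i B (n + 1) u =
      ((n : ℂ) + 1) • alt d (n + 1) (firstBlock n i B (u : Tensor d (n + 1))) := rfl

theorem sum_perm_apply_zero {M : Type*} [AddCommMonoid M] {n : ℕ} (F : Fin (n + 1) → M) :
    ∑ σ : Equiv.Perm (Fin (n + 1)), F (σ⁻¹ 0) = n.factorial • ∑ p, F p := by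
  rw [← Equiv.sum_comp (Equiv.inv (Equiv.Perm (Fin (n + 1))))]
  simp only [Equiv.inv_apply, inv_inv]
  rw [← Equiv.sum_comp Equiv.Perm.decomposeFin.symm, Fintype.sum_prod_type, Finset.smul_sum]
  refine Finset.sum_congr rfl fun p _ ↦ ?_
  simp [Fintype.card_perm]

/-- Acting on the first slot of a permuted product tensor acts on the factor `h (σ⁻¹ 0)`, and
antisymmetrization absorbs the sign. For n+1 factors each is hit by n! permutations, and `(n+1) · n!
/ (n+1)! = 1`. -/
theorem dGammaN_wedge (i : Fin 2) (B : L2E d →L[ℂ] L2E d) (n : ℕ) (h : Fin n → HH d) :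
    dGammaN i B n (wedge h) = ∑ j, wedge (Function.update h j (block i B (h j))) := by
  cases n with
  | zero => simp [dGammaN]
  | succ n =>
    have hn : (n.factorial : ℂ) ≠ 0 := Nat.cast_ne_zero.2 n.factorial_ne_zero
    have h1 : ((n : ℂ) + 1) * (((n + 1).factorial : ℂ)⁻¹ * (n.factorial : ℂ)) = 1 := by
      have hn' : (n : ℂ) + 1 ≠ 0 := Nat.cast_add_one_ne_zero n
      rw [Nat.factorial_succ]
      push_cast
      field_simp
    have h2 (σ : Equiv.Perm (Fin (n + 1))) : alt d (n + 1) (firstBlock n i B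
        (((Equiv.Perm.sign σ : ℤ) : ℂ) • permOp d σ (tprod h))) =
        wedge (Function.update h (σ⁻¹ 0) (block i B (h (σ⁻¹ 0)))) := by
      rw [map_smul, firstBlock_permOp_tprod, map_smul, alt_permOp, smul_smul, sign_mul_sign,
        one_smul]
      rfl
    rw [dGammaN_succ, wedge, coe_alt, map_smul, map_smul, map_sum, map_sum,
      Finset.sum_congr rfl fun σ _ ↦ h2 σ,
      sum_perm_apply_zero fun j ↦ wedge (Function.update h j (block i B (h j))),
      ← Nat.cast_smul_eq_nsmul ℂ, smul_smul, smul_smul, mul_assoc, h1, one_smul]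

end SecondQuantization

/-! ### Entries -/

section Entries

variable {V : ℕ → Type*} [∀ n, AddCommGroup (V n)]

theorem FinSum.ext {u v : FinSum V} [∀ n, Module ℂ (V n)] (h : ∀ n, u.entry n = v.entry n) :
    u = v := DFinsupp.ext h

theorem FinSum.entry_zero [∀ n, Module ℂ (V n)] (n : ℕ) : (0 : FinSum V).entry n = 0 := rfl

variable [∀ n, Module ℂ (V n)] [∀ n, TopologicalSpace (V n)]

theorem FinSum.induction {P : FinSum V → Prop} (hs : ∀ n (v : V n), P (FinSum.single n v))
    (ha : ∀ u v, P u → P v → P (u + v)) (u : FinSum V) : P u := by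
  refine DFinsupp.induction (p := P) u ?_ fun n v f _ _ hf ↦ ha _ _ (hs n v) hf
  have := hs 0 0
  rwa [map_zero] at this

@[simp]
theorem FinSum.entry_single (n : ℕ) (v : V n) : (FinSum.single n v).entry n = v :=
  DFinsupp.single_eq_same

theorem FinSum.entry_single_of_ne {m n : ℕ} (h : m ≠ n) (v : V m) :
    (FinSum.single m v).entry n = 0 := DFinsupp.single_eq_of_ne h.symm

variable {W : ℕ → Type*} [∀ n, AddCommGroup (W n)] [∀ n, Module ℂ (W n)]
  [∀ n, TopologicalSpace (W n)]

/-- All operators used here shift the particle number by a fixed amount, so each entry of the image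
depends on a single entry of the argument; linearity reduces this to single summands. -/
theorem FinSum.entry_of_single (T : FinSum V →L[ℂ] FinSum W) {n m : ℕ} (S : V n →L[ℂ] W m)
    (h : ∀ v, (T (FinSum.single n v)).entry m = S v)
    (h0 : ∀ l, l ≠ n → ∀ v, (T (FinSum.single l v)).entry m = 0) (u : FinSum V) :
    (T u).entry m = S (u.entry n) := by
  induction u using FinSum.induction with
  | hs l v =>
    rcases eq_or_ne l n with rfl | hl
    · rw [h, FinSum.entry_single]
    · rw [h0 l hl, FinSum.entry_single_of_ne hl, map_zero]
  | ha u v hu hv => rw [map_add, FinSum.entry_add, FinSum.entry_add, map_add, hu, hv]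

end Entries

/-! ### Entries of the Fock space operators and the anticommutation relation -/

section FockEntries

variable {d : ℕ}

theorem fockInner_add_left (u v w : FockFin d) :
    fockInner (u + v) w = fockInner u w + fockInner v w :=
  congrArg (fun T : FockFin d →L[ℂ] ℂ ↦ T w) (fockInner_add u v)

theorem fockInner_add_right (u v w : FockFin d) :
    fockInner u (v + w) = fockInner u v + fockInner u w := (fockInner u).map_add v w

theorem fockInner_single_right (u : FockFin d) (n : ℕ) (v : Fock d n) :
    fockInner u (FinSum.single (V := fun n ↦ Fock d n) n v) = inner ℂ (u.entry n) v := by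
  simp [fockInner]

theorem fockInner_single_left (u : FockFin d) (n : ℕ) (v : Fock d n) :
    fockInner (FinSum.single (V := fun n ↦ Fock d n) n v) u = inner ℂ v (u.entry n) := by
  induction u using FinSum.induction with
  | hs l w =>
    rw [fockInner_single_right]
    rcases eq_or_ne l n with rfl | hl
    · rw [FinSum.entry_single, FinSum.entry_single]
    · rw [FinSum.entry_single_of_ne hl, FinSum.entry_single_of_ne hl.symm, inner_zero_left,
        inner_zero_right]
  | ha u w hu hw =>
    exact (fockInner_add_right _ _ _).trans ((congrArg₂ (· + ·) hu hw).trans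
      (inner_add_right (𝕜 := ℂ) (v : Tensor d n) (u.entry n : Tensor d n)
        (w.entry n : Tensor d n)).symm)

theorem conj_fockInner (u v : FockFin d) : conj (fockInner u v) = fockInner v u := by
  induction v using FinSum.induction with
  | hs l w =>
    rw [fockInner_single_left, fockInner_single_right]
    exact inner_conj_symm (𝕜 := ℂ) (w : Tensor d l) (u.entry l : Tensor d l)
  | ha v w hv hw =>
    exact (congrArg conj (fockInner_add_right u v w)).trans ((map_add _ _ _).trans
      ((congrArg₂ (· + ·) hv hw).trans (fockInner_add_left v w u).symm))

theorem toDual_apply (u : FockFin d) (G : TestFin d) :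
    toDual d u G = fockInner (emb d G) u := conj_fockInner _ _

theorem adj_apply (B : TestFin d →L[ℂ] FockFin d) (u : FockFin d) (G : TestFin d) :
    adj B u G = fockInner (B G) u := conj_fockInner _ _

theorem emb_single (n : ℕ) (g : Test d n) :
    emb d (FinSum.single (V := fun n ↦ Test d n) n g) =
      FinSum.single (V := fun n ↦ Fock d n) n (embN d n g) := by
  rw [emb, FinSum.lift_single]
  rfl

theorem entry_emb (G : TestFin d) (n : ℕ) : (emb d G).entry n = embN d n (G.entry n) :=
  FinSum.entry_of_single (V := fun n ↦ Test d n) (W := fun n ↦ Fock d n) (emb d) (embN d n)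
    (fun v ↦ by rw [emb_single, FinSum.entry_single])
    (fun l hl v ↦ by rw [emb_single, FinSum.entry_single_of_ne hl]) G

theorem cre_single (f : HH d) (n : ℕ) (u : Fock d n) :
    cre f (FinSum.single (V := fun n ↦ Fock d n) n u) =
      FinSum.single (V := fun n ↦ Fock d n) (n + 1) (creN n f u) := by
  rw [cre, FinSum.lift_single]
  rfl

theorem entry_cre (f : HH d) (u : FockFin d) (n : ℕ) :
    (cre f u).entry (n + 1) = creN n f (u.entry n) :=
  FinSum.entry_of_single (V := fun n ↦ Fock d n) (W := fun n ↦ Fock d n) (cre f) (creN n f)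
    (fun v ↦ by rw [cre_single, FinSum.entry_single])
    (fun l hl v ↦ by rw [cre_single, FinSum.entry_single_of_ne (by omega)]) u

theorem ann_single_zero (f : HH d) (u : Fock d 0) :
    ann f (FinSum.single (V := fun n ↦ Fock d n) 0 u) = 0 := by
  rw [ann, FinSum.lift_single]
  rfl

theorem ann_single_succ (f : HH d) (n : ℕ) (u : Fock d (n + 1)) :
    ann f (FinSum.single (V := fun n ↦ Fock d n) (n + 1) u) =
      FinSum.single (V := fun n ↦ Fock d n) n (annN n f u) := by
  rw [ann, FinSum.lift_single]
  rfl

theorem entry_ann (f : HH d) (u : FockFin d) (n : ℕ) :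
    (ann f u).entry n = annN n f (u.entry (n + 1)) :=
  FinSum.entry_of_single (V := fun n ↦ Fock d n) (W := fun n ↦ Fock d n) (ann f) (annN n f)
    (fun v ↦ by rw [ann_single_succ, FinSum.entry_single])
    (fun l hl v ↦ by
      cases l with
      | zero => rw [ann_single_zero, FinSum.entry_zero]
      | succ l => rw [ann_single_succ, FinSum.entry_single_of_ne (by omega)]) u

theorem annD_single_zero (F : Fin 2 → 𝓢'(E d, ℂ)) (g : Test d 0) :
    annD F (FinSum.single (V := fun n ↦ Test d n) 0 g) = 0 := by
  rw [annD, FinSum.lift_single]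
  rfl

theorem annD_single_succ (F : Fin 2 → 𝓢'(E d, ℂ)) (n : ℕ) (g : Test d (n + 1)) :
    annD F (FinSum.single (V := fun n ↦ Test d n) (n + 1) g) =
      FinSum.single (V := fun n ↦ Fock d n) n (annDN n F g) := by
  rw [annD, FinSum.lift_single]
  rfl

theorem entry_annD (F : Fin 2 → 𝓢'(E d, ℂ)) (G : TestFin d) (n : ℕ) :
    (annD F G).entry n = annDN n F (G.entry (n + 1)) :=
  FinSum.entry_of_single (V := fun n ↦ Test d n) (W := fun n ↦ Fock d n) (annD F) (annDN n F)
    (fun v ↦ by rw [annD_single_succ, FinSum.entry_single])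
    (fun l hl v ↦ by
      cases l with
      | zero => rw [annD_single_zero, FinSum.entry_zero]
      | succ l => rw [annD_single_succ, FinSum.entry_single_of_ne (by omega)]) G

theorem fockInner_cre (f : HH d) (u v : FockFin d) :
    fockInner (cre f u) v = fockInner u (ann f v) := by
  induction u using FinSum.induction with
  | hs n a =>
    rw [cre_single, fockInner_single_left, fockInner_single_left, entry_ann]
    exact (inner_annN_right f a (v.entry (n + 1))).symm
  | ha u w hu hw =>
    exact (congrArg (fun z ↦ fockInner z v) ((cre f).map_add u w)).trans
      ((fockInner_add_left _ _ _).trans ((congrArg₂ (· + ·) hu hw).trans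
        (fockInner_add_left _ _ _).symm))

theorem fockInner_zero_left (u : FockFin d) : fockInner 0 u = 0 := by
  have h := fockInner_add_left 0 0 u
  rwa [add_zero, left_eq_add] at h

theorem fockInner_ann_cre_single (f : HH d) (u : FockFin d) (n : ℕ) (a : Fock d n) :
    fockInner (FinSum.single (V := fun n ↦ Fock d n) n a) (ann f (cre f u)) =
      inner ℂ (creN n f a) (creN n f (u.entry n)) := by
  rw [fockInner_single_left, entry_ann, entry_cre]
  exact inner_annN_right f a _

theorem fockInner_ann_single_zero (f : HH d) (u : FockFin d) (a : Fock d 0) :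
    fockInner (ann f (FinSum.single (V := fun n ↦ Fock d n) 0 a)) (ann f u) = 0 :=
  (congrArg (fun z ↦ fockInner z (ann f u)) (ann_single_zero f a)).trans (fockInner_zero_left _)

theorem fockInner_ann_single_succ (f : HH d) (u : FockFin d) (n : ℕ) (a : Fock d (n + 1)) :
    fockInner (ann f (FinSum.single (V := fun n ↦ Fock d n) (n + 1) a)) (ann f u) =
      inner ℂ (annN n f a) (annN n f (u.entry (n + 1))) :=
  (congrArg (fun z ↦ fockInner z (ann f u)) (ann_single_succ f n a)).trans
    ((fockInner_single_left _ n _).trans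
      (congrArg (fun z ↦ (inner ℂ (annN n f a) z : ℂ)) (entry_ann f u n)))

/-- The canonical anticommutation relation. -/
theorem ann_cre (f : HH d) (u v : FockFin d) :
    fockInner v (ann f (cre f u)) =
      inner ℂ f f * fockInner v u - fockInner (ann f v) (ann f u) := by
  induction v using FinSum.induction with
  | hs n a =>
    refine (fockInner_ann_cre_single f u n a).trans ?_
    match n, a with
    -- The vacuum component is annihilated, so the subtracted term is zero and only the norm term
    -- survives.
    | 0, a =>
      exact (inner_creN_creN_zero f a (u.entry 0)).trans ((sub_zero _).symm.trans
        (congrArg₂ (fun y z ↦ inner ℂ f f * y - z) (fockInner_single_left u 0 a).symm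
          (fockInner_ann_single_zero f u a).symm))
    | n + 1, a =>
      exact (inner_creN_creN_succ f a (u.entry (n + 1))).trans
        (congrArg₂ (fun y z ↦ inner ℂ f f * y - z) (fockInner_single_left u (n + 1) a).symm
          (fockInner_ann_single_succ f u n a).symm)
  | ha v w hv hw =>
    have h := (congrArg (fun z ↦ fockInner z (ann f u)) ((ann f).map_add v w)).trans
      (fockInner_add_left (ann f v) (ann f w) (ann f u))
    refine (fockInner_add_left v w _).trans ((congrArg₂ (· + ·) hv hw).trans ?_)
    refine .trans ?_ (congrArg₂ (fun y z ↦ inner ℂ f f * y - z)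
      (fockInner_add_left v w u).symm h.symm)
    ring

/-- The operator `dΓ(B)`, where `B` acts in the copy number `i` of `H_ℂ`. -/
def dGamma (i : Fin 2) (B : L2E d →L[ℂ] L2E d) : FockFin d →L[ℂ] FockFin d :=
  FinSum.lift fun n ↦ FinSum.single (V := fun n ↦ Fock d n) n ∘L dGammaN i B n

theorem dGamma_single (i : Fin 2) (B : L2E d →L[ℂ] L2E d) (n : ℕ) (u : Fock d n) :
    dGamma i B (FinSum.single (V := fun n ↦ Fock d n) n u) =
      FinSum.single (V := fun n ↦ Fock d n) n (dGammaN i B n u) := by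
  rw [dGamma, FinSum.lift_single]
  rfl

theorem entry_dGamma (i : Fin 2) (B : L2E d →L[ℂ] L2E d) (u : FockFin d) (n : ℕ) :
    (dGamma i B u).entry n = dGammaN i B n (u.entry n) :=
  FinSum.entry_of_single (V := fun n ↦ Fock d n) (W := fun n ↦ Fock d n) (dGamma i B)
    (dGammaN i B n) (fun v ↦ by rw [dGamma_single, FinSum.entry_single])
    (fun l hl v ↦ by rw [dGamma_single, FinSum.entry_single_of_ne hl]) u

theorem isSecondQuantization_dGamma (i : Fin 2) (B : L2E d →L[ℂ] L2E d) :
    IsSecondQuantization (block i B) (dGamma i B) := fun n h ↦ by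
  rw [dGamma_single, dGammaN_wedge]

/-- The restriction of the two-particle creation operator with kernel `Ψ` to `𝓕_a^{(n)}`. -/
def pairCreN (Ψ : Tensor d 2) (n : ℕ) : Fock d n →L[ℂ] Fock d (n + 2) :=
  ((Real.sqrt ((n + 1) * (n + 2)) : ℝ) : ℂ) • wedgeLeft n Ψ

/-- The two-particle creation operator with kernel `Ψ`. -/
def pairCre (Ψ : Tensor d 2) : FockFin d →L[ℂ] FockFin d :=
  FinSum.lift fun n ↦ FinSum.single (V := fun n ↦ Fock d n) (n + 2) ∘L pairCreN Ψ n

theorem pairCre_single (Ψ : Tensor d 2) (n : ℕ) (u : Fock d n) :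
    pairCre Ψ (FinSum.single (V := fun n ↦ Fock d n) n u) =
      FinSum.single (V := fun n ↦ Fock d n) (n + 2) (pairCreN Ψ n u) := by
  rw [pairCre, FinSum.lift_single]
  rfl

theorem isPairCreation_pairCre (Ψ : Tensor d 2) : IsPairCreation Ψ (pairCre Ψ) :=
  fun n u ↦ pairCre_single Ψ n u

/-- The restriction of the two-particle annihilation operator with kernel `Ψ` to `𝓕_a^{(n)}`. -/
def pairAnnSum (Ψ : Tensor d 2) : (n : ℕ) → Fock d n →L[ℂ] FockFin d
  | 0 => 0
  | 1 => 0
  | n + 2 =>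
    FinSum.single (V := fun n ↦ Fock d n) n ∘L ContinuousLinearMap.adjoint (pairCreN Ψ n)

/-- The two-particle annihilation operator with kernel `Ψ`. -/
def pairAnn (Ψ : Tensor d 2) : FockFin d →L[ℂ] FockFin d := FinSum.lift (pairAnnSum Ψ)

theorem pairAnn_single (Ψ : Tensor d 2) (n : ℕ) (u : Fock d n) :
    pairAnn Ψ (FinSum.single (V := fun n ↦ Fock d n) n u) = pairAnnSum Ψ n u :=
  FinSum.lift_single _ _ _

theorem entry_pairAnn (Ψ : Tensor d 2) (u : FockFin d) (n : ℕ) :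
    (pairAnn Ψ u).entry n = ContinuousLinearMap.adjoint (pairCreN Ψ n) (u.entry (n + 2)) := by
  have h (n : ℕ) (v : Fock d (n + 2)) :
      pairAnn Ψ (FinSum.single (V := fun n ↦ Fock d n) (n + 2) v) =
        FinSum.single (V := fun n ↦ Fock d n) n (ContinuousLinearMap.adjoint (pairCreN Ψ n) v) :=
    pairAnn_single Ψ (n + 2) v
  refine FinSum.entry_of_single (V := fun n ↦ Fock d n) (W := fun n ↦ Fock d n) (pairAnn Ψ)
    (ContinuousLinearMap.adjoint (pairCreN Ψ n)) (fun v ↦ ?_) (fun l hl v ↦ ?_) u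
  · exact (congrArg (fun z : FockFin d ↦ z.entry n) (h n v)).trans (FinSum.entry_single n _)
  · match l, hl, v with
    | 0, _, v => exact congrArg (fun z : FockFin d ↦ z.entry n) (pairAnn_single Ψ 0 v)
    | 1, _, v => exact congrArg (fun z : FockFin d ↦ z.entry n) (pairAnn_single Ψ 1 v)
    | l + 2, hl, v =>
      exact (congrArg (fun z : FockFin d ↦ z.entry n) (h l v)).trans
        (FinSum.entry_single_of_ne (fun h ↦ hl (congrArg (· + 2) h)) _)

theorem fockInner_pairAnn (Ψ : Tensor d 2) (u v : FockFin d) :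
    fockInner u (pairAnn Ψ v) = fockInner (pairCre Ψ u) v := by
  induction u using FinSum.induction with
  | hs n a =>
    rw [pairCre_single, fockInner_single_left, fockInner_single_left, entry_pairAnn]
    exact ContinuousLinearMap.adjoint_inner_right (pairCreN Ψ n) a (v.entry (n + 2))
  | ha u w hu hw =>
    exact (fockInner_add_left _ _ _).trans ((congrArg₂ (· + ·) hu hw).trans
      ((fockInner_add_left _ _ _).symm.trans
        (congrArg (fun z ↦ fockInner z v) ((pairCre Ψ).map_add u w).symm)))

end FockEntries

/-! ### Density of the test functions -/

section Density

variable {d : ℕ}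

/-- Permutation of the variables of a Schwartz function. -/
def permTest {n : ℕ} (σ : Equiv.Perm (Fin n)) :
    𝓢(Fin n → E d, ℂ) →L[ℂ] 𝓢(Fin n → E d, ℂ) :=
  SchwartzMap.compCLMOfContinuousLinearEquiv ℂ
    (LinearEquiv.funCongrLeft ℝ (E d) σ).toContinuousLinearEquiv

theorem permTest_apply {n : ℕ} (σ : Equiv.Perm (Fin n)) (g : 𝓢(Fin n → E d, ℂ))
    (z : Fin n → E d) : permTest σ g z = g (z ∘ σ) := rfl

/-- The antisymmetrization of a test function. -/
def altTest {n : ℕ} (G : (Fin n → Fin 2) → 𝓢(Fin n → E d, ℂ)) : Test d n :=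
  ⟨fun s ↦ (n.factorial : ℂ)⁻¹ • ∑ σ : Equiv.Perm (Fin n),
    ((Equiv.Perm.sign σ : ℤ) : ℂ) • permTest σ (G (s ∘ σ)), by
    intro τ s z
    simp only [_root_.smul_apply, _root_.sum_apply, permTest_apply, smul_eq_mul]
    rw [mul_left_comm]
    congr 1
    rw [Finset.mul_sum]
    refine Fintype.sum_equiv (Equiv.mulLeft τ) (fun σ ↦ ((Equiv.Perm.sign σ : ℤ) : ℂ) *
      G ((s ∘ τ) ∘ σ) ((z ∘ τ) ∘ σ)) (fun σ ↦ ((Equiv.Perm.sign τ : ℤ) : ℂ) *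
      (((Equiv.Perm.sign σ : ℤ) : ℂ) * G (s ∘ σ) (z ∘ σ))) fun σ ↦ ?_
    rw [Equiv.coe_mulLeft, Equiv.Perm.sign_mul, Units.val_mul, Int.cast_mul, ← mul_assoc,
      ← mul_assoc, sign_mul_sign, one_mul]
    rfl⟩

theorem embN_apply {n : ℕ} (g : Test d n) (s : Fin n → Fin 2) :
    (embN d n g : Tensor d n) s = (g.1 s).toLp 2 volume := rfl

theorem embN_altTest {n : ℕ} (G : (Fin n → Fin 2) → 𝓢(Fin n → E d, ℂ)) :
    embN d n (altTest G) = alt d n (WithLp.toLp 2 fun s ↦ (G s).toLp 2 volume) := by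
  refine Subtype.ext ?_
  rw [coe_alt]
  ext1 s
  rw [embN_apply]
  have h1 : (altTest G).1 s = (n.factorial : ℂ)⁻¹ • ∑ σ : Equiv.Perm (Fin n),
    ((Equiv.Perm.sign σ : ℤ) : ℂ) • permTest σ (G (s ∘ σ)) := rfl
  have h2 (σ : Equiv.Perm (Fin n)) : (permTest σ (G (s ∘ σ))).toLp 2 volume =
      Lp.compMeasurePreserving (fun z : Fin n → E d ↦ z ∘ σ) (measurePreserving_comp σ)
        ((G (s ∘ σ)).toLp 2 volume) := by
    unfold SchwartzMap.toLp
    rw [Lp.toLp_compMeasurePreserving]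
    rfl
  rw [h1, ← SchwartzMap.toLpCLM_apply (𝕜 := ℂ), map_smul, map_sum, PiLp.smul_apply]
  congr 1
  rw [WithLp.ofLp_sum, Finset.sum_apply]
  refine Finset.sum_congr rfl fun σ _ ↦ ?_
  rw [map_smul, SchwartzMap.toLpCLM_apply, h2]
  rfl

/-- Schwartz tensors are dense, and antisymmetrization is continuous and surjective, hence maps them
to a dense set. That image consists of test functions because antisymmetrization preserves the
Schwartz class. -/
theorem denseRange_embN (d n : ℕ) : DenseRange (embN d n) := by
  have h1 : DenseRange fun G : (Fin n → Fin 2) → 𝓢(Fin n → E d, ℂ) ↦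
      (fun s ↦ (G s).toLp 2 volume : (Fin n → Fin 2) → L2 d n) :=
    DenseRange.piMap fun _ ↦ SchwartzMap.denseRange_toLpCLM (E := Fin n → E d) (F := ℂ) (p := 2)
      (μ := volume) ENNReal.ofNat_ne_top
  have h2 : Function.Surjective (alt d n) := fun u ↦ ⟨u, alt_coe u⟩
  have h3 : DenseRange fun u : (Fin n → Fin 2) → L2 d n ↦ alt d n (WithLp.toLp 2 u) :=
    (h2.comp (WithLp.toLp_surjective 2)).denseRange
  have h4 := h3.comp h1 ((alt d n).continuous.comp (PiLp.continuous_toLp 2 _))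
  refine h4.mono ?_
  rintro _ ⟨G, rfl⟩
  exact ⟨altTest G, embN_altTest G⟩

/-- By the universal property it suffices that the map is continuous on each summand, where it is
the identity or zero. This permits density arguments entry by entry. -/
theorem continuous_entry (n : ℕ) : Continuous fun u : FockFin d ↦ u.entry n := by
  refine FinSum.continuous_of_single (V := fun n ↦ Fock d n) (DFinsupp.lapply (R := ℂ) n)
    fun m ↦ ?_
  change Continuous fun v ↦ (FinSum.single (V := fun n ↦ Fock d n) m v).entry n
  rcases eq_or_ne m n with rfl | h
  · exact continuous_id.congr fun v ↦ (FinSum.entry_single (V := fun n ↦ Fock d n) m v).symm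
  · exact continuous_const.congr fun v ↦
      (FinSum.entry_single_of_ne (V := fun n ↦ Fock d n) h v).symm

/-- Uniqueness of the smeared operators: density of test functions is used twice, for the argument
(with continuity of S and R) and for the vectors that test the entries of the result. -/
theorem eq_of_toDual_eq {S R : FockFin d →L[ℂ] FockFin d}
    (h : ∀ G₁ G₂, toDual d (S (emb d G₁)) G₂ = toDual d (R (emb d G₁)) G₂) : S = R := by
  refine FinSum.hom_ext fun n v ↦ FinSum.ext fun m ↦ ?_
  refine (denseRange_embN d n).induction_on
    (p := fun v ↦ (S (FinSum.single (V := fun n ↦ Fock d n) n v)).entry m =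
      (R (FinSum.single (V := fun n ↦ Fock d n) n v)).entry m) v ?_ fun a ↦ ?_
  · exact isClosed_eq
      ((continuous_entry m).comp (S.continuous.comp (FinSum.single n).continuous))
      ((continuous_entry m).comp (R.continuous.comp (FinSum.single n).continuous))
  · refine (denseRange_embN d m).eq_of_inner_right ℂ fun b ↦ ?_
    have h1 := h (FinSum.single n a) (FinSum.single m b)
    have h2 (T : FockFin d →L[ℂ] FockFin d) :
        toDual d (T (emb d (FinSum.single (V := fun n ↦ Test d n) n a)))
          (FinSum.single (V := fun n ↦ Test d n) m b) =
        inner ℂ (embN d m b) ((T (FinSum.single (V := fun n ↦ Fock d n) n (embN d n a))).entry m) :=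
      (toDual_apply _ _).trans ((congrArg₂ (fun y z ↦ fockInner y (T z)) (emb_single m b)
        (emb_single n a)).trans (fockInner_single_left _ m _))
    exact (h2 S).symm.trans (h1.trans (h2 R))

end Density

/-! ### Smeared operators -/

section Components

variable {d : ℕ}

theorem contract_zero {n : ℕ} (G : 𝓢(Fin (n + 1) → E d, ℂ)) : contract n 0 G = 0 := by
  refine Lp.ext ?_
  filter_upwards [contract_coeFn 0 G, Lp.coeFn_zero ℂ 2 (volume : Measure (Fin n → E d))]
    with w h1 h2
  rw [h1, h2]
  rfl

theorem pairing_zero : pairing (0 : 𝓢'(E d, ℂ)) = 0 := by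
  ext φ
  exact map_zero conj

theorem annDN_single_apply {n : ℕ} (i : Fin 2) (F : 𝓢'(E d, ℂ)) (G : Test d (n + 1))
    (s : Fin n → Fin 2) :
    (annDN n (Pi.single i F) G : Tensor d n) s =
      ((Real.sqrt (n + 1) : ℝ) : ℂ) • contract n (pairing F) (G.1 (Fin.cons i s)) := by
  have h1 : (annDN n (Pi.single i F) G : Tensor d n) s = ((Real.sqrt (n + 1) : ℝ) : ℂ) •
      (∑ j : Fin 2, contract n (pairing ((Pi.single i F : Fin 2 → 𝓢'(E d, ℂ)) j)) ∘L
        testComponent (Fin.cons j s : Fin (n + 1) → Fin 2)) G := rfl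
  rw [h1, _root_.sum_apply, Finset.sum_eq_single i]
  · rw [Pi.single_eq_same]
    rfl
  · intro j _ hj
    rw [Pi.single_eq_of_ne hj, pairing_zero]
    exact contract_zero _
  · simp

theorem annN_copy_embN_apply {n : ℕ} (i : Fin 2) (g : L2E d) (G : Test d (n + 1))
    (s : Fin n → Fin 2) :
    (annN n (copy i g) (embN d (n + 1) G) : Tensor d n) s =
      ((Real.sqrt (n + 1) : ℝ) : ℂ) • contract n (innerTest g) (G.1 (Fin.cons i s)) := by
  rw [coe_annN, PiLp.smul_apply, contrT_copy, embN_apply, contr_toLp_eq_contract]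
  rfl

theorem inner_of_components {n : ℕ} {u v : Fock d n} {p q : (Fin n → Fin 2) → L2 d n}
    (hu : ∀ s, (u : Tensor d n) s = ((Real.sqrt (n + 1) : ℝ) : ℂ) • p s)
    (hv : ∀ s, (v : Tensor d n) s = ((Real.sqrt (n + 1) : ℝ) : ℂ) • q s) :
    inner ℂ u v = (((n : ℂ) + 1) * ∑ s, inner ℂ (p s) (q s) : ℂ) := by
  rw [inner_fock, inner_tensor, Finset.mul_sum]
  refine Finset.sum_congr rfl fun s _ ↦ ?_
  rw [hu, hv, inner_smul_left, inner_smul_right, Complex.conj_ofReal, ← mul_assoc, sqrt_mul_sqrt]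

/-- The projection drops against the antisymmetric v, and only components whose first factor lies in
copy i survive. These are the components seen by an annihilation operator of that copy. -/
theorem inner_dGammaN_succ {n : ℕ} (i : Fin 2) (B : L2E d →L[ℂ] L2E d) (v u : Fock d (n + 1)) :
    inner ℂ v (dGammaN i B (n + 1) u) = (((n : ℂ) + 1) * ∑ s : Fin n → Fin 2,
      inner ℂ ((v : Tensor d (n + 1)) (Fin.cons i s))
        (onFirst n B ((u : Tensor d (n + 1)) (Fin.cons i s))) : ℂ) := by
  rw [dGammaN_succ, inner_fock, Submodule.coe_smul, inner_smul_right, ← inner_fock,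
    inner_alt_right, inner_tensor, sum_cons, Finset.sum_eq_single i]
  · refine congrArg _ (Finset.sum_congr rfl fun s _ ↦ ?_)
    rw [firstBlock_apply, Fin.cons_zero, if_pos rfl]
  · intro j _ hj
    refine Finset.sum_eq_zero fun s _ ↦ ?_
    rw [firstBlock_apply, Fin.cons_zero, if_neg hj, inner_zero_right]
  · simp

theorem IsKernel.smear_dGammaN {L : E d → 𝓢(E d, ℂ) →L[ℂ] ℂ} {A : L2E d →L[ℂ] L2E d}
    (hL : IsKernel L A) (hA : ContinuousLinearMap.adjoint A = A) (i : Fin 2) {n : ℕ}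
    (f : 𝓢(E d, ℝ)) (b a : Test d (n + 1)) :
    Integrable (fun x ↦ (f x : ℂ) * (((n : ℂ) + 1) * ∑ s : Fin n → Fin 2,
      inner ℂ (contract n (L x) (b.1 (Fin.cons i s)))
        (contract n (L x) (a.1 (Fin.cons i s))))) ∧
    inner ℂ (embN d (n + 1) b) (dGammaN i (A ∘L mulSchwartz f ∘L A) (n + 1) (embN d (n + 1) a)) =
      ∫ x, (f x : ℂ) * (((n : ℂ) + 1) * ∑ s : Fin n → Fin 2,
        inner ℂ (contract n (L x) (b.1 (Fin.cons i s)))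
          (contract n (L x) (a.1 (Fin.cons i s)))) := by
  have h1 (s : Fin n → Fin 2) :=
    hL.smear_contract f (b.1 (Fin.cons i s)) (a.1 (Fin.cons i s))
  have h2 (x : E d) : (f x : ℂ) * (((n : ℂ) + 1) * ∑ s : Fin n → Fin 2,
      inner ℂ (contract n (L x) (b.1 (Fin.cons i s))) (contract n (L x) (a.1 (Fin.cons i s)))) =
      ((n : ℂ) + 1) * ∑ s : Fin n → Fin 2, (f x : ℂ) *
      inner ℂ (contract n (L x) (b.1 (Fin.cons i s)))
        (contract n (L x) (a.1 (Fin.cons i s))) := by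
    rw [mul_left_comm, Finset.mul_sum]
  simp only [h2]
  refine ⟨(integrable_finsetSum _ fun s _ ↦ (h1 s).1).const_mul _, ?_⟩
  rw [integral_const_mul, integral_finsetSum _ fun s _ ↦ (h1 s).1, inner_dGammaN_succ]
  refine congrArg _ (Finset.sum_congr rfl fun s _ ↦ ?_)
  rw [← (h1 s).2, embN_apply, embN_apply, onFirst_comp, onFirst_comp]
  refine .trans ?_ (ContinuousLinearMap.adjoint_inner_right (onFirst n A) _ _)
  rw [onFirst_adjoint, hA]
  rfl

/-- The element of `(H_ℂ ⊕ H_ℂ)^{⊗ 2}` whose only nonvanishing component is `Θ`, the first factor of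
which lies in the copy number `1` of `H_ℂ` and the second one in the copy number `0`. -/
def pairTensor (Θ : L2 d 2) : Tensor d 2 := WithLp.toLp 2 fun s ↦ if s = ![1, 0] then Θ else 0

theorem pairTensor_apply (Θ : L2 d 2) (s : Fin 2 → Fin 2) :
    pairTensor Θ s = if s = ![1, 0] then Θ else 0 := rfl

theorem outer_zero {m n : ℕ} (b : L2 d n) : outer n (0 : L2 d m) b = 0 := by
  rw [← zero_smul ℂ (0 : L2 d m), outer_smul, zero_smul]

theorem inner_tensorLeft_pairTensor {n : ℕ} (Θ : L2 d 2) (v : Tensor d n) (u : Tensor d (n + 2)) :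
    inner ℂ (tensorLeft n (pairTensor Θ) v) u = (∑ s : Fin n → Fin 2,
      inner ℂ (outer n Θ (v s)) (u (Fin.cons 1 (Fin.cons 0 s))) : ℂ) := by
  have h (i j : Fin 2) (s : Fin n → Fin 2) :
      tensorLeft n (pairTensor Θ) v (Fin.cons i (Fin.cons j s)) =
        if i = 1 ∧ j = 0 then outer n Θ (v s) else 0 := by
    have h1 : (Fin.cons i (Fin.cons j s) : Fin (n + 2) → Fin 2) ∘ firstIdx 2 n = ![i, j] := by
      funext l
      fin_cases l <;> rfl
    have h2 : (Fin.cons i (Fin.cons j s) : Fin (n + 2) → Fin 2) ∘ lastIdx 2 n = s := rfl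
    have h3 : tensorLeft n (pairTensor Θ) v (Fin.cons i (Fin.cons j s)) =
        outer n (pairTensor Θ ((Fin.cons i (Fin.cons j s) : Fin (n + 2) → Fin 2) ∘ firstIdx 2 n))
          (v ((Fin.cons i (Fin.cons j s) : Fin (n + 2) → Fin 2) ∘ lastIdx 2 n)) := rfl
    have h4 : (![i, j] : Fin 2 → Fin 2) = ![1, 0] ↔ i = 1 ∧ j = 0 := by
      simp
    rw [h3, h1, h2, pairTensor_apply]
    simp only [h4]
    split_ifs
    · rfl
    · exact outer_zero _
  rw [inner_tensor, sum_cons, Fin.sum_univ_two, sum_cons, sum_cons, Fin.sum_univ_two,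
    Fin.sum_univ_two]
  simp only [h]
  simp

theorem inner_pairCreN {n : ℕ} (Θ : L2 d 2) (v : Fock d n) (u : Fock d (n + 2)) :
    inner ℂ (pairCreN (pairTensor Θ) n v) u =
      (((Real.sqrt ((n + 1) * (n + 2)) : ℝ) : ℂ) * ∑ s : Fin n → Fin 2,
        inner ℂ (outer n Θ ((v : Tensor d n) s))
          ((u : Tensor d (n + 2)) (Fin.cons 1 (Fin.cons 0 s))) : ℂ) := by
  have h1 : pairCreN (pairTensor Θ) n v = ((Real.sqrt ((n + 1) * (n + 2)) : ℝ) : ℂ) •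
      alt d (n + 2) (tensorLeft n (pairTensor Θ) (v : Tensor d n)) := rfl
  rw [h1, inner_fock, Submodule.coe_smul, inner_smul_left, ← inner_fock, inner_alt_left,
    Complex.conj_ofReal, inner_tensorLeft_pairTensor]

/-- The right-hand operator removes the first slot, in copy 1, with factor `√(n+2)`; the left-hand
one removes the next slot, in copy 0, with factor `√(n+1)`. This order agrees with the support `![1,
0]` of `pairTensor`, so no extra sign appears. -/
theorem inner_annN_annDN {n : ℕ} (g : L2E d) (F : 𝓢'(E d, ℂ)) (v : Fock d n) (a : Test d (n + 2)) :
    inner ℂ v (annN n (copy 0 g) (annDN (n + 1) (Pi.single 1 F) a)) =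
      (((Real.sqrt ((n + 1) * (n + 2)) : ℝ) : ℂ) * ∑ s : Fin n → Fin 2,
        inner ℂ (prodL n g ((v : Tensor d n) s))
          (contract (n + 1) (pairing F) (a.1 (Fin.cons 1 (Fin.cons 0 s)))) : ℂ) := by
  rw [inner_fock, inner_tensor, Finset.mul_sum]
  refine Finset.sum_congr rfl fun s _ ↦ ?_
  rw [coe_annN, PiLp.smul_apply, contrT_copy, annDN_single_apply, map_smul, smul_smul,
    inner_smul_right, Real.sqrt_mul (by positivity), Complex.ofReal_mul]
  congr 1
  · push_cast
    norm_num [add_assoc]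
  · exact ContinuousLinearMap.adjoint_inner_right (prodL n g) _ _

/-- By self-adjointness A moves from the kernel `(A ⊗ 1)Θ` onto the wave function a, where it
becomes contraction with `F x`; then `IsKernel.smear_pair` applies to each component. -/
theorem IsKernel.smear_pairCreN {F : E d → 𝓢'(E d, ℂ)} {A : L2E d →L[ℂ] L2E d}
    (hL : IsKernel (fun x ↦ pairing (F x)) A) (hA : ContinuousLinearMap.adjoint A = A)
    {f : 𝓢(E d, ℝ)} {g : E d → L2E d} {Θ : L2 d 2} (hΘ : IsPairFunction f g Θ) {n : ℕ}
    (v : Fock d n) (a : Test d (n + 2)) :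
    Integrable (fun x ↦ (f x : ℂ) *
      inner ℂ v (annN n (copy 0 (g x)) (annDN (n + 1) (Pi.single 1 (F x)) a))) ∧
    inner ℂ (pairCreN (pairTensor (onFirst 1 A Θ)) n v) (embN d (n + 2) a) =
      ∫ x, (f x : ℂ) *
        inner ℂ v (annN n (copy 0 (g x)) (annDN (n + 1) (Pi.single 1 (F x)) a)) := by
  have h1 (s : Fin n → Fin 2) :=
    hL.smear_pair hΘ ((v : Tensor d n) s) (a.1 (Fin.cons 1 (Fin.cons 0 s)))
  have h2 (x : E d) : (f x : ℂ) *
      inner ℂ v (annN n (copy 0 (g x)) (annDN (n + 1) (Pi.single 1 (F x)) a)) =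
      ((Real.sqrt ((n + 1) * (n + 2)) : ℝ) : ℂ) * ∑ s : Fin n → Fin 2, (f x : ℂ) *
        inner ℂ (prodL n (g x) ((v : Tensor d n) s))
          (contract (n + 1) (pairing (F x)) (a.1 (Fin.cons 1 (Fin.cons 0 s)))) := by
    rw [inner_annN_annDN, mul_left_comm, Finset.mul_sum]
  simp only [h2]
  refine ⟨(integrable_finsetSum _ fun s _ ↦ (h1 s).1).const_mul _, ?_⟩
  rw [integral_const_mul, integral_finsetSum _ fun s _ ↦ (h1 s).1, inner_pairCreN]
  refine congrArg _ (Finset.sum_congr rfl fun s _ ↦ ?_)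
  rw [← (h1 s).2, embN_apply, onFirst_outer]
  refine .trans ?_ (ContinuousLinearMap.adjoint_inner_left (onFirst (n + 1) A) _ _)
  rw [onFirst_adjoint, hA]

theorem IsKernel.smear_pairTensor {F : E d → 𝓢'(E d, ℂ)} {A : L2E d →L[ℂ] L2E d}
    (hL : IsKernel (fun x ↦ pairing (F x)) A) (hA : ContinuousLinearMap.adjoint A = A)
    {f : 𝓢(E d, ℝ)} {g : E d → L2E d} {Θ : L2 d 2} (hΘ : IsPairFunction f g Θ)
    (φ χ : Fin 2 → 𝓢(E d, ℂ)) :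
    Integrable (fun x ↦ (f x : ℂ) * (pairing (F x) (φ 1) * inner ℂ (g x) ((χ 0).toLp 2 volume))) ∧
    inner ℂ (pairTensor (onFirst 1 A Θ)) (tprod ![testPair φ, testPair χ]) =
      ∫ x, (f x : ℂ) * (pairing (F x) (φ 1) * inner ℂ (g x) ((χ 0).toLp 2 volume)) := by
  have h1 := hL.smear_pair_prod hΘ (φ 1) ((χ 0).toLp 2 volume)
  refine ⟨h1.1, .trans ?_ h1.2⟩
  have h2 : tprod ![testPair φ, testPair χ] ![1, 0] =
      (prodL 1 ((φ 1).toLp 2 volume) (oneVar ((χ 0).toLp 2 volume)) : L2 d 2) := by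
    rw [tprod_succ, oneLeft_apply]
    rfl
  rw [inner_tensor, Finset.sum_eq_single ![1, 0]]
  · rw [pairTensor_apply, if_pos rfl, h2, ← onFirst_prodL]
    refine .trans ?_ (ContinuousLinearMap.adjoint_inner_left (onFirst 1 A) _ _)
    rw [onFirst_adjoint, hA]
  · intro s _ hs
    rw [pairTensor_apply, if_neg hs, inner_zero_left]
  · simp

end Components

/-! ### Calculus of smeared operator families and the four terms of the density -/

section Smeared

variable {d : ℕ} {f : 𝓢(E d, ℝ)}

theorem IsSmeared.of_single {T : E d → TestFin d →ₗ[ℂ] TestDual d} {R : FockFin d →L[ℂ] FockFin d}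
    (h : ∀ (G : TestFin d) (n : ℕ) (b : Test d n),
      Integrable (fun x ↦ (f x : ℂ) * T x G (FinSum.single (V := fun n ↦ Test d n) n b)) ∧
      toDual d (R (emb d G)) (FinSum.single (V := fun n ↦ Test d n) n b) =
        ∫ x, (f x : ℂ) * T x G (FinSum.single (V := fun n ↦ Test d n) n b)) :
    IsSmeared f T R := fun G₁ G₂ ↦ by
  induction G₂ using FinSum.induction with
  | hs n b => exact h G₁ n b
  | ha u v hu hv =>
    have h1 : (fun x ↦ (f x : ℂ) * T x G₁ (u + v)) =
        fun x ↦ (f x : ℂ) * T x G₁ u + (f x : ℂ) * T x G₁ v := by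
      funext x
      rw [← mul_add]
      exact congrArg _ ((T x G₁).map_add u v)
    rw [h1]
    refine ⟨hu.1.add hv.1, ?_⟩
    rw [integral_add hu.1 hv.1, ← hu.2, ← hv.2]
    exact (toDual d (R (emb d G₁))).map_add u v

theorem IsSmeared.congr {T T' : E d → TestFin d →ₗ[ℂ] TestDual d}
    {R R' : FockFin d →L[ℂ] FockFin d} (h : IsSmeared f T R) (hT : ∀ x, T' x = T x) (hR : R' = R) :
    IsSmeared f T' R' := by
  rw [funext hT, hR]
  exact h

theorem IsSmeared.add {T T' : E d → TestFin d →ₗ[ℂ] TestDual d} {R R' : FockFin d →L[ℂ] FockFin d}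
    (h : IsSmeared f T R) (h' : IsSmeared f T' R') :
    IsSmeared f (fun x ↦ T x + T' x) (R + R') := fun G₁ G₂ ↦ by
  change Integrable (fun x ↦ (f x : ℂ) * (T x G₁ G₂ + T' x G₁ G₂)) ∧
    _ = ∫ x, (f x : ℂ) * (T x G₁ G₂ + T' x G₁ G₂)
  simp only [mul_add]
  refine ⟨(h G₁ G₂).1.add (h' G₁ G₂).1, ?_⟩
  rw [integral_add (h G₁ G₂).1 (h' G₁ G₂).1, ← (h G₁ G₂).2, ← (h' G₁ G₂).2]
  exact congrArg (fun z : TestDual d ↦ z G₂)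
    ((toDual d).map_add (R (emb d G₁)) (R' (emb d G₁)))

theorem IsSmeared.const_smul {T : E d → TestFin d →ₗ[ℂ] TestDual d}
    {R : FockFin d →L[ℂ] FockFin d} (h : IsSmeared f T R) (c : ℂ) :
    IsSmeared f (fun x ↦ c • T x) (c • R) := fun G₁ G₂ ↦ by
  change Integrable (fun x ↦ (f x : ℂ) * (c * T x G₁ G₂)) ∧
    _ = ∫ x, (f x : ℂ) * (c * T x G₁ G₂)
  simp only [mul_left_comm _ c]
  refine ⟨(h G₁ G₂).1.const_mul c, ?_⟩
  rw [integral_const_mul, ← (h G₁ G₂).2]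
  exact congrArg (fun z : TestDual d ↦ z G₂) ((toDual d).map_smul c (R (emb d G₁)))

theorem isSmeared_toDual (f : 𝓢(E d, ℝ)) :
    IsSmeared f (fun _ ↦ toDual d ∘ₗ (emb d : TestFin d →ₗ[ℂ] FockFin d))
      (((∫ x, f x : ℝ) : ℂ) • ContinuousLinearMap.id ℂ (FockFin d)) := fun G₁ G₂ ↦ by
  refine ⟨(f.integrable (μ := volume)).ofReal.mul_const _, ?_⟩
  rw [integral_mul_const, integral_complex_ofReal]
  exact congrArg (fun z : TestDual d ↦ z G₂) ((toDual d).map_smul _ (emb d G₁))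

/-- Since f is real, smearing commutes with taking formal adjoints. -/
theorem IsSmeared.of_conj {T T' : E d → TestFin d →ₗ[ℂ] TestDual d}
    {R R' : FockFin d →L[ℂ] FockFin d} (h : IsSmeared f T R)
    (hT : ∀ x G₁ G₂, T' x G₁ G₂ = conj (T x G₂ G₁))
    (hR : ∀ G₁ G₂, toDual d (R' (emb d G₁)) G₂ = conj (toDual d (R (emb d G₂)) G₁)) :
    IsSmeared f T' R' := fun G₁ G₂ ↦ by
  have h1 : (fun x ↦ (f x : ℂ) * T' x G₁ G₂) = fun x ↦ conj ((f x : ℂ) * T x G₂ G₁) :=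
    funext fun x ↦ by rw [hT, map_mul, Complex.conj_ofReal]
  rw [h1, integral_conj, ← (h G₂ G₁).2]
  exact ⟨Complex.conjCLE.integrable_comp_iff.2 (h G₂ G₁).1, hR G₁ G₂⟩

theorem IsSmeared.unique {T : E d → TestFin d →ₗ[ℂ] TestDual d} {R S : FockFin d →L[ℂ] FockFin d}
    (hR : IsSmeared f T R) (hS : IsSmeared f T S) : S = R :=
  eq_of_toDual_eq fun G₁ G₂ ↦ (hS G₁ G₂).2.trans (hR G₁ G₂).2.symm

/-- Smearing of `B(x)* B(x)`, where `B(x)` is the annihilation operator in the copy number `i` of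
`H_ℂ` given by contraction with the functional `L x`. -/
theorem IsKernel.isSmeared {L : E d → 𝓢(E d, ℂ) →L[ℂ] ℂ} {A : L2E d →L[ℂ] L2E d}
    (hL : IsKernel L A) (hA : ContinuousLinearMap.adjoint A = A) (i : Fin 2) (f : 𝓢(E d, ℝ))
    {B : E d → TestFin d →L[ℂ] FockFin d} {C : E d → (n : ℕ) → Test d (n + 1) →L[ℂ] Fock d n}
    (hC : ∀ x n G s, (C x n G : Tensor d n) s =
      ((Real.sqrt (n + 1) : ℝ) : ℂ) • contract n (L x) (G.1 (Fin.cons i s)))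
    (hB₀ : ∀ x b, B x (FinSum.single (V := fun n ↦ Test d n) 0 b) = 0)
    (hB : ∀ x n b, B x (FinSum.single (V := fun n ↦ Test d n) (n + 1) b) =
      FinSum.single (V := fun n ↦ Fock d n) n (C x n b))
    (hE : ∀ x G n, (B x G).entry n = C x n (G.entry (n + 1))) :
    IsSmeared f (fun x ↦ adj (B x) ∘ₗ (B x : TestFin d →ₗ[ℂ] FockFin d))
      (dGamma i (A ∘L mulSchwartz f ∘L A)) := by
  refine IsSmeared.of_single fun G n b ↦ ?_
  have h1 : toDual d (dGamma i (A ∘L mulSchwartz f ∘L A) (emb d G))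
      (FinSum.single (V := fun n ↦ Test d n) n b) =
      inner ℂ (embN d n b) (dGammaN i (A ∘L mulSchwartz f ∘L A) n (embN d n (G.entry n))) :=
    (toDual_apply _ _).trans ((congrArg (fun y ↦ fockInner y _) (emb_single n b)).trans
      ((fockInner_single_left _ n _).trans (congrArg (fun z ↦ (inner ℂ (embN d n b) z : ℂ))
        ((entry_dGamma i _ _ n).trans (congrArg _ (entry_emb G n))))))
  rw [h1]
  match n, b with
  | 0, b =>
    have h2 (x : E d) : (adj (B x) ∘ₗ (B x : TestFin d →ₗ[ℂ] FockFin d)) G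
        (FinSum.single (V := fun n ↦ Test d n) 0 b) = 0 :=
      (adj_apply _ _ _).trans ((congrArg (fun y ↦ fockInner y (B x G)) (hB₀ x b)).trans
        (fockInner_zero_left _))
    simp only [h2, mul_zero, integral_zero]
    exact ⟨integrable_zero _ _ _, inner_zero_right (𝕜 := ℂ) (embN d 0 b : Tensor d 0)⟩
  | n + 1, b =>
    have h2 (x : E d) : (adj (B x) ∘ₗ (B x : TestFin d →ₗ[ℂ] FockFin d)) G
        (FinSum.single (V := fun n ↦ Test d n) (n + 1) b) =
        ((n : ℂ) + 1) * ∑ s : Fin n → Fin 2, inner ℂ (contract n (L x) (b.1 (Fin.cons i s)))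
          (contract n (L x) ((G.entry (n + 1)).1 (Fin.cons i s))) :=
      (adj_apply _ _ _).trans ((congrArg (fun y ↦ fockInner y (B x G)) (hB x n b)).trans
        ((fockInner_single_left _ n _).trans ((congrArg (fun z ↦ (inner ℂ (C x n b) z : ℂ))
          (hE x G n)).trans (inner_of_components (hC x n b) (hC x n (G.entry (n + 1)))))))
    simp only [h2]
    exact hL.smear_dGammaN hA i f b (G.entry (n + 1))

theorem isSmeared_annD {F : E d → 𝓢'(E d, ℂ)} {A : L2E d →L[ℂ] L2E d}
    (hL : IsKernel (fun x ↦ pairing (F x)) A) (hA : ContinuousLinearMap.adjoint A = A) (i : Fin 2)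
    (f : 𝓢(E d, ℝ)) :
    IsSmeared f
      (fun x ↦ adj (annDCopy i (F x)) ∘ₗ (annDCopy i (F x) : TestFin d →ₗ[ℂ] FockFin d))
      (dGamma i (A ∘L mulSchwartz f ∘L A)) :=
  hL.isSmeared hA i f (C := fun x n ↦ annDN n (Pi.single i (F x)))
    (fun x _ G s ↦ annDN_single_apply i (F x) G s) (fun _ b ↦ annD_single_zero _ b)
    (fun _ n b ↦ annD_single_succ _ n b) fun _ G n ↦ entry_annD _ G n

theorem isSmeared_ann {g : E d → L2E d} {A : L2E d →L[ℂ] L2E d}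
    (hL : IsKernel (fun x ↦ innerTest (g x)) A) (hA : ContinuousLinearMap.adjoint A = A)
    (i : Fin 2) (f : 𝓢(E d, ℝ)) :
    IsSmeared f
      (fun x ↦ adj (annCopy i (g x) ∘L emb d) ∘ₗ
        (annCopy i (g x) ∘L emb d : TestFin d →ₗ[ℂ] FockFin d))
      (dGamma i (A ∘L mulSchwartz f ∘L A)) :=
  hL.isSmeared hA i f (C := fun x n ↦ annN n (copy i (g x)) ∘L embN d (n + 1))
    (fun x _ G s ↦ annN_copy_embN_apply i (g x) G s)
    (fun x b ↦ (congrArg (ann (copy i (g x))) (emb_single 0 b)).trans (ann_single_zero _ _))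
    (fun x n b ↦ (congrArg (ann (copy i (g x))) (emb_single (n + 1) b)).trans
      (ann_single_succ _ n _))
    fun x G n ↦ (entry_ann _ _ n).trans (congrArg (annN n (copy i (g x))) (entry_emb G (n + 1)))

theorem inner_copy (i : Fin 2) (g h : L2E d) : inner ℂ (copy i g) (copy i h) = (inner ℂ g h : ℂ) := by
  rw [PiLp.inner_apply, Finset.sum_eq_single i]
  · rw [copy_apply, copy_apply, if_pos rfl, if_pos rfl]
  · intro j _ hj
    rw [copy_apply, if_neg hj, inner_zero_left]
  · simp

/-- The anticommutation relation rewrites the family as the constant c minus `a*a` in weak form,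
with the second annihilation operator acting on the other test function. The constant smears to `c ∫
f`, the rest to `dΓ`. -/
theorem isSmeared_ann_cre {g : E d → L2E d} {A : L2E d →L[ℂ] L2E d} {c : ℂ}
    (hL : IsKernel (fun x ↦ innerTest (g x)) A) (hA : ContinuousLinearMap.adjoint A = A)
    (hc : ∀ x, inner ℂ (g x) (g x) = c) (i : Fin 2) (f : 𝓢(E d, ℝ)) :
    IsSmeared f
      (fun x ↦ toDual d ∘ₗ (annCopy i (g x) ∘L creCopy i (g x) ∘L emb d :
        TestFin d →L[ℂ] FockFin d))
      (c • (((∫ x, f x : ℝ) : ℂ) • ContinuousLinearMap.id ℂ (FockFin d)) +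
        (-1 : ℂ) • dGamma i (A ∘L mulSchwartz f ∘L A)) := by
  have h (x : E d) : toDual d ∘ₗ (annCopy i (g x) ∘L creCopy i (g x) ∘L emb d :
        TestFin d →L[ℂ] FockFin d) =
      c • (toDual d ∘ₗ (emb d : TestFin d →ₗ[ℂ] FockFin d)) +
        (-1 : ℂ) • (adj (annCopy i (g x) ∘L emb d) ∘ₗ
          (annCopy i (g x) ∘L emb d : TestFin d →ₗ[ℂ] FockFin d)) := by
    refine LinearMap.ext fun G₁ ↦ ContinuousLinearMap.ext fun G₂ ↦ ?_
    refine (toDual_apply (ann (copy i (g x)) (cre (copy i (g x)) (emb d G₁))) G₂).trans ?_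
    refine (ann_cre (copy i (g x)) (emb d G₁) (emb d G₂)).trans ?_
    refine (congrArg₂ (fun y z ↦ y * fockInner (emb d G₂) (emb d G₁) - z)
      ((inner_copy i (g x) (g x)).trans (hc x)) rfl).trans ?_
    refine Eq.trans ?_ (congrArg₂ (fun y z : ℂ ↦ c * y + -1 * z) (toDual_apply (emb d G₁) G₂)
      (adj_apply (annCopy i (g x) ∘L emb d) (ann (copy i (g x)) (emb d G₁)) G₂)).symm
    exact (sub_eq_add_neg _ _).trans (congrArg _ (neg_eq_neg_one_mul _))
  exact (((isSmeared_toDual f).const_smul c).add ((isSmeared_ann hL hA i f).const_smul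
    (-1))).congr h rfl

theorem isSmeared_ann_annD {F : E d → 𝓢'(E d, ℂ)} {A : L2E d →L[ℂ] L2E d}
    (hL : IsKernel (fun x ↦ pairing (F x)) A) (hA : ContinuousLinearMap.adjoint A = A)
    {g : E d → L2E d} {Θ : L2 d 2} (hΘ : IsPairFunction f g Θ) :
    IsSmeared f
      (fun x ↦ toDual d ∘ₗ (annCopy 0 (g x) ∘L annDCopy 1 (F x) : TestFin d →L[ℂ] FockFin d))
      (pairAnn (pairTensor (onFirst 1 A Θ))) := by
  refine IsSmeared.of_single fun G n b ↦ ?_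
  have h1 : toDual d (pairAnn (pairTensor (onFirst 1 A Θ)) (emb d G))
      (FinSum.single (V := fun n ↦ Test d n) n b) =
      inner ℂ (pairCreN (pairTensor (onFirst 1 A Θ)) n (embN d n b))
        (embN d (n + 2) (G.entry (n + 2))) :=
    (toDual_apply _ _).trans ((congrArg (fun y ↦ fockInner y _) (emb_single n b)).trans
      ((fockInner_single_left _ n _).trans ((congrArg (fun z ↦ (inner ℂ (embN d n b) z : ℂ))
        ((entry_pairAnn _ _ n).trans (congrArg _ (entry_emb G (n + 2))))).trans
          (ContinuousLinearMap.adjoint_inner_right _ _ _))))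
  have h2 (x : E d) : (toDual d ∘ₗ (annCopy 0 (g x) ∘L annDCopy 1 (F x) :
      TestFin d →L[ℂ] FockFin d)) G (FinSum.single (V := fun n ↦ Test d n) n b) =
      inner ℂ (embN d n b)
        (annN n (copy 0 (g x)) (annDN (n + 1) (Pi.single 1 (F x)) (G.entry (n + 2)))) :=
    (toDual_apply _ _).trans ((congrArg (fun y ↦ fockInner y _) (emb_single n b)).trans
      ((fockInner_single_left _ n _).trans (congrArg (fun z ↦ (inner ℂ (embN d n b) z : ℂ))
        ((entry_ann _ _ n).trans (congrArg _ (entry_annD _ G (n + 1)))))))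
  rw [h1]
  simp only [h2]
  exact hL.smear_pairCreN hA hΘ (embN d n b) (G.entry (n + 2))

/-- Obtained from the annihilation case by conjugation, so both pair operators share one kernel and
their adjointness needs no separate argument. -/
theorem isSmeared_creD_cre {F : E d → 𝓢'(E d, ℂ)} {A : L2E d →L[ℂ] L2E d}
    (hL : IsKernel (fun x ↦ pairing (F x)) A) (hA : ContinuousLinearMap.adjoint A = A)
    {g : E d → L2E d} {Θ : L2 d 2} (hΘ : IsPairFunction f g Θ) :
    IsSmeared f
      (fun x ↦ creDCopy 1 (F x) ∘ₗ (creCopy 0 (g x) ∘L emb d : TestFin d →L[ℂ] FockFin d))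
      (pairCre (pairTensor (onFirst 1 A Θ))) := by
  refine (isSmeared_ann_annD hL hA hΘ).of_conj (fun x G₁ G₂ ↦ ?_) fun G₁ G₂ ↦ ?_
  · have h1 : (creDCopy 1 (F x) ∘ₗ (creCopy 0 (g x) ∘L emb d : TestFin d →L[ℂ] FockFin d)) G₁ G₂ =
        fockInner (annD (Pi.single 1 (F x)) G₂) (cre (copy 0 (g x)) (emb d G₁)) :=
      adj_apply _ _ _
    have h2 : (toDual d ∘ₗ (annCopy 0 (g x) ∘L annDCopy 1 (F x) :
        TestFin d →L[ℂ] FockFin d)) G₂ G₁ =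
        fockInner (emb d G₁) (ann (copy 0 (g x)) (annD (Pi.single 1 (F x)) G₂)) :=
      toDual_apply _ _
    rw [h1, h2, ← fockInner_cre, conj_fockInner]
  · rw [toDual_apply, toDual_apply, fockInner_pairAnn, conj_fockInner]

theorem ρ_eq (k : MomentumDensity d) (x : E d) :
    ρ k x = ρ₁ k x + ρ₂ k x + ρ₃ k x + ρ₄ k x := by
  refine LinearMap.ext fun G ↦ ?_
  set u := annDCopy 1 (κ₂x k x) G
  set v := creCopy 0 (J (κ₁x k x)) (emb d G)
  have h1 := (creDCopy 1 (κ₂x k x)).map_add u v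
  have h2 := (toDual d ∘ₗ (annCopy 0 (J (κ₁x k x)) : FockFin d →ₗ[ℂ] FockFin d)).map_add u v
  refine (congrArg₂ (· + ·) h1 h2).trans ?_
  refine Eq.trans ?_ (add_assoc _ _ _).symm
  exact congrArg₂ (· + ·) (add_comm _ _) (add_comm _ _)

end Smeared

/-! ### Assembly of the decomposition -/

theorem sub_smul_smul_add_neg_smul {M : Type*} [AddCommGroup M] [Module ℂ M] (a b : ℂ) (x y : M) :
    (a * b) • x - (b • a • x + (-1 : ℂ) • y) = y := by
  rw [smul_smul, mul_comm b a, neg_one_smul, sub_add_eq_sub_sub, sub_self, zero_sub, neg_neg]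

theorem isSecondQuantization_A₁ {d : ℕ} (k : MomentumDensity d) (f : 𝓢(E d, ℝ)) :
    IsSecondQuantization (A₁ k f) (dGamma 0 (JKJ k ∘L mulSchwartz f ∘L JKJ k)) :=
  isSecondQuantization_dGamma 0 (JKJ k ∘L mulSchwartz f ∘L JKJ k)

theorem isSecondQuantization_A₁_sub {d : ℕ} (k : MomentumDensity d) (f : 𝓢(E d, ℝ)) (a b : ℝ) :
    IsSecondQuantization (A₁ k f) (((a * b : ℝ) : ℂ) • ContinuousLinearMap.id ℂ (FockFin d) -
      ((b : ℂ) • ((a : ℂ) • ContinuousLinearMap.id ℂ (FockFin d)) +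
        (-1 : ℂ) • dGamma 0 (JKJ k ∘L mulSchwartz f ∘L JKJ k))) := by
  rw [Complex.ofReal_mul]
  exact (sub_smul_smul_add_neg_smul (a : ℂ) (b : ℂ) (ContinuousLinearMap.id ℂ (FockFin d))
    (dGamma 0 (JKJ k ∘L mulSchwartz f ∘L JKJ k))).symm ▸ isSecondQuantization_A₁ k f

end FermiGas

end

theorem lemma3p1 (d : ℕ) (k : MomentumDensity d) (f : 𝓢(E d, ℝ)) :
    ∃ R R₁ R₂ R₃ R₄ : FockFin d →L[ℂ] FockFin d,
      (∀ S : FockFin d →L[ℂ] FockFin d, IsSmeared f (ρ k) S ↔ S = R) ∧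
      R = R₁ + R₂ + R₃ + R₄ ∧
      IsSmeared f (ρ₁ k) R₁ ∧ IsSmeared f (ρ₂ k) R₂ ∧
      IsSmeared f (ρ₃ k) R₃ ∧ IsSmeared f (ρ₄ k) R₄ ∧
      (∃ Ψ : Tensor d 2, IsPairKernel k f Ψ ∧ IsPairCreation Ψ R₁) ∧
      IsSecondQuantization (A₂ k f) R₂ ∧
      IsSecondQuantization (A₁ k f)
        ((((∫ x, f x) * ((2 * Real.pi) ^ (-(d : ℝ)) * ∫ p, k.khat p) : ℝ) : ℂ) •
          ContinuousLinearMap.id ℂ (FockFin d) - R₃) ∧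
      (∀ u v : FockFin d, fockInner u (R₄ v) = fockInner (R₁ u) v) := by
  -- The kernel Ψ of both pair operators is `(K₂ ⊗ 1)Θ`, placed in the component `![1, 0]`.
  obtain ⟨Θ, hΘ⟩ := exists_isPairFunction f k
  have h₁ : IsSmeared f (ρ₁ k) (pairCre (pairTensor (onFirst 1 (K₂ k) Θ))) :=
    isSmeared_creD_cre (isKernel_K₂ k) (adjoint_K₂ k) hΘ
  have h₂ : IsSmeared f (ρ₂ k) (dGamma 1 (K₂ k ∘L mulSchwartz f ∘L K₂ k)) :=
    isSmeared_annD (isKernel_K₂ k) (adjoint_K₂ k) 1 f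
  have h₃ := isSmeared_ann_cre (isKernel_JKJ k) (adjoint_JKJ k) (inner_J_κ₁x_self k) 0 f
  have h₄ : IsSmeared f (ρ₄ k) (pairAnn (pairTensor (onFirst 1 (K₂ k) Θ))) :=
    isSmeared_ann_annD (isKernel_K₂ k) (adjoint_K₂ k) hΘ
  have h := (((h₁.add h₂).add h₃).add h₄).congr (ρ_eq k) rfl
  exact ⟨_, _, _, _, _, fun S ↦ ⟨h.unique, fun hS ↦ hS ▸ h⟩, rfl, h₁, h₂, h₃, h₄,
    ⟨_, (isKernel_K₂ k).smear_pairTensor (adjoint_K₂ k) hΘ, isPairCreation_pairCre _⟩,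
    isSecondQuantization_dGamma 1 (K₂ k ∘L mulSchwartz f ∘L K₂ k),
    isSecondQuantization_A₁_sub k f _ _,
    fockInner_pairAnn (pairTensor (onFirst 1 (K₂ k) Θ))⟩
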